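/- **Setting.** Let $\Gamma=(V,E)$ be a finite directed graph without parallel edges (loops allowed) on $V=\{0,1,\dots,N\}$ that is strongly connected and aperiodic, and let $O:V\to\{-1,1\}$. Let $\Sigma=\{a\in V^{\mathbb N}:(a_i,a_{i+1})\in E\text{ for all }i\ge 0\}$, with shift $\sigma$. For $a,b\in\Sigma$ put $a<b$ iff there is $i\ge 0$ with $a_k=b_k$ for all $k<i$ and $\prod_{k<i}O(a_k)\,(a_i-b_i)<0$. A sequence $a\in\Sigma$ is *admissible* if $a_0=N$ and $\sigma^i(a)\le a$ for all $i\ge 0$. For finite words over $V$ put $\mathrm{sgn}(w)=\prod_k O(w_k)$, and $u<v$ iff there is $0\le j<\min(|u|,|v|)$ with $u_k=v_k$ for $k<j$ and $\prod_{k<j}O(u_k)\,(u_j-v_j)<0$; $u\le v$ means $u<v$ or $u=v$. A nonempty word $w$ is - *periodic* if $w^\infty\in\Sigma$ and $w$ starts with $N$; - *irreducible* if it is not a concatenation of two or more copies of one word; - *extremal* if it is periodic and $w^\infty$ is admissible; - *admissible* if it is extremal and $\mathrm{sgn}(w)=1$; - *dominant* if it is periodic and, for every $2\le k\le |w|$,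 the length-$k$ suffix of the word $wN$ is strictly smaller than the length-$k$ prefix of $w$. Let $W_n$ be the set of periodic words of length $n$, linearly ordered by $\le$. A pair $(a,a')$ in $W_n$ is a *tuning pair* if $a$ is admissible, $a'$ is extremal with $\mathrm{sgn}(a')=-1$, and $a'$ is the immediate successor of $a$ in $W_n$. $(\Gamma,O)$ is *tunable* (with the word $w_{\min}$) if 1. $w_{\min}$ is a periodic word containing the letter $N$ exactly once, $\mathrm{sgn}(w_{\min})=-1$, and $w_{\min}N\le c$ for every finite path $c$ of $\Gamma$ of length $|w_{\min}|+1$ (number of letters) that starts with $N$; 2. every extremal irreducible word $a$ with $\mathrm{sgn}(a)=-1$ either equals $w_{\min}^k$ for some odd $k$ or is a member of a tuning pair. A word $w$ is *renormalizable* if there are a tuning pair $(a,a')$ and a word $v$ over $\{0,1\}$ such that $w$ is obtained from $v$ by replacing each letter $0$ by $a$ and each letter $1$ by $a'$, where $v$ is admissible for the complete directed graph (with loops) on $\{0,1\}$ with signs $0\mapsto 1$, $1\mapsto -1$. **Theorem.** Assume that $(\Gamma,O)$ is tunable with the word $w_{\min}$. Let $w$ be an admissible, irreducible and non-renormalizable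 word that is not of the form $w_{\min}^k$. Then for every positive integer $n$ there is a word $b$ such that $w^nb$ is dominant. -/

import Mathlib

namespace KneadingWords

variable {N : ℕ}

/-- Finite words over the alphabet `V = {0, 1, …, N}`. -/
abbrev Word (N : ℕ) : Type := List (Fin (N + 1))

/-- The space `Σ` of infinite paths on the directed graph `Γ`. -/
def pathSpace (Γ : Digraph (Fin (N + 1))) : Set (ℕ → Fin (N + 1)) :=
  {a | ∀ n, Γ.Adj (a n) (a (n + 1))}

/-- The strict order on infinite sequences: at the first index where they differ, compare the
letters, with the orientation given by the sign of the common prefix. -/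
def SeqLT (O : Fin (N + 1) → ℤˣ) (a b : ℕ → Fin (N + 1)) : Prop :=
  ∃ n : ℕ, (∀ k < n, a k = b k) ∧
    (∏ k ∈ Finset.range n, (O (a k) : ℤ)) * (((a n : ℕ) : ℤ) - ((b n : ℕ) : ℤ)) < 0

/-- The non-strict order on infinite sequences. -/
def SeqLE (O : Fin (N + 1) → ℤˣ) (a b : ℕ → Fin (N + 1)) : Prop :=
  SeqLT O a b ∨ a = b

/-- Admissible infinite sequences: paths that start with `N` and dominate all their shifts. -/
def SeqAdmissible (Γ : Digraph (Fin (N + 1))) (O : Fin (N + 1) → ℤˣ)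
    (a : ℕ → Fin (N + 1)) : Prop :=
  a ∈ pathSpace Γ ∧ a 0 = Fin.last N ∧ ∀ n, SeqLE O (fun i => a (i + n)) a

/-- The sign of a finite word. -/
def sgn (O : Fin (N + 1) → ℤˣ) (w : Word N) : ℤ := (w.map fun c => (O c : ℤ)).prod

/-- The strict partial order on finite words: the words differ at some common index, and they
compare there according to the sign of the common prefix. -/
def WordLT (O : Fin (N + 1) → ℤˣ) (u v : Word N) : Prop :=
  ∃ (j : ℕ) (hu : j < u.length) (hv : j < v.length), u.take j = v.take j ∧
    sgn O (u.take j) * (((u[j] : ℕ) : ℤ) - ((v[j] : ℕ) : ℤ)) < 0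

/-- The non-strict partial order on finite words. -/
def WordLE (O : Fin (N + 1) → ℤˣ) (u v : Word N) : Prop := WordLT O u v ∨ u = v

/-- The `k`-fold concatenation `w ^ k`. -/
def wpow (w : Word N) (k : ℕ) : Word N := (List.replicate k w).flatten

/-- The infinite repetition `w ^ ∞` (only meaningful for nonempty `w`). -/
def repeatSeq (w : Word N) : ℕ → Fin (N + 1) := fun i => w.getD (i % w.length) 0

/-- A finite path on `Γ`: consecutive letters are joined by edges. -/
def IsPathWord (Γ : Digraph (Fin (N + 1))) (w : Word N) : Prop := List.IsChain Γ.Adj w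

/-- `w` is nonempty and `w ^ ∞` is a path, i.e. `w` lists the vertices of a closed walk. -/
def IsCyclicWord (Γ : Digraph (Fin (N + 1))) (w : Word N) : Prop :=
  w ≠ [] ∧ repeatSeq w ∈ pathSpace Γ

/-- `Γ` is strongly connected: there is a directed path from any vertex to any other one. -/
def StronglyConnected (Γ : Digraph (Fin (N + 1))) : Prop :=
  ∀ i j, Relation.ReflTransGen Γ.Adj i j

/-- `Γ` is aperiodic: the lengths of its closed walks have no common divisor except `1`. -/
def Aperiodic (Γ : Digraph (Fin (N + 1))) : Prop :=
  ∀ d : ℕ, (∀ w : Word N, IsCyclicWord Γ w → d ∣ w.length) → d = 1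

/-- Periodic words: `w ^ ∞ ∈ Σ` and `w` starts with `N`. -/
def Periodic (Γ : Digraph (Fin (N + 1))) (w : Word N) : Prop :=
  IsCyclicWord Γ w ∧ w.head? = some (Fin.last N)

/-- Irreducible words: not a concatenation of more than one copies of another word. -/
def IrreducibleWord (w : Word N) : Prop :=
  ¬ ∃ (u : Word N) (k : ℕ), 2 ≤ k ∧ w = wpow u k

/-- Extremal words: `w` is periodic and `w ^ ∞` is admissible. -/
def Extremal (Γ : Digraph (Fin (N + 1))) (O : Fin (N + 1) → ℤˣ) (w : Word N) : Prop :=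
  Periodic Γ w ∧ SeqAdmissible Γ O (repeatSeq w)

/-- Admissible words: extremal words of positive sign. -/
def Admissible (Γ : Digraph (Fin (N + 1))) (O : Fin (N + 1) → ℤˣ) (w : Word N) : Prop :=
  Extremal Γ O w ∧ sgn O w = 1

/-- Dominant words: `w` is periodic and, for `2 ≤ k ≤ |w|`, the length `k` suffix of `wN` is
strictly smaller than the length `k` prefix of `w`. -/
def Dominant (Γ : Digraph (Fin (N + 1))) (O : Fin (N + 1) → ℤˣ) (w : Word N) : Prop :=
  Periodic Γ w ∧ ∀ k, 2 ≤ k → k ≤ w.length →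
    WordLT O ((w ++ [Fin.last N]).rtake k) (w.take k)

/-- `b = Next(a)`: `b` is right above `a` in the set of periodic words of length `|a|`. -/
def IsNext (Γ : Digraph (Fin (N + 1))) (O : Fin (N + 1) → ℤˣ) (a b : Word N) : Prop :=
  Periodic Γ a ∧ Periodic Γ b ∧ a.length = b.length ∧ WordLT O a b ∧
    ¬ ∃ c : Word N, Periodic Γ c ∧ c.length = a.length ∧ WordLT O a c ∧ WordLT O c b

/-- `(a, a')` is a tuning pair. -/
def TuningPair (Γ : Digraph (Fin (N + 1))) (O : Fin (N + 1) → ℤˣ) (a a' : Word N) : Prop :=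
  Admissible Γ O a ∧ Extremal Γ O a' ∧ sgn O a' = -1 ∧ IsNext Γ O a a'

/-- The requirement on `w_min`: a periodic word of negative sign in which `N` occurs only once,
such that `w_min N` is minimal among the finite paths of its length that start with `N`. -/
def IsMinWord (Γ : Digraph (Fin (N + 1))) (O : Fin (N + 1) → ℤˣ) (m : Word N) : Prop :=
  Periodic Γ m ∧ m.count (Fin.last N) = 1 ∧ sgn O m = -1 ∧
    ∀ c : Word N, IsPathWord Γ c → c.head? = some (Fin.last N) → c.length = m.length + 1 →
      WordLE O (m ++ [Fin.last N]) c

/-- `(Γ, O)` is tunable, with `m` as the word `w_min`. -/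
def TunableWith (Γ : Digraph (Fin (N + 1))) (O : Fin (N + 1) → ℤˣ) (m : Word N) : Prop :=
  IsMinWord Γ O m ∧
    ∀ a : Word N, Extremal Γ O a → IrreducibleWord a → sgn O a = -1 →
      (∃ k : ℕ, Odd k ∧ a = wpow m k) ∨ ∃ c : Word N, TuningPair Γ O c a ∨ TuningPair Γ O a c

/-- The complete graph on `{0, 1}` (loops included), for the unimodal setting. -/
def unimodalGraph : Digraph (Fin (1 + 1)) := Digraph.completeDigraph (Fin (1 + 1))

/-- The signs of the unimodal setting: `0 ↦ 1`, `1 ↦ -1`. -/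
def unimodalSign : Fin (1 + 1) → ℤˣ := ![1, -1]

/-- The word obtained from a word `v` in `0`, `1` by replacing `0` with `a` and `1` with `a'`. -/
def tuning (a a' : Word N) (v : Word 1) : Word N :=
  v.flatMap fun c => if c = 0 then a else a'

/-- `w` is a tuning: `w = a * v` for a tuning pair `(a, a')` and a word `v` that is admissible in
the unimodal setting. -/
def Renormalizable (Γ : Digraph (Fin (N + 1))) (O : Fin (N + 1) → ℤˣ) (w : Word N) : Prop :=
  ∃ (a a' : Word N) (v : Word 1), TuningPair Γ O a a' ∧
    Admissible unimodalGraph unimodalSign v ∧ w = tuning a a' v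

end KneadingWords

/-!
Everything takes place in the linearly ordered space `Sq O` of sequences, in which prepending a
positive word is increasing and prepending a negative word is decreasing. Let `κ = w ^ ∞` and let
`m` be the minimal word. A word `u m ^ M` with large `M` is dominant as soon as `u m ^ ∞` strictly
dominates its shifts (`IsMinWord.exists_dominant`), so it is enough to find a sequence `c` ending in
`m ^ ∞` such that `w ^ n c` strictly dominates its shifts for large `n`. As `w` is irreducible, its
borders are negative, and such a `c` is one that does not exceed `κ` together with its shifts, and
that separates `κ` from the border tails: `t κ < c < κ` for each border `s` of `w = s t`
(`PrimeWord.exists_dominating`). Then `κ` is approximated from below by the sequences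
`w ^ n c`. This is the statement (`Approximable`) that is carried along an induction on the length
of `w`.

If all border tails are below `m ^ ∞`, then `c = m ^ ∞` will do. Otherwise let `ℓ` be the largest
border tail. The border before it is negative, extremal and irreducible. So `w` has a longest
proper prefix `f` with these properties, and tunability together with
`TuningPair.upper_eq_tuning` shows that `f` is tuned from a pair `(d, d')` whose lower word is not
renormalizable (`exists_outer_pair`). Then `d ^ ∞` is approximable, either by induction, applied to
the root of `d`, or because it is `m ^ ∞`; this is how `c` arises: its last part is an approximant
of `d ^ ∞`.

If `ℓ < d ^ ∞`, such an approximant is large enough to be `c`. If not, read `κ` in blocks `d` and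
`d'`. Occurrences of `d'` in `κ` can only begin where a block begins
(`PrimePair.below_of_suffix_lower`, `PrimePair.below_of_suffix_upper`), so if blocks filled a
period, then `w` would be tuned from `(d, d')`, hence renormalizable by monotonicity of the
substitution (`TuningPair.admissible_of_tuning`). Therefore there is a first gap: `κ = B x` where
`B` consists of blocks and `x` is strictly between `d` and `d'`. A prefix of `κ` that extends a
little beyond `B` still dominates its suffixes (`Gap.suffix_below`, `Gap.prolong`). If it is
negative, it is extremal, which contradicts the choice of `f`. If it is positive, then that prefix
followed by an approximant of `d ^ ∞` is the required `c`. The only exceptional position of the gap,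
right at the end of the period, is excluded in `PrimePair.false_of_root_power`.
-/

namespace KneadingWords

variable {N : ℕ} {O : Fin (N + 1) → ℤˣ}

/-! ### The ordered space of sequences -/

/-- Infinite sequences over the alphabet. The parameter `O` is only there so that the linear order
induced by the signs `O` can be an instance. -/
def Sq (_O : Fin (N + 1) → ℤˣ) : Type := ℕ → Fin (N + 1)

/-- The sequence of letters, each multiplied by the sign of the prefix before it. It turns the
twisted order into the lexicographic one. -/
def signedSeq (O : Fin (N + 1) → ℤˣ) (a : ℕ → Fin (N + 1)) : ℕ → ℤ :=
  fun n => (∏ k ∈ Finset.range n, (O (a k) : ℤ)) * ((a n : ℕ) : ℤ)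

lemma prod_sign_ne_zero (a : ℕ → Fin (N + 1)) (n : ℕ) :
    (∏ k ∈ Finset.range n, (O (a k) : ℤ)) ≠ 0 :=
  Finset.prod_ne_zero_iff.2 fun _ _ => Units.ne_zero _

lemma prod_sign_congr {a b : ℕ → Fin (N + 1)} {n : ℕ} (h : ∀ k < n, a k = b k) :
    (∏ k ∈ Finset.range n, (O (a k) : ℤ)) = ∏ k ∈ Finset.range n, (O (b k) : ℤ) :=
  Finset.prod_congr rfl fun k hk => by rw [h k (Finset.mem_range.1 hk)]

lemma eq_of_signedSeq_eq {a b : ℕ → Fin (N + 1)} {n : ℕ}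
    (h : ∀ k < n, signedSeq O a k = signedSeq O b k) : ∀ k < n, a k = b k := by
  intro k
  induction k using Nat.strong_induction_on with
  | _ k ih =>
    intro hk
    have h1 : ∀ l < k, a l = b l := fun l hl => ih l hl (hl.trans hk)
    have h2 := h k hk
    simp only [signedSeq] at h2
    rw [prod_sign_congr h1] at h2
    have h3 := mul_left_cancel₀ (prod_sign_ne_zero b k) h2
    exact Fin.ext (by exact_mod_cast h3)

lemma signedSeq_congr {a b : ℕ → Fin (N + 1)} {n : ℕ} (h : ∀ k < n, a k = b k) :
    ∀ k < n, signedSeq O a k = signedSeq O b k := by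
  intro k hk
  simp only [signedSeq]
  rw [prod_sign_congr fun l hl => h l (hl.trans hk), h k hk]

lemma signedSeq_injective : Function.Injective fun a : Sq O => toLex (signedSeq O a) := by
  intro a b h
  have h' : signedSeq O a = signedSeq O b := toLex.injective h
  funext n
  exact eq_of_signedSeq_eq (O := O) (n := n + 1) (fun k _ => by rw [h']) n (Nat.lt_succ_self n)

/-- The signed lexicographic order as a linear order. -/
noncomputable instance : LinearOrder (Sq O) :=
  LinearOrder.lift' (fun a : Sq O => toLex (signedSeq O a)) signedSeq_injective

lemma Sq.lt_iff {a b : Sq O} : a < b ↔ SeqLT O a b := by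
  have h : a < b ↔ toLex (signedSeq O a) < toLex (signedSeq O b) := Iff.rfl
  rw [h]
  constructor
  · rintro ⟨n, h1, h2⟩
    have h3 := eq_of_signedSeq_eq (O := O) (n := n) h1
    refine ⟨n, h3, ?_⟩
    rw [mul_sub, sub_neg]
    have h4 : signedSeq O a n < signedSeq O b n := h2
    simp only [signedSeq] at h4
    rwa [← prod_sign_congr h3] at h4
  · rintro ⟨n, h1, h2⟩
    refine ⟨n, signedSeq_congr h1, ?_⟩
    rw [mul_sub, sub_neg] at h2
    change signedSeq O a n < signedSeq O b n
    simp only [signedSeq]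
    rwa [← prod_sign_congr h1]

lemma Sq.le_iff {a b : Sq O} : a ≤ b ↔ SeqLE O a b := by
  rw [le_iff_lt_or_eq, Sq.lt_iff]; rfl

/-- The word `u` followed by the sequence `x`, written `u ⌢ x`. -/
def app (u : Word N) (x : Sq O) : Sq O :=
  fun i => if h : i < u.length then u[i] else x (i - u.length)

infixr:67 " ⌢ " => app

/-- The `n`-fold shift. -/
def dr (n : ℕ) (x : Sq O) : Sq O := fun i => x (i + n)

/-- The prefix of length `n`. -/
def tk (n : ℕ) (x : Sq O) : Word N := List.ofFn fun i : Fin n => x i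

lemma app_lt {u : Word N} {x : Sq O} {i : ℕ} (h : i < u.length) : (u ⌢ x) i = u[i] := by
  simp [app, h]

lemma app_add (u : Word N) (x : Sq O) (i : ℕ) : (u ⌢ x) (i + u.length) = x i := by
  simp [app]

@[simp] lemma nil_app (x : Sq O) : ([] : Word N) ⌢ x = x := by
  funext i; simp [app]

lemma append_app (u v : Word N) (x : Sq O) : (u ++ v) ⌢ x = u ⌢ (v ⌢ x) := by
  funext i
  simp only [app, List.length_append]
  by_cases h1 : i < u.length
  · simp [h1, Nat.lt_add_right, List.getElem_append_left]
  · by_cases h2 : i < u.length + v.length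
    · have h3 : i - u.length < v.length := by omega
      simp [h1, h2, h3, List.getElem_append_right (Nat.le_of_not_lt h1)]
    · have h3 : ¬ (i - u.length < v.length) := by omega
      simp [h1, h2, h3, Nat.sub_sub]

@[simp] lemma dr_zero (x : Sq O) : dr 0 x = x := rfl

lemma dr_dr (m n : ℕ) (x : Sq O) : dr m (dr n x) = dr (m + n) x := by
  funext i; simp [dr, add_assoc]

@[simp] lemma dr_app (u : Word N) (x : Sq O) : dr u.length (u ⌢ x) = x := by
  funext i; exact app_add u x i

lemma dr_length_add_app (u : Word N) (n : ℕ) (x : Sq O) : dr (u.length + n) (u ⌢ x) = dr n x := by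
  rw [add_comm, ← dr_dr, dr_app]

@[simp] lemma length_tk (n : ℕ) (x : Sq O) : (tk n x).length = n := by simp [tk]

@[simp] lemma getElem_tk {n i : ℕ} (x : Sq O) (h : i < (tk n x).length) : (tk n x)[i] = x i := by
  simp [tk]

@[simp] lemma tk_zero (x : Sq O) : tk 0 x = [] := by simp [tk]

@[simp] lemma tk_app_dr (n : ℕ) (x : Sq O) : tk n x ⌢ dr n x = x := by
  funext i
  by_cases h : i < n
  · rw [app_lt (by simpa using h)]; simp
  · have := app_add (tk n x) (dr n x) (i - n)
    simp only [length_tk] at this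
    rw [Nat.sub_add_cancel (by omega)] at this
    rw [this]; simp [dr, Nat.sub_add_cancel (Nat.le_of_not_lt h)]

@[simp] lemma tk_app (u : Word N) (x : Sq O) : tk u.length (u ⌢ x) = u := by
  apply List.ext_getElem (by simp)
  intro i h1 h2
  simp [app_lt h2]

lemma app_injective (u : Word N) : Function.Injective (app (O := O) u) := by
  intro x y h
  rw [← dr_app u x, h, dr_app]

lemma app_inj {u : Word N} {x y : Sq O} : u ⌢ x = u ⌢ y ↔ x = y := (app_injective u).eq_iff

lemma app_eq_app {u v : Word N} {x y : Sq O} (hl : u.length = v.length) (h : u ⌢ x = v ⌢ y) :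
    u = v ∧ x = y := by
  have h1 : u = v := by rw [← tk_app u x, h, hl, tk_app]
  subst h1
  exact ⟨rfl, app_injective u h⟩

lemma tk_eq_iff {n : ℕ} {x y : Sq O} : tk n x = tk n y ↔ ∀ i < n, x i = y i := by
  constructor
  · intro h i hi
    have h1 : i < (tk n x).length := by simpa using hi
    have h2 : i < (tk n y).length := by simpa using hi
    rw [← getElem_tk x h1, ← getElem_tk y h2]
    simp [h]
  · intro h
    apply List.ext_getElem (by simp)
    intro i h1 h2
    simpa using h i (by simpa using h1)

lemma tk_mono {m n : ℕ} (hmn : m ≤ n) {x y : Sq O} (h : tk n x = tk n y) : tk m x = tk m y :=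
  tk_eq_iff.2 fun i hi => tk_eq_iff.1 h i (hi.trans_le hmn)

/-- Taking prefixes of a concatenation, when the prefix ends inside the sequence. -/
lemma tk_length_add_app (u : Word N) (n : ℕ) (x : Sq O) :
    tk (u.length + n) (u ⌢ x) = u ++ tk n x := by
  have h : (u ++ tk n x) ⌢ dr n x = u ⌢ x := by rw [append_app, tk_app_dr]
  rw [← h]
  have := tk_app (O := O) (u ++ tk n x) (dr n x)
  simpa using this

lemma tk_add (m n : ℕ) (x : Sq O) : tk (m + n) x = tk m x ++ tk n (dr m x) := by
  have := tk_length_add_app (tk m x) n (dr m x)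
  simpa using this

lemma app_tk_congr (u : Word N) {n : ℕ} {x y : Sq O} (h : tk n x = tk n y) :
    tk (u.length + n) (u ⌢ x) = tk (u.length + n) (u ⌢ y) := by
  rw [tk_length_add_app, tk_length_add_app, h]

lemma exists_app_of_tk {u : Word N} {x : Sq O} (h : tk u.length x = u) : x = u ⌢ dr u.length x := by
  conv_lhs => rw [← tk_app_dr u.length x, h]

/-- Two words that are prefixes of one sequence are comparable. -/
lemma exists_append_of_app_eq {u v : Word N} {x y : Sq O} (h : u ⌢ x = v ⌢ y)
    (hl : u.length ≤ v.length) : ∃ t, v = u ++ t ∧ x = t ⌢ y := by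
  refine ⟨v.drop u.length, ?_⟩
  have h1 : v = v.take u.length ++ v.drop u.length := (List.take_append_drop _ _).symm
  rw [h1, append_app] at h
  have h2 : u.length = (v.take u.length).length := by simp [hl]
  obtain ⟨h3, h4⟩ := app_eq_app h2 h
  refine ⟨?_, h4⟩
  conv_lhs => rw [h1, ← h3]

/-! ### Signs and the order -/

@[simp] lemma sgn_nil : sgn O ([] : Word N) = 1 := rfl

@[simp] lemma sgn_append (u v : Word N) : sgn O (u ++ v) = sgn O u * sgn O v := by
  simp [sgn]

lemma sgn_eq_one_or (u : Word N) : sgn O u = 1 ∨ sgn O u = -1 := by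
  induction u with
  | nil => left; rfl
  | cons a u ih =>
    have h : sgn O (a :: u) = (O a : ℤ) * sgn O u := by simp [sgn]
    rcases Int.units_eq_one_or (O a) with h1 | h1 <;> rcases ih with h2 | h2 <;> simp [h, h1, h2]

lemma sgn_tk (n : ℕ) (x : Sq O) : sgn O (tk n x) = ∏ k ∈ Finset.range n, (O (x k) : ℤ) := by
  simp [sgn, tk, List.map_ofFn, List.prod_ofFn, Finset.prod_range]

/-- The order in terms of a common prefix and the letters that follow it. -/
lemma Sq.lt_iff_tk {a b : Sq O} : a < b ↔ ∃ n, tk n a = tk n b ∧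
    sgn O (tk n a) * (((a n : ℕ) : ℤ) - ((b n : ℕ) : ℤ)) < 0 := by
  rw [Sq.lt_iff]
  simp only [SeqLT, tk_eq_iff, sgn_tk]

lemma tk_eq_of_between {n : ℕ} {a b c : Sq O} (hab : a ≤ b) (hbc : b ≤ c) (h : tk n a = tk n c) :
    tk n b = tk n a := by
  by_contra hne
  have h1 : a < b := lt_of_le_of_ne hab fun e => hne (by rw [e])
  have h2 : b < c := lt_of_le_of_ne hbc fun e => hne (by rw [e, h])
  obtain ⟨i, hi, hi'⟩ := Sq.lt_iff_tk.1 h1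
  obtain ⟨j, hj, hj'⟩ := Sq.lt_iff_tk.1 h2
  have hin : i < n := by
    by_contra hc
    exact hne (tk_mono (Nat.le_of_not_lt hc) hi).symm
  have hjn : j < n := by
    by_contra hc
    exact hne ((tk_mono (Nat.le_of_not_lt hc) hj).trans h.symm)
  have hac := tk_eq_iff.1 h
  rcases lt_trichotomy i j with hij | hij | hij
  · rw [tk_eq_iff.1 hj i hij, hac i hin] at hi'
    simp at hi'
  · subst hij
    rw [← hac i hin, ← hi] at hj'
    have : sgn O (tk i a) * (((a i : ℕ) : ℤ) - ((b i : ℕ) : ℤ)) +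
      sgn O (tk i a) * (((b i : ℕ) : ℤ) - ((a i : ℕ) : ℤ)) = 0 := by ring
    linarith
  · rw [← tk_eq_iff.1 hi j hij, hac j hjn] at hj'
    simp at hj'

/-- The set of sequences with prefix `u` is convex. -/
lemma exists_app_of_between {u : Word N} {x y z : Sq O} (h1 : u ⌢ x ≤ z) (h2 : z ≤ u ⌢ y) :
    ∃ z', z = u ⌢ z' := by
  have h := tk_eq_of_between (n := u.length) h1 h2 (by simp)
  rw [tk_app] at h
  exact ⟨_, exists_app_of_tk h⟩

/-- A strict inequality depends on finitely many letters only. -/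
lemma Sq.lt_local {a b : Sq O} (h : a < b) : ∃ J, tk J a ≠ tk J b ∧ ∀ a' b' : Sq O,
    tk J a' = tk J a → tk J b' = tk J b → a' < b' := by
  obtain ⟨n, h1, h2⟩ := Sq.lt_iff_tk.1 h
  refine ⟨n + 1, ?_, fun a' b' ha hb => ?_⟩
  · intro e
    rw [tk_eq_iff.1 e n (Nat.lt_succ_self n)] at h2
    simp at h2
  · have ha' := tk_mono (Nat.le_succ n) ha
    have hb' := tk_mono (Nat.le_succ n) hb
    refine Sq.lt_iff_tk.2 ⟨n, by rw [ha', hb', h1], ?_⟩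
    rw [ha', tk_eq_iff.1 ha n (Nat.lt_succ_self n), tk_eq_iff.1 hb n (Nat.lt_succ_self n)]
    exact h2

lemma Sq.lt_of_tk {n : ℕ} {a b a' b' : Sq O} (h : a < b) (hne : tk n a ≠ tk n b)
    (ha : tk n a' = tk n a) (hb : tk n b' = tk n b) : a' < b' := by
  by_contra hc
  rw [not_lt] at hc
  -- `b'` and `a'` lie in the cylinders of `b` and `a`, which are convex and disjoint
  rcases le_total a b' with h1 | h1
  · have := tk_eq_of_between h1 hc ha.symm
    exact hne (this.symm.trans hb)
  · have := tk_eq_of_between h1 h.le hb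
    exact hne (this.trans hb)

lemma app_lt_app_pos {u : Word N} (hu : sgn O u = 1) {x y : Sq O} : u ⌢ x < u ⌢ y ↔ x < y := by
  have key : ∀ x y : Sq O, x < y → u ⌢ x < u ⌢ y := by
    intro x y h
    obtain ⟨n, h1, h2⟩ := Sq.lt_iff_tk.1 h
    refine Sq.lt_iff_tk.2 ⟨u.length + n, app_tk_congr u h1, ?_⟩
    rw [tk_length_add_app, sgn_append, hu, one_mul, add_comm u.length n, app_add, app_add]
    exact h2
  refine ⟨fun h => ?_, key x y⟩
  rcases lt_trichotomy x y with h1 | h1 | h1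
  · exact h1
  · exact absurd h (by rw [h1]; exact lt_irrefl _)
  · exact absurd (key _ _ h1) (not_lt.2 h.le)

lemma app_lt_app_neg {u : Word N} (hu : sgn O u = -1) {x y : Sq O} : u ⌢ x < u ⌢ y ↔ y < x := by
  have key : ∀ x y : Sq O, x < y → u ⌢ y < u ⌢ x := by
    intro x y h
    obtain ⟨n, h1, h2⟩ := Sq.lt_iff_tk.1 h
    refine Sq.lt_iff_tk.2 ⟨u.length + n, (app_tk_congr u h1).symm, ?_⟩
    rw [tk_length_add_app, sgn_append, hu, add_comm u.length n, app_add, app_add, ← h1]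
    have : -1 * sgn O (tk n x) * (((y n : ℕ) : ℤ) - ((x n : ℕ) : ℤ)) =
      sgn O (tk n x) * (((x n : ℕ) : ℤ) - ((y n : ℕ) : ℤ)) := by ring
    rw [this]; exact h2
  refine ⟨fun h => ?_, key y x⟩
  rcases lt_trichotomy y x with h1 | h1 | h1
  · exact h1
  · exact absurd h (by rw [h1]; exact lt_irrefl _)
  · exact absurd (key _ _ h1) (not_lt.2 h.le)

lemma app_le_app_pos {u : Word N} (hu : sgn O u = 1) {x y : Sq O} : u ⌢ x ≤ u ⌢ y ↔ x ≤ y := by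
  rw [← not_lt, app_lt_app_pos hu, not_lt]

lemma app_le_app_neg {u : Word N} (hu : sgn O u = -1) {x y : Sq O} : u ⌢ x ≤ u ⌢ y ↔ y ≤ x := by
  rw [← not_lt, app_lt_app_neg hu, not_lt]

lemma first_le_of_le {x y : Sq O} (h : x ≤ y) : x 0 ≤ y 0 := by
  by_contra hc
  rw [not_le] at hc
  refine absurd h (not_le.2 (Sq.lt_iff_tk.2 ⟨0, by simp, ?_⟩))
  have : ((y 0 : ℕ) : ℤ) < ((x 0 : ℕ) : ℤ) := by exact_mod_cast hc
  rw [tk_zero, sgn_nil]; linarith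

lemma lt_of_first_lt {x y : Sq O} (h : x 0 < y 0) : x < y := by
  by_contra hc
  exact absurd (first_le_of_le (not_lt.1 hc)) (not_le.2 h)

lemma first_eq_last_of_le {x y : Sq O} (h : x ≤ y) (hx : x 0 = Fin.last N) : y 0 = Fin.last N :=
  le_antisymm (Fin.le_last _) (hx ▸ first_le_of_le h)

lemma app_first {u : Word N} (hu : u ≠ []) (x y : Sq O) : (u ⌢ x) 0 = (u ⌢ y) 0 := by
  have h : 0 < u.length := List.length_pos_iff.2 hu
  rw [app_lt h, app_lt h]

/-! ### Comparing a sequence with a cylinder -/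

/-- `x` is strictly below every sequence with prefix `u`, written `x ≪ u`. Unlike `x < u ⌢ z`,
this only depends on the first `u.length` letters of `x`. -/
def Below (x : Sq O) (u : Word N) : Prop := ∀ z, x < u ⌢ z

/-- `x` is strictly above every sequence with prefix `u`, written `u ⋘ x`. -/
def Above (u : Word N) (x : Sq O) : Prop := ∀ z, u ⌢ z < x

infix:50 " ≪ " => Below
infix:50 " ⋘ " => Above

lemma below_or (x : Sq O) (u : Word N) : x ≪ u ∨ (∃ z, x = u ⌢ z) ∨ u ⋘ x := by
  by_cases h : ∃ z, x = u ⌢ z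
  · exact Or.inr (Or.inl h)
  · by_cases h1 : x ≪ u
    · exact Or.inl h1
    · refine Or.inr (Or.inr fun z => ?_)
      simp only [Below, not_forall, not_lt] at h1
      obtain ⟨z', hz'⟩ := h1
      by_contra hc
      exact h (exists_app_of_between hz' (not_lt.1 hc))

lemma below_of_le {x : Sq O} {u : Word N} {z : Sq O} (h : x ≤ u ⌢ z) (hne : ∀ y, x ≠ u ⌢ y) :
    x ≪ u := by
  rcases below_or x u with h1 | ⟨y, hy⟩ | h1
  · exact h1
  · exact absurd hy (hne y)
  · exact absurd (h1 z) (not_lt.2 h)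

lemma above_of_le {x : Sq O} {u : Word N} {z : Sq O} (h : u ⌢ z ≤ x) (hne : ∀ y, x ≠ u ⌢ y) :
    u ⋘ x := by
  rcases below_or x u with h1 | ⟨y, hy⟩ | h1
  · exact absurd (h1 z) (not_lt.2 h)
  · exact absurd hy (hne y)
  · exact h1

lemma Below.append {x : Sq O} {u : Word N} (h : x ≪ u) (v : Word N) : x ≪ u ++ v := fun z => by
  rw [append_app]; exact h _

lemma Above.append {x : Sq O} {u : Word N} (h : u ⋘ x) (v : Word N) : u ++ v ⋘ x := fun z => by
  rw [append_app]; exact h _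

lemma Below.congr {x y : Sq O} {u : Word N} {n : ℕ} (h : x ≪ u) (hn : u.length ≤ n)
    (hxy : tk n x = tk n y) : y ≪ u := by
  intro z
  refine Sq.lt_of_tk (n := u.length) (h z) ?_ (tk_mono hn hxy.symm) rfl
  intro e
  rw [tk_app] at e
  have h2 := h (dr u.length x)
  rw [← exists_app_of_tk e] at h2
  exact lt_irrefl _ h2

lemma Below.not_app {x : Sq O} {u : Word N} (h : x ≪ u) (z : Sq O) : x ≠ u ⌢ z := fun e =>
  absurd (h z) (by rw [e]; exact lt_irrefl _)

lemma Above.not_app {x : Sq O} {u : Word N} (h : u ⋘ x) (z : Sq O) : x ≠ u ⌢ z := fun e =>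
  absurd (h z) (by rw [e]; exact lt_irrefl _)

lemma not_below {x : Sq O} {u : Word N} (h : ¬ x ≪ u) : ∃ z, u ⌢ z ≤ x := by
  simpa [Below] using h

lemma not_above {x : Sq O} {u : Word N} (h : ¬ u ⋘ x) : ∃ z, x ≤ u ⌢ z := by
  simpa [Above] using h

/-- Words of one length whose cylinders interleave are equal. -/
lemma eq_of_interleave {u v : Word N} (hl : u.length = v.length) {a b c d : Sq O}
    (h1 : u ⌢ a ≤ v ⌢ b) (h2 : v ⌢ c ≤ u ⌢ d) : u = v := by
  rcases below_or (u ⌢ a) v with h | ⟨z, hz⟩ | h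
  · have h3 := tk_eq_of_between (h c).le h2 (n := u.length) (by simp)
    rw [tk_app, hl, tk_app] at h3
    exact h3.symm
  · exact (app_eq_app hl hz).1
  · exact absurd (h b) (not_lt.2 h1)

/-! ### Periodic sequences -/

/-- The periodic sequence `u ^ ∞`. -/
def per (O : Fin (N + 1) → ℤˣ) (u : Word N) : Sq O := repeatSeq u

lemma per_apply {u : Word N} (hu : u ≠ []) (i : ℕ) :
    per O u i = u[i % u.length]'(Nat.mod_lt _ (List.length_pos_iff.2 hu)) := by
  simp only [per, repeatSeq]
  exact (List.getElem_eq_getD _).symm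

lemma app_per {u : Word N} (hu : u ≠ []) : u ⌢ per O u = per O u := by
  funext i
  by_cases h : i < u.length
  · rw [app_lt h, per_apply hu]; simp [Nat.mod_eq_of_lt h]
  · have h1 : i = (i - u.length) + u.length := by omega
    rw [h1, app_add, per_apply hu, per_apply hu]
    simp

lemma dr_per {u : Word N} (hu : u ≠ []) : dr u.length (per O u) = per O u := by
  conv_lhs => rw [← app_per hu]
  rw [dr_app]

lemma tk_per {u : Word N} (hu : u ≠ []) : tk u.length (per O u) = u := by
  conv_lhs => rw [← app_per hu]
  rw [tk_app]

lemma dr_mul_of_dr {n : ℕ} {x : Sq O} (h : dr n x = x) (k : ℕ) : dr (k * n) x = x := by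
  induction k with
  | zero => simp
  | succ k ih => rw [Nat.succ_mul, ← dr_dr, h, ih]

lemma eq_of_blocks {u : Word N} (hu : u ≠ []) {x y : Sq O}
    (hx : ∀ n, tk u.length (dr (n * u.length) x) = u)
    (hy : ∀ n, tk u.length (dr (n * u.length) y) = u) : x = y := by
  funext i
  have hl := List.length_pos_iff.2 hu
  have h1 := tk_eq_iff.1 ((hx (i / u.length)).trans (hy (i / u.length)).symm) (i % u.length)
    (Nat.mod_lt _ hl)
  simp only [dr] at h1
  have h2 : i % u.length + i / u.length * u.length = i := by
    rw [mul_comm]; exact Nat.mod_add_div _ _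
  rwa [h2] at h1

lemma eq_per_of_blocks {u : Word N} (hu : u ≠ []) {x : Sq O}
    (hx : ∀ n, tk u.length (dr (n * u.length) x) = u) : x = per O u :=
  eq_of_blocks hu hx fun n => by rw [dr_mul_of_dr (dr_per hu), tk_per hu]

lemma eq_per {u : Word N} (hu : u ≠ []) {x : Sq O} (hx : x = u ⌢ x) : x = per O u := by
  have h1 : dr u.length x = x := by conv_lhs => rw [hx, dr_app]
  refine eq_per_of_blocks hu fun n => ?_
  rw [dr_mul_of_dr h1, hx, tk_app]

lemma ne_nil_of_append {u v : Word N} (h : u ≠ []) : u ++ v ≠ [] := by simp [h]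

lemma dr_per_append {q s : Word N} (h : q ++ s ≠ []) :
    dr q.length (per O (q ++ s)) = s ⌢ per O (q ++ s) := by
  conv_lhs => rw [← app_per h, append_app, dr_app]

/-- Rotating a word shifts its periodic sequence. -/
lemma per_rotate {q s : Word N} (h : q ++ s ≠ []) : per O (s ++ q) = s ⌢ per O (q ++ s) := by
  have h' : s ++ q ≠ [] := by simpa [and_comm] using h
  refine (eq_per h' ?_).symm
  conv_lhs => rw [← app_per h]
  simp only [append_app]

@[simp] lemma wpow_zero (u : Word N) : wpow u 0 = [] := rfl

lemma wpow_succ (u : Word N) (k : ℕ) : wpow u (k + 1) = u ++ wpow u k := by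
  simp [wpow, List.replicate_succ]

@[simp] lemma wpow_one (u : Word N) : wpow u 1 = u := by simp [wpow]

lemma wpow_add (u : Word N) (k l : ℕ) : wpow u (k + l) = wpow u k ++ wpow u l := by
  rw [wpow, List.replicate_add, List.flatten_append]; rfl

lemma wpow_succ' (u : Word N) (k : ℕ) : wpow u (k + 1) = wpow u k ++ u := by
  rw [wpow_add, wpow_one]

@[simp] lemma length_wpow (u : Word N) (k : ℕ) : (wpow u k).length = k * u.length := by
  simp [wpow]

lemma wpow_mul (u : Word N) (k l : ℕ) : wpow (wpow u k) l = wpow u (k * l) := by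
  induction l with
  | zero => simp
  | succ l ih => rw [wpow_succ, ih, ← wpow_add]; congr 1; ring

lemma sgn_wpow (u : Word N) (k : ℕ) : sgn O (wpow u k) = sgn O u ^ k := by
  induction k with
  | zero => simp
  | succ k ih => rw [wpow_succ, sgn_append, ih, pow_succ']

lemma wpow_app_of_app {u : Word N} {x : Sq O} (h : u ⌢ x = x) (k : ℕ) : wpow u k ⌢ x = x := by
  induction k with
  | zero => simp
  | succ k ih => rw [wpow_succ, append_app, ih, h]

lemma wpow_ne_nil {u : Word N} (hu : u ≠ []) {k : ℕ} (hk : k ≠ 0) : wpow u k ≠ [] := by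
  intro e
  have h1 := congrArg List.length e
  have h2 := List.length_pos_iff.2 hu
  rw [length_wpow, List.length_nil] at h1
  rcases Nat.mul_eq_zero.1 h1 with h3 | h3 <;> omega

lemma per_wpow {u : Word N} (hu : u ≠ []) {k : ℕ} (hk : k ≠ 0) : per O (wpow u k) = per O u :=
  (eq_per (wpow_ne_nil hu hk) (wpow_app_of_app (app_per hu) k).symm).symm

lemma dr_sub_of_dr {a b : ℕ} (hab : a ≤ b) {x : Sq O} (ha : dr a x = x) (hb : dr b x = x) :
    dr (b - a) x = x := by
  conv_lhs => rw [← ha, dr_dr, Nat.sub_add_cancel hab]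
  exact hb

lemma dr_mod_of_dr {a b : ℕ} {x : Sq O} (ha : dr a x = x) (hb : dr b x = x) :
    dr (b % a) x = x := by
  have h := dr_sub_of_dr (Nat.div_mul_le_self b a) (dr_mul_of_dr ha (b / a)) hb
  rwa [show b - b / a * a = b % a by
    have := Nat.mod_add_div b a
    rw [mul_comm] at this
    omega] at h

lemma dr_shift_of_dr {p : ℕ} {x : Sq O} (hp : dr p x = x) (n : ℕ) : dr p (dr n x) = dr n x := by
  rw [dr_dr, Nat.add_comm, ← dr_dr, hp]

/-- A shift of a `p`-periodic sequence can be shifted back. -/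
lemma exists_dr_back {p : ℕ} (hp : 0 < p) {x : Sq O} (h : dr p x = x) (n : ℕ) :
    ∃ k, dr k (dr n x) = x := by
  refine ⟨n * p - n, ?_⟩
  rw [dr_dr, Nat.sub_add_cancel (Nat.le_mul_of_pos_right n hp)]
  exact dr_mul_of_dr h n

lemma dr_of_dr_dr {p q n : ℕ} (hp : 0 < p) {x : Sq O} (h : dr p x = x)
    (hq : dr q (dr n x) = dr n x) : dr q x = x := by
  obtain ⟨k, hk⟩ := exists_dr_back hp h n
  have := dr_shift_of_dr hq k
  rwa [hk] at this

/-- The minimal period of `u ^ ∞` for an irreducible word `u` is its length. -/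
lemma IrreducibleWord.dr_ne {u : Word N} (hirr : IrreducibleWord u) {i : ℕ} (hi : 0 < i)
    (hi' : i < u.length) : dr i (per O u) ≠ per O u := by
  intro h
  have hu : u ≠ [] := by
    rintro rfl; simp at hi'
  classical
  have hex : ∃ g, 0 < g ∧ dr g (per O u) = per O u := ⟨i, hi, h⟩
  obtain ⟨hg, hg'⟩ := Nat.find_spec hex
  have hmin : ∀ j, 0 < j → dr j (per O u) = per O u → Nat.find hex ≤ j :=
    fun j h1 h2 => Nat.find_min' hex ⟨h1, h2⟩
  have hle := hmin i hi h
  generalize Nat.find hex = g at hg hg' hmin hle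
  have hdvd : g ∣ u.length := by
    rw [Nat.dvd_iff_mod_eq_zero]
    by_contra hne
    have := hmin _ (Nat.pos_of_ne_zero hne) (dr_mod_of_dr hg' (dr_per hu))
    exact absurd (Nat.mod_lt u.length hg) (not_lt.2 this)
  obtain ⟨k, hk⟩ := hdvd
  refine hirr ⟨tk g (per O u), k, ?_, ?_⟩
  · by_contra hc
    have : k = 0 ∨ k = 1 := by omega
    rcases this with rfl | rfl
    · simp at hk; exact hu hk
    · omega
  · have h1 : tk g (per O u) ⌢ per O u = per O u := by
      conv_lhs => arg 2; rw [← hg']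
      exact tk_app_dr g _
    have h2 := wpow_app_of_app h1 k
    have h3 : u ⌢ per O u = wpow (tk g (per O u)) k ⌢ per O u := by rw [h2, app_per hu]
    exact (app_eq_app (by simp [hk, mul_comm]) h3).1

lemma irreducible_of_dr_ne {u : Word N} (hu : u ≠ [])
    (h : ∀ i, 0 < i → i < u.length → dr i (per O u) ≠ per O u) : IrreducibleWord u := by
  rintro ⟨v, k, hk, rfl⟩
  have hv : v ≠ [] := by
    rintro rfl
    exact hu (by simp [wpow])
  have hl := List.length_pos_iff.2 hv
  refine h v.length hl ?_ ?_
  · rw [length_wpow]; nlinarith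
  · rw [per_wpow hv (by omega), dr_per hv]

/-- Every word is a power of an irreducible one. -/
lemma exists_root {u : Word N} (hu : u ≠ []) :
    ∃ e k, e ≠ [] ∧ IrreducibleWord e ∧ 0 < k ∧ u = wpow e k := by
  induction hn : u.length using Nat.strong_induction_on generalizing u with
  | _ n ih =>
    by_cases hirr : IrreducibleWord u
    · exact ⟨u, 1, hu, hirr, one_pos, by simp⟩
    · simp only [IrreducibleWord, not_not] at hirr
      obtain ⟨v, k, hk, rfl⟩ := hirr
      have hv : v ≠ [] := by
        rintro rfl
        exact hu (by simp [wpow])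
      have hl := List.length_pos_iff.2 hv
      obtain ⟨e, l, he, h1, h2, rfl⟩ := ih v.length (by rw [← hn, length_wpow]; nlinarith) hv rfl
      exact ⟨e, l * k, he, h1, Nat.mul_pos h2 (by omega), wpow_mul e l k⟩

/-! ### Comparison with a fixed point of a positive word -/

/-- The map `z ↦ s ⌢ z` for positive `s` pulls sequences above its fixed point downwards. -/
lemma app_lt_self_of_lt {s : Word N} (hs : s ≠ []) (hp : sgn O s = 1) {x z : Sq O}
    (hx : s ⌢ x = x) (hz : x < z) : s ⌢ z < z := by
  by_contra hc
  rw [not_lt] at hc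
  have h1 : ∀ n, z ≤ wpow s n ⌢ z := by
    intro n
    induction n with
    | zero => simp
    | succ n ih =>
      rw [wpow_succ, append_app]
      exact hc.trans ((app_le_app_pos hp).2 ih)
  obtain ⟨J, -, hJ⟩ := Sq.lt_local hz
  refine absurd (hJ (wpow s J ⌢ z) z ?_ rfl) (not_lt.2 (h1 J))
  have h2 : J ≤ (wpow s J).length := by
    have := List.length_pos_iff.2 hs
    rw [length_wpow]; nlinarith
  conv_rhs => rw [← wpow_app_of_app hx J]
  exact tk_mono h2 (by rw [tk_app, tk_app])

lemma self_lt_app_of_lt {s : Word N} (hs : s ≠ []) (hp : sgn O s = 1) {x z : Sq O}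
    (hx : s ⌢ x = x) (hz : z < x) : z < s ⌢ z := by
  by_contra hc
  rw [not_lt] at hc
  have h1 : ∀ n, wpow s n ⌢ z ≤ z := by
    intro n
    induction n with
    | zero => simp
    | succ n ih =>
      rw [wpow_succ, append_app]
      exact ((app_le_app_pos hp).2 ih).trans hc
  obtain ⟨J, -, hJ⟩ := Sq.lt_local hz
  refine absurd (hJ z (wpow s J ⌢ z) rfl ?_) (not_lt.2 (h1 J))
  have h2 : J ≤ (wpow s J).length := by
    have := List.length_pos_iff.2 hs
    rw [length_wpow]; nlinarith
  conv_rhs => rw [← wpow_app_of_app hx J]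
  exact tk_mono h2 (by rw [tk_app, tk_app])

/-- A sequence that dominates its shifts and lies above the fixed point of a positive word does not
start with this word. -/
lemma not_app_of_lt {s : Word N} (hs : s ≠ []) (hp : sgn O s = 1) {x z : Sq O}
    (hx : s ⌢ x = x) (hz : x < z) (hmax : ∀ n, dr n z ≤ z) (y : Sq O) : z ≠ s ⌢ y := by
  intro e
  have h1 : y ≤ z := by
    have := hmax s.length
    rwa [e, dr_app, ← e] at this
  have h2 := (app_le_app_pos hp).2 h1
  rw [← e] at h2
  exact absurd (app_lt_self_of_lt hs hp hx hz) (not_lt.2 h2)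

/-! ### Paths and closed words -/

/-- Being an infinite path on the graph. -/
def IsPath (Γ : Digraph (Fin (N + 1))) (x : Sq O) : Prop := ∀ n, Γ.Adj (x n) (x (n + 1))

lemma IsPath.dr {x : Sq O} (h : IsPath Γ x) (n : ℕ) : IsPath Γ (dr n x) := fun i => by
  have := h (i + n)
  simpa [KneadingWords.dr, add_right_comm] using this

lemma IsPath.of_app {u : Word N} {x : Sq O} (h : IsPath Γ (u ⌢ x)) : IsPath Γ x := by
  have := h.dr u.length
  rwa [dr_app] at this

/-- A tail of a path can be exchanged for another path that starts with the same letter. -/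
lemma IsPath.exchange {u : Word N} {x y : Sq O} (h : IsPath Γ (u ⌢ x)) (hy : IsPath Γ y)
    (h0 : y 0 = x 0) : IsPath Γ (u ⌢ y) := by
  intro n
  by_cases h1 : n + 1 < u.length
  · have := h n
    rw [app_lt h1, app_lt (by omega)] at this ⊢
    exact this
  · by_cases h2 : n + 1 = u.length
    · have := h n
      have e : ∀ z : Sq O, (u ⌢ z) (n + 1) = z 0 := fun z => by
        have := app_add u z 0
        rwa [zero_add, ← h2] at this
      rw [e, app_lt (by omega)] at this ⊢
      rwa [h0]
    · obtain ⟨k, hk⟩ : ∃ k, n = k + u.length := ⟨n - u.length, by omega⟩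
      subst hk
      have e : k + u.length + 1 = (k + 1) + u.length := by omega
      rw [e, app_add, app_add]
      exact hy k

/-- Closed words start at `N` and can be followed by any path from `N`. -/
def IsClosedWord (Γ : Digraph (Fin (N + 1))) (O : Fin (N + 1) → ℤˣ) (u : Word N) : Prop :=
  u ≠ [] ∧ (∀ x : Sq O, (u ⌢ x) 0 = Fin.last N) ∧
    ∀ x : Sq O, IsPath Γ x → x 0 = Fin.last N → IsPath Γ (u ⌢ x)

lemma Periodic.ne_nil {u : Word N} (h : Periodic Γ u) : u ≠ [] := h.1.1

lemma Periodic.isPath {u : Word N} (h : Periodic Γ u) : IsPath Γ (per O u) := h.1.2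

lemma Periodic.app_first {u : Word N} (h : Periodic Γ u) (x : Sq O) :
    (u ⌢ x) 0 = Fin.last N := by
  obtain ⟨h1, h2⟩ := h
  cases u with
  | nil => exact absurd rfl h1.1
  | cons a u => simpa [app] using h2

lemma Periodic.per_first {u : Word N} (h : Periodic Γ u) : per O u 0 = Fin.last N := by
  rw [← app_per h.ne_nil]; exact h.app_first _

lemma Periodic.isClosedWord {u : Word N} (h : Periodic Γ u) : IsClosedWord Γ O u := by
  refine ⟨h.ne_nil, h.app_first, fun x hx hx0 => ?_⟩
  refine IsPath.exchange (x := per O u) ?_ hx ?_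
  · rw [app_per h.ne_nil]; exact h.isPath
  · rw [hx0, h.per_first]

/-- A word that closes up along some path is periodic. -/
lemma periodic_of_isPath {u : Word N} (hu : u ≠ []) {x : Sq O} (h : IsPath Γ (u ⌢ x))
    (h0 : (u ⌢ x) 0 = Fin.last N) (hx : x 0 = Fin.last N) : Periodic Γ u := by
  have hl := List.length_pos_iff.2 hu
  have hhead : u[0] = Fin.last N := by rw [← h0, app_lt hl]
  refine ⟨⟨hu, ?_⟩, ?_⟩
  · intro n
    change Γ.Adj (per O u n) (per O u (n + 1))
    rw [per_apply hu, per_apply hu]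
    have h1 := Nat.mod_lt n hl
    by_cases h2 : n % u.length + 1 < u.length
    · have h3 : (n + 1) % u.length = n % u.length + 1 := by
        rw [Nat.add_mod, Nat.mod_eq_of_lt (show 1 < u.length by omega), Nat.mod_eq_of_lt h2]
      have := h (n % u.length)
      rw [app_lt h2, app_lt h1] at this
      simpa [h3] using this
    · have h3 : n % u.length + 1 = u.length := by omega
      have h4 : (n + 1) % u.length = 0 := by
        rw [Nat.add_mod]
        rcases Nat.lt_or_ge 1 u.length with h5 | h5
        · rw [Nat.mod_eq_of_lt h5, h3, Nat.mod_self]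
        · have : u.length = 1 := by omega
          rw [this]; exact Nat.mod_one _
      have := h (n % u.length)
      rw [app_lt h1] at this
      have e : (u ⌢ x) (n % u.length + 1) = x 0 := by
        have := app_add u x 0
        rwa [zero_add, ← h3] at this
      rw [e, hx, ← hhead] at this
      simpa [h4] using this
  · cases u with
    | nil => exact absurd rfl hu
    | cons a u => simpa using hhead

lemma IsClosedWord.periodic {u : Word N} (h : IsClosedWord Γ O u) {x : Sq O} (hx : IsPath Γ x)
    (hx0 : x 0 = Fin.last N) : Periodic Γ u :=
  periodic_of_isPath h.1 (h.2.2 x hx hx0) (h.2.1 x) hx0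

lemma IsClosedWord.append {u v : Word N} (hu : IsClosedWord Γ O u) (hv : IsClosedWord Γ O v) :
    IsClosedWord Γ O (u ++ v) := by
  refine ⟨ne_nil_of_append hu.1, fun x => ?_, fun x hx hx0 => ?_⟩
  · rw [append_app]; exact hu.2.1 _
  · rw [append_app]; exact hu.2.2 _ (hv.2.2 x hx hx0) (hv.2.1 x)

lemma Periodic.append {u v : Word N} (hu : Periodic Γ u) (hv : Periodic Γ v) :
    Periodic Γ (u ++ v) :=
  (hu.isClosedWord.append (O := fun _ => 1) hv.isClosedWord).periodic hu.isPath hu.per_first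

lemma Periodic.wpow {u : Word N} (hu : Periodic Γ u) {k : ℕ} (hk : 0 < k) :
    Periodic Γ (wpow u k) := by
  induction k with
  | zero => omega
  | succ k ih =>
    rcases Nat.eq_zero_or_pos k with rfl | h
    · simpa using hu
    · rw [wpow_succ]; exact hu.append (ih h)

/-- Cutting a periodic word off its front. -/
lemma Periodic.of_append {u v : Word N} (h : Periodic Γ (u ++ v)) (hv : v ≠ [])
    (h0 : ∀ x : Sq O, (v ⌢ x) 0 = Fin.last N) : Periodic Γ v := by
  have h1 : IsPath Γ (per O (u ++ v)) := h.isPath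
  rw [← app_per h.ne_nil, append_app] at h1
  exact periodic_of_isPath hv h1.of_app (h0 _) h.per_first

/-- Rotations of a periodic word to another occurrence of `N` are periodic. -/
lemma Periodic.rotate {q s : Word N} (h : Periodic Γ (q ++ s)) (hs : s ≠ [])
    (h0 : ∀ x : Sq O, (s ⌢ x) 0 = Fin.last N) : Periodic Γ (s ++ q) := by
  rcases eq_or_ne q [] with rfl | hq
  · simpa using h
  have h1 : IsPath Γ (per O (s ++ q)) := by
    rw [per_rotate h.ne_nil]
    have := (h.isPath (O := O)).dr q.length
    rwa [dr_per_append h.ne_nil] at this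
  have h2 : per O (s ++ q) 0 = Fin.last N := by
    rw [← app_per (ne_nil_of_append hs), append_app]; exact h0 _
  refine periodic_of_isPath (O := O) (x := per O (s ++ q)) (ne_nil_of_append hs) ?_ ?_ h2
  · rwa [app_per (ne_nil_of_append hs)]
  · rwa [app_per (ne_nil_of_append hs)]

lemma Extremal.periodic {u : Word N} (h : Extremal Γ O u) : Periodic Γ u := h.1

lemma Extremal.dr_le {u : Word N} (h : Extremal Γ O u) (n : ℕ) : dr n (per O u) ≤ per O u :=
  Sq.le_iff.2 (h.2.2.2 n)

lemma extremal_of_dr_le {u : Word N} (h : Periodic Γ u) (hle : ∀ n, dr n (per O u) ≤ per O u) :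
    Extremal Γ O u :=
  ⟨h, h.1.2, h.per_first (O := O), fun n => Sq.le_iff.1 (hle n)⟩

/-- For extremality it suffices to compare the shifts within one period. -/
lemma dr_le_of_lt_length {u : Word N} (hu : u ≠ [])
    (h : ∀ i, 0 < i → i < u.length → dr i (per O u) ≤ per O u) (n : ℕ) :
    dr n (per O u) ≤ per O u := by
  have h1 : dr n (per O u) = dr (n % u.length) (per O u) := by
    conv_lhs => rw [← Nat.mod_add_div n u.length, ← dr_dr, mul_comm, dr_mul_of_dr (dr_per hu)]
  rw [h1]
  rcases Nat.eq_zero_or_pos (n % u.length) with h2 | h2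
  · rw [h2]; simp
  · exact h _ h2 (Nat.mod_lt _ (List.length_pos_iff.2 hu))

lemma Extremal.wpow {u : Word N} (h : Extremal Γ O u) {k : ℕ} (hk : 0 < k) :
    Extremal Γ O (wpow u k) := by
  refine extremal_of_dr_le (h.periodic.wpow hk) ?_
  rw [per_wpow h.periodic.ne_nil hk.ne']
  exact h.dr_le

lemma Extremal.of_wpow {u : Word N} {k : ℕ} (h : Extremal Γ O (KneadingWords.wpow u k)) :
    Extremal Γ O u := by
  have hk : k ≠ 0 := by
    rintro rfl
    exact h.periodic.ne_nil rfl
  have hu : u ≠ [] := by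
    rintro rfl
    exact h.periodic.ne_nil (by simp [KneadingWords.wpow])
  have h1 := h.periodic.isPath (O := O)
  have h2 := h.periodic.per_first (O := O)
  have h3 := h.dr_le
  rw [per_wpow hu hk] at h1 h2 h3
  refine extremal_of_dr_le (periodic_of_isPath (x := per O u) hu ?_ ?_ h2) h3
  · rwa [app_per hu]
  · rwa [app_per hu]

/-- The shift of `(q ++ s) ^ ∞` to its suffix `s` is at most the sequence itself. -/
lemma Extremal.suffix_le {q s : Word N} (h : Extremal Γ O (q ++ s)) :
    s ⌢ per O (q ++ s) ≤ per O (q ++ s) := by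
  rw [← dr_per_append h.periodic.ne_nil]; exact h.dr_le _

/-! ### Word order and sequence order -/

lemma take_tk {j k : ℕ} (h : j ≤ k) (x : Sq O) : (tk k x).take j = tk j x := by
  obtain ⟨l, rfl⟩ := Nat.exists_eq_add_of_le h
  rw [tk_add]
  have : (tk j x).length = j := by simp
  conv_lhs => arg 1; rw [← this]
  rw [List.take_left]

lemma wordLT_tk_iff {k : ℕ} {x y : Sq O} :
    WordLT O (tk k x) (tk k y) ↔ x < y ∧ tk k x ≠ tk k y := by
  constructor
  · rintro ⟨j, hu, hv, h1, h2⟩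
    have hj : j < k := by simpa using hu
    rw [take_tk hj.le, take_tk hj.le] at h1
    rw [take_tk hj.le, getElem_tk, getElem_tk] at h2
    refine ⟨Sq.lt_iff_tk.2 ⟨j, h1, h2⟩, fun e => ?_⟩
    rw [tk_eq_iff.1 e j hj] at h2
    simp at h2
  · rintro ⟨h1, h2⟩
    obtain ⟨j, h3, h4⟩ := Sq.lt_iff_tk.1 h1
    have hj : j < k := by
      by_contra hc
      exact h2 (tk_mono (not_lt.1 hc) h3)
    refine ⟨j, by simpa using hj, by simpa using hj, ?_, ?_⟩
    · rw [take_tk hj.le, take_tk hj.le, h3]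
    · rw [take_tk hj.le, getElem_tk, getElem_tk]; exact h4

lemma wordLT_iff_app_lt {u v : Word N} (hl : u.length = v.length) (x y : Sq O) :
    WordLT O u v ↔ u ⌢ x < v ⌢ y ∧ u ≠ v := by
  have h := wordLT_tk_iff (k := u.length) (x := u ⌢ x) (y := v ⌢ y)
  rw [tk_app] at h
  rwa [hl, tk_app] at h

/-! ### Tuning pairs -/

lemma TuningPair.length_eq {d d' : Word N} (h : TuningPair Γ O d d') : d.length = d'.length :=
  h.2.2.2.2.2.1

lemma TuningPair.app_lt {d d' : Word N} (h : TuningPair Γ O d d') (x y : Sq O) :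
    d ⌢ x < d' ⌢ y :=
  ((wordLT_iff_app_lt h.length_eq x y).1 h.2.2.2.2.2.2.1).1

lemma TuningPair.ext {d d' : Word N} (h : TuningPair Γ O d d') : Extremal Γ O d := h.1.1

lemma TuningPair.ext' {d d' : Word N} (h : TuningPair Γ O d d') : Extremal Γ O d' := h.2.1

lemma TuningPair.sgn_lower {d d' : Word N} (h : TuningPair Γ O d d') : sgn O d = 1 := h.1.2

lemma TuningPair.sgn_upper {d d' : Word N} (h : TuningPair Γ O d d') : sgn O d' = -1 :=
  h.2.2.1

lemma TuningPair.ne_nil {d d' : Word N} (h : TuningPair Γ O d d') : d ≠ [] := h.ext.periodic.ne_nil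

lemma TuningPair.ne_nil' {d d' : Word N} (h : TuningPair Γ O d d') : d' ≠ [] :=
  h.ext'.periodic.ne_nil

lemma TuningPair.app_per_lower {d d' : Word N} (h : TuningPair Γ O d d') : d ⌢ per O d = per O d :=
  app_per h.ne_nil

lemma TuningPair.per_lt_app {d d' : Word N} (h : TuningPair Γ O d d') (x : Sq O) :
    per O d < d' ⌢ x := by
  rw [← h.app_per_lower]; exact h.app_lt _ _

lemma TuningPair.per_lt_per {d d' : Word N} (h : TuningPair Γ O d d') : per O d < per O d' := by
  rw [← app_per h.ne_nil']; exact h.per_lt_app _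

/-- There is no periodic word between the two words of a tuning pair. -/
lemma TuningPair.trichotomy {d d' u : Word N} (h : TuningPair Γ O d d') (hu : Periodic Γ u)
    (hl : u.length = d.length) :
    u = d ∨ u = d' ∨ (∀ x y : Sq O, u ⌢ x < d ⌢ y) ∨ ∀ x y : Sq O, d' ⌢ x < u ⌢ y := by
  by_cases h1 : u = d
  · exact Or.inl h1
  by_cases h2 : u = d'
  · exact Or.inr (Or.inl h2)
  have hl' : u.length = d'.length := hl.trans h.length_eq
  by_cases h3 : WordLT O d u
  · by_cases h4 : WordLT O u d'
    · exact absurd ⟨u, hu, hl, h3, h4⟩ h.2.2.2.2.2.2.2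
    · refine Or.inr (Or.inr (Or.inr fun x y => ?_))
      by_contra hc
      refine h4 ((wordLT_iff_app_lt hl' y x).2 ⟨lt_of_le_of_ne (not_lt.1 hc) fun e => ?_, h2⟩)
      exact h2 (app_eq_app hl' e).1
  · refine Or.inr (Or.inr (Or.inl fun x y => ?_))
    by_contra hc
    refine h3 ((wordLT_iff_app_lt hl.symm y x).2
      ⟨lt_of_le_of_ne (not_lt.1 hc) fun e => ?_, Ne.symm h1⟩)
    exact h1 (app_eq_app hl e.symm).1

/-- A tuning pair whose upper word has no proper period. In the tunable case this holds for every
tuning pair, see `TuningPair.primePair`. -/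
structure PrimePair (Γ : Digraph (Fin (N + 1))) (O : Fin (N + 1) → ℤˣ) (d d' : Word N) : Prop where
  pair : TuningPair Γ O d d'
  dr_ne : ∀ i, 0 < i → i < d'.length → dr i (per O d') ≠ per O d'

lemma PrimePair.dr_lt {d d' : Word N} (h : PrimePair Γ O d d') {i : ℕ} (hi : 0 < i)
    (hi' : i < d'.length) : dr i (per O d') < per O d' :=
  lt_of_le_of_ne (h.pair.ext'.dr_le i) (h.dr_ne i hi hi')

/-- A proper rotation of the upper word of a tuning pair is negative and smaller than the upper
word, so it is smaller than the lower word. -/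
lemma PrimePair.rotate_lt {d g t : Word N} (h : PrimePair Γ O d (g ++ t)) (hg : g ≠ [])
    (ht : t ≠ []) (h0 : ∀ x : Sq O, (t ⌢ x) 0 = Fin.last N) (x y : Sq O) :
    t ⌢ g ⌢ x < d ⌢ y := by
  have hlg := List.length_pos_iff.2 hg
  have hlt := List.length_pos_iff.2 ht
  have hper : Periodic Γ (t ++ g) := h.pair.ext'.periodic.rotate ht h0
  have hne : t ++ g ≠ [] := hper.ne_nil
  have h1 : per O (t ++ g) < per O (g ++ t) := by
    rw [per_rotate h.pair.ne_nil', ← dr_per_append h.pair.ne_nil']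
    exact h.dr_lt hlg (by simp [hlt])
  have hl : (t ++ g).length = d.length := by
    rw [h.pair.length_eq]; simp [add_comm]
  rcases h.pair.trichotomy hper hl with h2 | h2 | h2 | h2
  · have h3 := h.pair.sgn_lower
    have h4 := h.pair.sgn_upper
    rw [← h2, sgn_append, mul_comm, ← sgn_append, h4] at h3
    norm_num at h3
  · rw [h2] at h1; exact absurd h1 (lt_irrefl _)
  · rw [← append_app]; exact h2 x y
  · have := h2 (per O (g ++ t)) (per O (t ++ g))
    rw [app_per h.pair.ne_nil', app_per hne] at this
    exact absurd h1 (not_lt.2 this.le)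

lemma first_of_app_first {t : Word N} (ht : t ≠ []) {x : Sq O} (h : (t ⌢ x) 0 = Fin.last N)
    (y : Sq O) : (t ⌢ y) 0 = Fin.last N := by
  rw [app_first ht y x, h]

/-- If the upper word of a tuning pair is `g t` with `g` negative, then the sequences starting with
`t` are smaller than the periodic sequence of the lower word. -/
lemma PrimePair.suffix_app_lt {d g t : Word N} (h : PrimePair Γ O d (g ++ t)) (hg : sgn O g = -1)
    (ht : t ≠ []) (x : Sq O) : t ⌢ x < per O d := by
  have hg0 : g ≠ [] := by
    rintro rfl
    norm_num at hg
  by_contra hc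
  rw [not_lt] at hc
  have h0 := first_of_app_first (O := O) ht
    (first_eq_last_of_le hc (h.pair.ext.periodic.per_first (O := O)))
  have h1 := h.rotate_lt hg0 ht h0
  have h2 := (h1 x (per O d)).le
  rw [h.pair.app_per_lower] at h2
  obtain ⟨τ, hτ⟩ := exists_app_of_between h2 hc
  have hl := h.pair.length_eq
  rw [List.length_append] at hl
  obtain ⟨z, hz, -⟩ := exists_append_of_app_eq (O := O) (u := t) (v := d) (x := τ) (y := per O d)
    (by rw [h.pair.app_per_lower, hτ]) (by omega)
  have hst : sgn O t = 1 := by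
    have h4 := h.pair.sgn_upper
    rw [sgn_append, hg] at h4
    linarith
  have hgz : ∀ x y : Sq O, g ⌢ x < z ⌢ y := fun x y => by
    have := h1 x y
    rwa [hz, append_app, app_lt_app_pos hst] at this
  have h5 : z ⌢ per O d ≤ per O d := by
    have := h.pair.ext
    rw [hz] at this ⊢
    exact this.suffix_le
  have h6 := h.pair.per_lt_app x
  rw [append_app] at h6
  exact absurd ((hgz (t ⌢ x) (per O d)).trans_le h5) (not_lt.2 h6.le)

/-- After a proper nonempty suffix of `d` or `d'`, a sequence that is at least `d ^ ∞` leads to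
something smaller than `d'`: occurrences of `d'` are aligned. -/
lemma PrimePair.below_of_suffix_lower {q s d' : Word N} (h : PrimePair Γ O (q ++ s) d')
    (hs : s ≠ []) {y : Sq O} (hy : per O (q ++ s) ≤ y) : s ⌢ y ≪ d' := by
  by_contra hc
  obtain ⟨z, hz⟩ := not_below hc
  set δ := per O (q ++ s) with hδ
  have h1 : s ⌢ δ ≤ δ := h.pair.ext.suffix_le
  have h2 : δ < d' ⌢ z := h.pair.per_lt_app z
  obtain ⟨τ, hτ⟩ := exists_app_of_between h1 (h2.le.trans hz)
  have hτδ : τ ≤ δ := by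
    have := h.pair.ext.dr_le s.length
    rwa [← hδ, hτ, dr_app, ← hτ] at this
  rcases sgn_eq_one_or (O := O) s with hp | hn
  · have h3 : δ ≤ τ := by
      conv_lhs at h1 => rw [hδ]
      conv_rhs at h1 => rw [hτ]
      exact (app_le_app_pos hp).1 h1
    have h4 : τ = δ := le_antisymm hτδ h3
    rw [h4] at hτ
    obtain ⟨z', hz'⟩ := exists_app_of_between (hτ ▸ h2.le) hz
    have hl := h.pair.length_eq
    rw [List.length_append] at hl
    obtain ⟨t, ht, -⟩ := exists_append_of_app_eq hz'.symm (by omega)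
    refine not_app_of_lt hs hp hτ.symm h.pair.per_lt_per h.pair.ext'.dr_le (t ⌢ per O d') ?_
    rw [← append_app, ← ht, app_per h.pair.ne_nil']
  · have h3 := h2.trans_le hz
    rw [hτ] at h3
    have h4 := (app_lt_app_neg hn).1 h3
    exact absurd (hτδ.trans hy) (not_le.2 h4)

lemma PrimePair.below_of_suffix_upper {q s d : Word N} (h : PrimePair Γ O d (q ++ s))
    (hs : s ≠ []) (hq : q ≠ []) {y : Sq O} (hy : per O d ≤ y) : s ⌢ y ≪ q ++ s := by
  by_contra hc
  obtain ⟨z, hz⟩ := not_below hc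
  have hlq := List.length_pos_iff.2 hq
  have hls := List.length_pos_iff.2 hs
  set δ := per O (q ++ s) with hδ
  have h1 : s ⌢ δ ≤ δ := h.pair.ext'.suffix_le
  -- `s` is also a prefix of the upper word
  obtain ⟨t, ht⟩ : ∃ t, q ++ s = s ++ t := by
    have e : ∀ x : Sq O, (q ++ s) ⌢ x =
        (q ++ s).take s.length ⌢ ((q ++ s).drop s.length ⌢ x) := fun x => by
      rw [← append_app, List.take_append_drop]
    have h3 : s = (q ++ s).take s.length := by
      refine eq_of_interleave (by simp) (a := δ) (d := y) ?_ ((e z) ▸ hz)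
        (b := (q ++ s).drop s.length ⌢ δ)
      rw [← e, app_per h.pair.ne_nil']
      exact h1
    refine ⟨(q ++ s).drop s.length, ?_⟩
    conv_rhs => arg 1; rw [h3]
    rw [List.take_append_drop]
  have hlt : t ≠ [] := by
    rintro rfl
    have := congrArg List.length ht
    rw [List.append_nil, List.length_append] at this
    omega
  rcases sgn_eq_one_or (O := O) s with hp | hn
  · have h2 : δ = s ⌢ t ⌢ δ := by rw [← append_app, ← ht, app_per h.pair.ne_nil']
    have h3 : δ ≤ t ⌢ δ := by
      conv_rhs at h1 => rw [h2]
      exact (app_le_app_pos hp).1 h1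
    have h4 : dr s.length δ = t ⌢ δ := by
      conv_lhs => rw [h2, dr_app]
    have h5 := h.dr_lt (i := s.length) hls (by simp [hlq])
    rw [← hδ, h4] at h5
    exact absurd h3 (not_le.2 h5)
  · rw [ht, append_app, app_le_app_neg hn] at hz
    have h2 := PrimePair.suffix_app_lt (ht ▸ h) hn hlt z
    exact absurd (hy.trans hz) (not_le.2 h2)

/-- If `s x < d ^ ∞` for some `x` above `d ^ ∞`, then `s` followed by any such sequence is smaller
than `d'`. -/
lemma PrimePair.below_of_app_lt {d d' s : Word N} (h : PrimePair Γ O d d') {x y : Sq O}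
    (hx : per O d ≤ x) (hy : per O d ≤ y) (hsx : s ⌢ x < per O d) : s ⌢ y ≪ d' := by
  by_contra hc
  obtain ⟨z, hz⟩ := not_below hc
  have h2 := (h.pair.per_lt_app z).trans_le hz
  obtain ⟨τ, hτ⟩ := exists_app_of_between hsx.le h2.le
  have hτδ : τ ≤ per O d := by
    have := h.pair.ext.dr_le s.length
    rwa [hτ, dr_app, ← hτ] at this
  rcases sgn_eq_one_or (O := O) s with hp | hn
  · rw [hτ] at hsx
    have := (app_lt_app_pos hp).1 hsx
    exact absurd (hτδ.trans hx) (not_le.2 this)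
  · rw [hτ] at h2
    have := (app_lt_app_neg hn).1 h2
    exact absurd (hτδ.trans hy) (not_le.2 this)

/-- If `g x` is strictly below `d'` for one tail `x` above `d ^ ∞`, then it is so for all such
tails. -/
lemma PrimePair.below_exchange {d d' g : Word N} (h : PrimePair Γ O d d') (hg : g ≠ []) {x y : Sq O}
    (hx : per O d ≤ x) (hy : per O d ≤ y) (hgx : g ⌢ x ≪ d') : g ⌢ y ≪ d' := by
  by_contra hc
  obtain ⟨z, hz⟩ := not_below hc
  obtain ⟨w, hw⟩ := exists_app_of_between (hgx z).le hz
  by_cases hl : d'.length ≤ g.length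
  · obtain ⟨t, ht, -⟩ := exists_append_of_app_eq hw hl
    exact hgx.not_app (t ⌢ x) (by rw [ht, append_app])
  obtain ⟨t, ht, -⟩ := exists_append_of_app_eq hw.symm (by omega)
  have hlt : t ≠ [] := by
    rintro rfl
    rw [List.append_nil] at ht
    rw [ht] at hl
    exact hl le_rfl
  subst ht
  rcases sgn_eq_one_or (O := O) g with hp | hn
  · have h1 : ∀ w : Sq O, x < t ⌢ w := fun w => by
      have := hgx w
      rwa [append_app, app_lt_app_pos hp] at this
    have h0 := first_of_app_first (O := O) hlt (first_eq_last_of_le (h1 x).le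
      (first_eq_last_of_le hx (h.pair.ext.periodic.per_first (O := O))))
    have h2 := h.rotate_lt hg hlt h0 x (per O d)
    rw [h.pair.app_per_lower] at h2
    exact absurd (hx.trans (h1 _).le) (not_le.2 h2)
  · rw [append_app, app_le_app_neg hn] at hz
    exact absurd (hy.trans hz) (not_le.2 (h.suffix_app_lt hn hlt z))

/-- A suffix of `d`, followed by a sequence above `d ^ ∞`, leads to something at most
`d ^ ∞`, except when the suffix is a positive period of `d ^ ∞`. -/
lemma PrimePair.app_le_of_suffix_lower {q s d' : Word N} (h : PrimePair Γ O (q ++ s) d')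
    {y : Sq O} (hy : per O (q ++ s) ≤ y) :
    s ⌢ y ≤ per O (q ++ s) ∨ (sgn O s = 1 ∧ s ⌢ per O (q ++ s) = per O (q ++ s)) := by
  by_contra hc
  push Not at hc
  obtain ⟨h2, hc⟩ := hc
  set δ := per O (q ++ s) with hδ
  have h1 : s ⌢ δ ≤ δ := h.pair.ext.suffix_le
  obtain ⟨τ, hτ⟩ := exists_app_of_between h1 h2.le
  have hτδ : τ ≤ δ := by
    have := h.pair.ext.dr_le s.length
    rwa [← hδ, hτ, dr_app, ← hτ] at this
  rcases sgn_eq_one_or (O := O) s with hp | hn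
  · have h3 : δ ≤ τ := by
      conv_rhs at h1 => rw [hτ]
      exact (app_le_app_pos hp).1 h1
    rw [le_antisymm hτδ h3] at hτ
    exact hc hp hτ.symm
  · rw [hτ] at h2
    have h4 := (app_lt_app_neg hn).1 h2
    exact absurd (hτδ.trans hy) (not_le.2 h4)

lemma PrimePair.app_le_of_suffix_upper {q s d : Word N} (h : PrimePair Γ O d (q ++ s))
    (hs : s ≠ []) (hq : q ≠ []) {y : Sq O} (hy : per O d ≤ y) : s ⌢ y ≤ per O d := by
  by_contra hc
  rw [not_le] at hc
  have h0 := first_of_app_first (O := O) hs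
    (first_eq_last_of_le hc.le (h.pair.ext.periodic.per_first (O := O)))
  rcases sgn_eq_one_or (O := O) s with hp | hn
  · have hqn : sgn O q = -1 := by
      have := h.pair.sgn_upper
      rwa [sgn_append, hp, mul_one] at this
    exact absurd hc (not_lt.2 (h.suffix_app_lt hqn hs y).le)
  · have h1 := h.rotate_lt hq hs h0 y (per O d)
    rw [h.pair.app_per_lower] at h1
    obtain ⟨τ, hτ⟩ := exists_app_of_between h1.le hc.le
    have hτδ : τ ≤ per O d := by
      have := h.pair.ext.dr_le s.length
      rwa [hτ, dr_app, ← hτ] at this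
    rw [hτ] at hc
    exact absurd (hτδ.trans hy) (not_le.2 ((app_lt_app_neg hn).1 hc))

/-- The periodic sequence of the lower word determines the length of a tuning pair. -/
lemma TuningPair.length_le_of_per_eq {d d' h h' : Word N} (hd : TuningPair Γ O d d')
    (hh : TuningPair Γ O h h') (heq : per O d = per O h) : h.length ≤ d.length := by
  by_contra hlt
  rw [not_le] at hlt
  have h1 : h ⌢ per O d = d ⌢ per O d := by
    rw [heq, hh.app_per_lower, ← heq, hd.app_per_lower]
  -- `h = g d` where `g` fixes `d ^ ∞`
  set g := tk (h.length - d.length) (per O d) with hg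
  have hdr : dr (h.length - d.length) (per O d) = per O d := by
    refine dr_sub_of_dr hlt.le (dr_per hd.ne_nil) ?_
    rw [heq]; exact dr_per hh.ne_nil
  have hgδ : g ⌢ per O d = per O d := by
    conv_lhs => arg 2; rw [← hdr]
    exact tk_app_dr _ _
  have hgl : g.length = h.length - d.length := by simp [hg]
  have hgne : g ≠ [] := by
    intro e
    have := congrArg List.length e
    rw [hgl] at this
    simp at this; omega
  have hhg : h = g ++ d := by
    refine (app_eq_app (x := per O d) (y := per O d) (O := O) (by simp [hgl]; omega) ?_).1
    rw [append_app, hd.app_per_lower, hgδ, h1, hd.app_per_lower]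
  have hgs : sgn O g = 1 := by
    have := hh.sgn_lower
    rwa [hhg, sgn_append, hd.sgn_lower, mul_one] at this
  have hgper : Periodic Γ g := by
    refine periodic_of_isPath (O := O) hgne (x := per O d) ?_ ?_ hd.ext.periodic.per_first
    · rw [hgδ]; exact hd.ext.periodic.isPath
    · rw [hgδ]; exact hd.ext.periodic.per_first
  -- so `h'` is squeezed between `g d` and `g d'`
  have h2 : ∃ x, per O h' = g ⌢ x := by
    have h3 : ∀ x : Sq O, h ⌢ x = g ⌢ d ⌢ x := fun x => by rw [hhg, append_app]
    have h4 := hh.app_lt (per O d) (per O h')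
    rw [h3, app_per hh.ne_nil'] at h4
    have h5 : Periodic Γ (g ++ d') := hgper.append hd.ext'.periodic
    have h6 : (g ++ d').length = h.length := by
      simp [hgl, ← hd.length_eq]; omega
    rcases hh.trichotomy h5 h6 with h7 | h7 | h7 | h7
    · rw [hhg, List.append_cancel_left_eq] at h7
      have := hd.sgn_lower
      rw [← h7, hd.sgn_upper] at this
      norm_num at this
    · exact ⟨d' ⌢ per O h', by rw [← append_app, h7, app_per hh.ne_nil']⟩
    · have h8 := h7 (per O d) (per O d)
      rw [h3, append_app, app_lt_app_pos hgs] at h8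
      exact absurd h8 (not_lt.2 (hd.app_lt _ _).le)
    · have h8 := h7 (per O h') (per O h')
      rw [append_app, app_per hh.ne_nil'] at h8
      exact exists_app_of_between h4.le h8.le
  obtain ⟨x, hx⟩ := h2
  exact not_app_of_lt hgne hgs hgδ (heq ▸ hh.per_lt_per) hh.ext'.dr_le x hx

/-! ### The minimal word -/

/-- A sequence from `N` that dominates its shifts lies above `m N`, or equals `m ^ ∞`. -/
lemma IsMinWord.above_or_eq {m : Word N} (hm : IsMinWord Γ O m) {x : Sq O} (hx : IsPath Γ x)
    (hx0 : x 0 = Fin.last N) (hmax : ∀ n, dr n x ≤ x) :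
    m ++ [Fin.last N] ⋘ x ∨ x = per O m := by
  obtain ⟨hper, -, hsgn, hmin⟩ := hm
  have key : ∀ y : Sq O, IsPath Γ y → y 0 = Fin.last N →
      (m ++ [Fin.last N] ⋘ y) ∨ ∃ z, y = (m ++ [Fin.last N]) ⌢ z := by
    intro y hy hy0
    have h1 : IsPathWord Γ (tk (m.length + 1) y) := by
      rw [IsPathWord, List.isChain_iff_getElem]
      intro i hi
      rw [getElem_tk, getElem_tk]
      exact hy i
    have h2 : (tk (m.length + 1) y).head? = some (Fin.last N) := by
      rw [← hy0]; simp [tk, List.ofFn_succ]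
    have hl : (m ++ [Fin.last N]).length = m.length + 1 := by simp
    rcases hmin _ h1 h2 (by simp) with h3 | h3
    · left
      intro z
      have := ((wordLT_iff_app_lt (O := O) (by simp) z (dr (m.length + 1) y)).1 h3).1
      rwa [tk_app_dr] at this
    · right
      refine ⟨dr (m.length + 1) y, ?_⟩
      rw [h3, tk_app_dr]
  rcases key x hx hx0 with h1 | ⟨z, hz⟩
  · exact Or.inl h1
  right
  have hmne : m ≠ [] := hper.ne_nil
  have hblock : ∀ n, dr (n * m.length) x 0 = Fin.last N →
      tk m.length (dr (n * m.length) x) = m ∧ dr ((n + 1) * m.length) x 0 = Fin.last N := by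
    intro n hn
    have h2 : ∃ w, dr (n * m.length) x = (m ++ [Fin.last N]) ⌢ w := by
      rcases key _ (hx.dr _) hn with h3 | h3
      · exact exists_app_of_between (h3 z).le (by rw [← hz]; exact hmax _)
      · exact h3
    obtain ⟨w, hw⟩ := h2
    rw [append_app] at hw
    refine ⟨by rw [hw, tk_app], ?_⟩
    rw [Nat.succ_mul, Nat.add_comm (n * m.length), ← dr_dr, hw, dr_app]
    simp [app]
  have hfirst : ∀ n, dr (n * m.length) x 0 = Fin.last N := by
    intro n
    induction n with
    | zero => simpa using hx0
    | succ n ih => exact (hblock n ih).2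
  exact eq_per_of_blocks hmne fun n => (hblock n (hfirst n)).1

/-- `m ^ ∞` is at most every sequence from `N` that dominates its shifts. -/
lemma IsMinWord.per_le {m : Word N} (hm : IsMinWord Γ O m) {x : Sq O} (hx : IsPath Γ x)
    (hx0 : x 0 = Fin.last N) (hmax : ∀ n, dr n x ≤ x) : per O m ≤ x := by
  rcases hm.above_or_eq hx hx0 hmax with h | h
  · have h1 := h (per O m)
    by_contra hc
    rw [not_le] at hc
    have e : per O m = (m ++ [Fin.last N]) ⌢ dr 1 (per O m) := by
      have hne := hm.1.ne_nil
      have h2 : per O m = m ⌢ per O m := (app_per hne).symm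
      have h3 : [Fin.last N] ⌢ dr 1 (per O m) = per O m := by
        have := tk_app_dr 1 (per O m)
        rwa [show tk 1 (per O m) = [Fin.last N] by simp [tk, hm.1.per_first (O := O)]] at this
      rw [append_app, h3]
      exact h2
    have h2 := h (dr 1 (per O m))
    rw [← e] at h2
    exact absurd hc (not_lt.2 h2.le)
  · exact h.ge

/-- The occurrences of `N` in `m ^ ∞` are at the multiples of `|m|`. -/
lemma IsMinWord.dvd_of_first {m : Word N} (hm : IsMinWord Γ O m) {i : ℕ}
    (hi : per O m i = Fin.last N) : m.length ∣ i := by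
  obtain ⟨hper, hcount, -, -⟩ := hm
  have hne := hper.ne_nil
  have hl := List.length_pos_iff.2 hne
  rw [per_apply hne] at hi
  by_contra hdvd
  have hpos : 0 < i % m.length := by
    rcases Nat.eq_zero_or_pos (i % m.length) with h | h
    · exact absurd (Nat.dvd_of_mod_eq_zero h) hdvd
    · exact h
  have h0 : m[0] = Fin.last N := by
    rw [← hper.app_first (O := O) (per O m), app_lt hl]
  cases m with
  | nil => exact absurd rfl hne
  | cons a m =>
    simp only [List.getElem_cons_zero] at h0
    subst h0
    rw [List.count_cons_self] at hcount
    have : Fin.last N ∈ m := by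
      obtain ⟨j, hj⟩ : ∃ j, i % (Fin.last N :: m).length = j + 1 :=
        ⟨_, (Nat.sub_add_cancel hpos).symm⟩
      have hlt := Nat.mod_lt i hl
      simp only [hj, List.getElem_cons_succ] at hi
      rw [← hi]
      exact List.getElem_mem _
    have := List.count_pos_iff.2 this
    omega

/-! ### Tuning as a monotone substitution -/

lemma tuning_cons (d d' : Word N) (c : Fin (1 + 1)) (v : Word 1) :
    tuning d d' (c :: v) = (if c = 0 then d else d') ++ tuning d d' v := rfl

@[simp] lemma tuning_nil (d d' : Word N) : tuning d d' [] = [] := rfl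

lemma tuning_append (d d' : Word N) (u v : Word 1) :
    tuning d d' (u ++ v) = tuning d d' u ++ tuning d d' v := by
  simp [tuning]

lemma tuning_wpow (d d' : Word N) (u : Word 1) (k : ℕ) :
    tuning d d' (wpow u k) = wpow (tuning d d' u) k := by
  induction k with
  | zero => rfl
  | succ k ih => rw [wpow_succ, wpow_succ, tuning_append, ih]

lemma length_tuning {d d' : Word N} (h : d.length = d'.length) (v : Word 1) :
    (tuning d d' v).length = v.length * d.length := by
  induction v with
  | nil => simp
  | cons c v ih =>
    rw [tuning_cons, List.length_append, ih, List.length_cons, Nat.succ_mul, add_comm]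
    split_ifs <;> simp [h]

lemma TuningPair.sgn_tuning {d d' : Word N} (h : TuningPair Γ O d d') (v : Word 1) :
    sgn O (tuning d d' v) = sgn unimodalSign v := by
  induction v with
  | nil => simp
  | cons c v ih =>
    have : sgn unimodalSign (c :: v) = (unimodalSign c : ℤ) * sgn unimodalSign v := by
      simp [sgn]
    rw [tuning_cons, sgn_append, ih, this]
    congr 1
    fin_cases c
    · simp [unimodalSign, h.sgn_lower]
    · simp [unimodalSign, h.sgn_upper]

lemma TuningPair.periodic_tuning {d d' : Word N} (h : TuningPair Γ O d d') {v : Word 1}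
    (hv : v ≠ []) : Periodic Γ (tuning d d' v) := by
  induction v with
  | nil => exact absurd rfl hv
  | cons c v ih =>
    have hc : Periodic Γ (if c = 0 then d else d') := by
      split_ifs
      exacts [h.ext.periodic, h.ext'.periodic]
    rw [tuning_cons]
    by_cases hv' : v = []
    · subst hv'
      simpa using hc
    · exact hc.append (ih hv')

/-- Tuning of composed tunings: substituting tuned words again gives a tuned word. -/
lemma tuning_flatMap (c c' : Word N) (u u' v : Word 1) :
    tuning (tuning c c' u) (tuning c c' u') v = tuning c c' (tuning u u' v) := by
  induction v with
  | nil => rfl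
  | cons a v ih =>
    rw [tuning_cons, tuning_cons, tuning_append, ih]
    split_ifs <;> rfl

/-- The substitution of `d` for `0` and `d'` for `1` in an infinite binary sequence, for words of
the same length. -/
def tuneSeq (O : Fin (N + 1) → ℤˣ) (d d' : Word N) (x : Sq unimodalSign) : Sq O :=
  fun i => (if x (i / d.length) = 0 then d else d').getD (i % d.length) 0

lemma tuneSeq_cons {d d' : Word N} (h : d.length = d'.length) (hd : d ≠ []) (c : Fin (1 + 1))
    (x : Sq unimodalSign) :
    tuneSeq O d d' ([c] ⌢ x) = (if c = 0 then d else d') ⌢ tuneSeq O d d' x := by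
  have hl := List.length_pos_iff.2 hd
  have hb : (if c = 0 then d else d').length = d.length := by split_ifs <;> simp [h]
  funext i
  by_cases hi : i < d.length
  · rw [app_lt (by rw [hb]; exact hi)]
    have h1 : ([c] ⌢ x) 0 = c := by simp [app]
    rw [tuneSeq, Nat.div_eq_of_lt hi, Nat.mod_eq_of_lt hi, h1]
    exact List.getD_eq_getElem _ _ _
  · obtain ⟨j, rfl⟩ := Nat.exists_eq_add_of_le' (not_lt.1 hi)
    have h1 : ([c] ⌢ x) (j / d.length + 1) = x (j / d.length) := app_add [c] x _
    conv_rhs => rw [← hb, app_add]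
    rw [tuneSeq, Nat.add_div_right _ hl, Nat.add_mod_right, h1, tuneSeq]

lemma tuneSeq_app {d d' : Word N} (h : d.length = d'.length) (hd : d ≠ []) (v : Word 1)
    (x : Sq unimodalSign) :
    tuneSeq O d d' (v ⌢ x) = tuning d d' v ⌢ tuneSeq O d d' x := by
  induction v with
  | nil => simp
  | cons c v ih =>
    rw [tuning_cons, append_app, ← ih, ← tuneSeq_cons h hd, ← append_app]
    rfl

lemma tuneSeq_dr {d d' : Word N} (h : d.length = d'.length) (hd : d ≠ []) (n : ℕ)
    (x : Sq unimodalSign) :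
    tuneSeq O d d' (dr n x) = dr (n * d.length) (tuneSeq O d d' x) := by
  conv_rhs => rw [← tk_app_dr n x, tuneSeq_app h hd]
  have : n * d.length = (tuning d d' (tk n x)).length := by
    rw [length_tuning h, length_tk]
  rw [this, dr_app]

lemma TuningPair.tuneSeq_lt {d d' : Word N} (h : TuningPair Γ O d d') {x y : Sq unimodalSign}
    (hxy : x < y) : tuneSeq O d d' x < tuneSeq O d d' y := by
  obtain ⟨n, h1, h2⟩ := Sq.lt_iff_tk.1 hxy
  have e : ∀ z : Sq unimodalSign, ∃ t, dr n z = [z n] ⌢ t := fun z => ⟨dr 1 (dr n z), by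
    conv_lhs => rw [← tk_app_dr 1 (dr n z)]
    congr 1
    simp [tk, dr]⟩
  have key : ∀ a b : Sq unimodalSign, a n < b n →
      tuneSeq O d d' (dr n a) < tuneSeq O d d' (dr n b) := by
    intro a b hab
    obtain ⟨s, hs⟩ := e a
    obtain ⟨t, ht⟩ := e b
    rw [hs, ht, tuneSeq_cons h.length_eq h.ne_nil, tuneSeq_cons h.length_eq h.ne_nil]
    have ha : a n = 0 := by
      have : (a n : ℕ) < (b n : ℕ) := hab
      have := (b n).isLt
      ext; simp; omega
    have hb : b n ≠ 0 := by
      rintro h0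
      rw [h0] at hab
      exact absurd hab (Fin.not_lt_zero _)
    rw [if_pos ha, if_neg hb]
    exact h.app_lt _ _
  rw [← tk_app_dr n x, ← tk_app_dr n y, ← h1, tuneSeq_app h.length_eq h.ne_nil,
    tuneSeq_app h.length_eq h.ne_nil]
  rcases sgn_eq_one_or (O := unimodalSign) (tk n x) with hp | hn
  · rw [app_lt_app_pos (by rw [h.sgn_tuning, hp])]
    refine key _ _ ?_
    rw [hp] at h2
    exact Fin.lt_def.2 (by omega)
  · rw [app_lt_app_neg (by rw [h.sgn_tuning, hn])]
    refine key _ _ ?_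
    rw [hn] at h2
    exact Fin.lt_def.2 (by omega)

lemma TuningPair.tuneSeq_per {d d' : Word N} (h : TuningPair Γ O d d') {v : Word 1} (hv : v ≠ []) :
    tuneSeq O d d' (per unimodalSign v) = per O (tuning d d' v) := by
  refine eq_per (h.periodic_tuning hv).ne_nil ?_
  conv_lhs => rw [← app_per hv, tuneSeq_app h.length_eq h.ne_nil]

/-- If a tuned word above `d ^ ∞` is admissible then so is its binary word. -/
lemma TuningPair.admissible_of_tuning {d d' : Word N} (h : TuningPair Γ O d d') {v : Word 1}
    (hu : Admissible Γ O (tuning d d' v)) (hlt : per O d < per O (tuning d d' v)) :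
    Admissible unimodalGraph unimodalSign v := by
  have hv : v ≠ [] := by
    rintro rfl
    exact hu.1.periodic.ne_nil rfl
  have hhead : v.head? = some (Fin.last 1) := by
    obtain ⟨c, v', rfl⟩ := List.exists_cons_of_ne_nil hv
    by_cases hc : c = 0
    · subst hc
      refine absurd ?_ (not_app_of_lt h.ne_nil h.sgn_lower h.app_per_lower hlt hu.1.dr_le
        (tuning d d' v' ⌢ per O (tuning d d' (0 :: v'))))
      conv_lhs => rw [← app_per hu.1.periodic.ne_nil]
      rw [tuning_cons, if_pos rfl, append_app]
    · rw [List.head?_cons]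
      congr 1
      have h1 := c.isLt
      have h2 : (c : ℕ) ≠ 0 := fun e => hc (Fin.ext e)
      ext; simp; omega
  have hper : Periodic unimodalGraph v := ⟨⟨hv, fun _ => trivial⟩, hhead⟩
  refine ⟨extremal_of_dr_le hper fun n => ?_, by rw [← h.sgn_tuning]; exact hu.2⟩
  by_contra hc
  have h1 := h.tuneSeq_lt (not_le.1 hc)
  rw [tuneSeq_dr h.length_eq h.ne_nil, h.tuneSeq_per hv] at h1
  exact absurd (hu.1.dr_le _) (not_le.2 h1)

lemma TuningPair.renormalizable_of_tuning {d d' : Word N} (h : TuningPair Γ O d d') {v : Word 1}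
    (hu : Admissible Γ O (tuning d d' v)) (hlt : per O d < per O (tuning d d' v)) :
    Renormalizable Γ O (tuning d d' v) :=
  ⟨d, d', v, h, h.admissible_of_tuning hu hlt, rfl⟩

lemma two_le_length_of_admissible {v : Word 1} (hv : Admissible unimodalGraph unimodalSign v) :
    2 ≤ v.length := by
  obtain ⟨c, v', rfl⟩ := List.exists_cons_of_ne_nil hv.1.periodic.ne_nil
  have h1 : c = Fin.last 1 := by simpa using hv.1.1.2
  have h2 := hv.2
  cases v' with
  | nil => rw [h1] at h2; simp [sgn, unimodalSign] at h2
  | cons a v' => simp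

/-- If the lower word of a tuning pair is tuned from `c` and `c'`, then so is the upper word: its
binary word differs in the last letter only. -/
lemma TuningPair.upper_eq_tuning {c c' d' : Word N} {v : Word 1} (hc : TuningPair Γ O c c')
    (hv : Admissible unimodalGraph unimodalSign v) (h : TuningPair Γ O (tuning c c' v) d') :
    ∃ v' : Word 1, d' = tuning c c' v' ∧ v'.head? = some 1 := by
  have hv2 := two_le_length_of_admissible hv
  obtain ⟨v0, a, rfl⟩ : ∃ v0 a, v = v0 ++ [a] :=
    ⟨v.dropLast, v.getLast (by rintro rfl; simp at hv2), (List.dropLast_append_getLast _).symm⟩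
  have hv0 : v0 ≠ [] := by
    rintro rfl
    simp at hv2
  have hhead : v0.head? = some 1 := by
    have := hv.1.1.2
    rwa [List.head?_append_of_ne_nil _ hv0] at this
  have htun : ∀ b : Fin (1 + 1), tuning c c' (v0 ++ [b]) =
      tuning c c' v0 ++ if b = 0 then c else c' := fun b => by
    rw [tuning_append, tuning_cons]; simp
  set g := tuning c c' v0 with hg
  -- `g y` is the lower word, and in `g y'` the last letter of the binary word is flipped
  have main : ∀ y y' : Word N, tuning c c' (v0 ++ [a]) = g ++ y → Periodic Γ y' →
      y.length = y'.length →
      (∀ s t : Sq O, g ⌢ y ⌢ s < g ⌢ y' ⌢ t) →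
      (∀ u, Periodic Γ u → u.length = c.length → (∀ s t : Sq O, g ⌢ y ⌢ s < g ⌢ u ⌢ t) →
        (∀ s t : Sq O, g ⌢ u ⌢ s < g ⌢ y' ⌢ t) → False) →
      (∀ s : Sq O, (∀ t : Sq O, g ⌢ y ⌢ t < g ⌢ s) → (∀ t : Sq O, g ⌢ s < g ⌢ y' ⌢ t) →
        s 0 = Fin.last N) → y.length = c.length →
      d' = g ++ y' := by
    intro y y' hgy hy' hl hlt hno hfirst hly
    rw [hgy] at h
    have hgp : Periodic Γ g := hc.periodic_tuning hv0
    rcases h.trichotomy (hgp.append hy') (by simp [hl]) with h1 | h1 | h1 | h1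
    · rw [List.append_cancel_left_eq] at h1
      subst h1
      exact absurd (hlt (per O c) (per O c)) (lt_irrefl _)
    · exact h1.symm
    · have h2 := h1 (per O c) (per O c)
      rw [append_app, append_app] at h2
      exact absurd (hlt (per O c) (per O c)) (not_lt.2 h2.le)
    · exfalso
      have h2 : ∀ s t : Sq O, g ⌢ y ⌢ s < d' ⌢ t := fun s t => by
        rw [← append_app]; exact h.app_lt s t
      have h3 : ∀ s t : Sq O, d' ⌢ s < g ⌢ y' ⌢ t := fun s t => by
        rw [← append_app]; exact h1 s t
      obtain ⟨z, hz⟩ := exists_app_of_between (h2 (per O c) (per O c)).le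
        (h3 (per O c) (per O c)).le
      have hl2 := h.length_eq
      rw [List.length_append] at hl2
      obtain ⟨u, hu, -⟩ := exists_append_of_app_eq hz.symm (by omega)
      have hlu : u.length = c.length := by
        have := congrArg List.length hu
        rw [List.length_append] at this
        omega
      simp only [hu, append_app] at h2 h3
      have hune : u ≠ [] := by
        rintro rfl
        exact hc.ne_nil (List.length_eq_zero_iff.1 hlu.symm)
      refine hno u ?_ hlu h2 h3
      have := h.ext'.periodic
      rw [hu] at this
      exact this.of_append (O := O) hune fun s => hfirst _ (fun t => h2 _ _) (fun t => h3 _ _)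
  have hs := hv.2
  rw [← hc.sgn_tuning, htun, sgn_append] at hs
  have hc0 := hc.ext.periodic.app_first (O := O)
  by_cases ha : a = 0
  · rw [if_pos ha, hc.sgn_lower, mul_one] at hs
    refine ⟨v0 ++ [1], ?_, by rw [List.head?_append_of_ne_nil _ hv0, hhead]⟩
    rw [htun, if_neg (by decide)]
    refine main c c' (by rw [htun, if_pos ha]) hc.ext'.periodic hc.length_eq ?_ ?_ ?_ rfl
    · intro s t; rw [app_lt_app_pos hs]; exact hc.app_lt _ _
    · intro u hu hl h1 h2
      simp only [app_lt_app_pos hs] at h1 h2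
      rcases hc.trichotomy hu hl with h3 | h3 | h3 | h3
      · subst h3; exact lt_irrefl _ (h1 (per O u) (per O u))
      · subst h3; exact lt_irrefl _ (h2 (per O u) (per O u))
      · exact lt_asymm (h1 (per O u) (per O u)) (h3 _ _)
      · exact lt_asymm (h2 (per O u) (per O u)) (h3 _ _)
    · intro s h1 _
      have := h1 (per O c)
      rw [app_lt_app_pos hs] at this
      exact first_eq_last_of_le this.le (hc0 _)
  · rw [if_neg ha, hc.sgn_upper] at hs
    have hs : sgn O g = -1 := by linarith
    refine ⟨v0 ++ [0], ?_, by rw [List.head?_append_of_ne_nil _ hv0, hhead]⟩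
    rw [htun, if_pos rfl]
    refine main c' c (by rw [htun, if_neg ha]) hc.ext.periodic hc.length_eq.symm ?_ ?_ ?_
      hc.length_eq.symm
    · intro s t; rw [app_lt_app_neg hs]; exact hc.app_lt _ _
    · intro u hu hl h1 h2
      simp only [app_lt_app_neg hs] at h1 h2
      rcases hc.trichotomy hu hl with h3 | h3 | h3 | h3
      · subst h3; exact lt_irrefl _ (h2 (per O u) (per O u))
      · subst h3; exact lt_irrefl _ (h1 (per O u) (per O u))
      · exact lt_asymm (h2 (per O u) (per O u)) (h3 _ _)
      · exact lt_asymm (h1 (per O u) (per O u)) (h3 _ _)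
    · intro s _ h1
      have := h1 (per O c)
      rw [app_lt_app_neg hs] at this
      exact first_eq_last_of_le this.le (hc0 _)

/-! ### Approximation from below by sequences ending in `m ^ ∞` -/

/-- The sequence `c` is a path that eventually becomes `m ^ ∞`, and it and all its shifts are at
most `κ`. -/
structure EndsBelow (Γ : Digraph (Fin (N + 1))) (m : Word N) (κ c : Sq O) : Prop where
  isPath : IsPath Γ c
  ends : ∃ u, c = u ⌢ per O m
  dr_le : ∀ i, dr i c ≤ κ

/-- The periodic sequence of `w` can be approximated by sequences that end in `m ^ ∞`
and that do not exceed it, together with their shifts. -/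
def Approximable (Γ : Digraph (Fin (N + 1))) (O : Fin (N + 1) → ℤˣ) (m w : Word N) : Prop :=
  ∀ n, ∃ z, EndsBelow Γ m (per O w) (wpow w n ⌢ z)

/-- An admissible irreducible word that is neither renormalizable nor a power of `m`: a word to
which the theorem applies. -/
structure PrimeWord (Γ : Digraph (Fin (N + 1))) (O : Fin (N + 1) → ℤˣ) (m w : Word N) : Prop where
  adm : Admissible Γ O w
  irr : IrreducibleWord w
  not_ren : ¬ Renormalizable Γ O w
  ne_wpow : ∀ k, w ≠ wpow m k

/-- The upper word of a tuning pair has no proper period. If it were `e ^ j` with `j ≥ 3` odd, then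
`e ^ (j - 1) c` would be a periodic word just below it, where `(c, e)` is a tuning pair, and a shift
of `d ^ ∞` would exceed `e ^ ∞`. -/
lemma TuningPair.primePair {m d d' : Word N} (htun : TunableWith Γ O m)
    (h : TuningPair Γ O d d') : PrimePair Γ O d d' := by
  refine ⟨h, fun i hi hi' hdr => ?_⟩
  obtain ⟨e, j, he, hirr, hj, rfl⟩ := exists_root h.ne_nil'
  have hj1 : j ≠ 1 := by
    rintro rfl
    rw [wpow_one] at hdr hi'
    exact hirr.dr_ne hi hi' hdr
  have hs := h.sgn_upper
  rw [sgn_wpow] at hs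
  have hen : sgn O e = -1 := by
    rcases sgn_eq_one_or (O := O) e with h1 | h1
    · rw [h1, one_pow] at hs; norm_num at hs
    · exact h1
  have hodd : Odd j := by
    by_contra hc
    rw [hen, (Nat.not_odd_iff_even.1 hc).neg_one_pow] at hs
    norm_num at hs
  obtain ⟨l, rfl⟩ : ∃ l, j = 2 * l + 3 := by
    obtain ⟨k, rfl⟩ := hodd
    exact ⟨k - 1, by omega⟩
  have hperE : per O (wpow e (2 * l + 3)) = per O e := per_wpow he (by omega)
  have hlt := h.per_lt_per
  rw [hperE] at hlt
  have hext : Extremal Γ O e := h.ext'.of_wpow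
  rcases htun.2 e hext hirr hen with ⟨k, hk, rfl⟩ | ⟨c, hc | hc⟩
  · rw [per_wpow htun.1.1.ne_nil (by rintro rfl; simp at hk)] at hlt
    exact absurd hlt (not_lt.2 (htun.1.per_le h.ext.periodic.isPath h.ext.periodic.per_first
      h.ext.dr_le))
  · have hpe : sgn O (wpow e (2 * l + 2)) = 1 := by
      rw [sgn_wpow, hen, Even.neg_one_pow ⟨l + 1, by ring⟩]
    have hsplit : wpow e (2 * l + 3) = wpow e (2 * l + 2) ++ e := wpow_succ' e _
    have hlow : ∃ x : Sq O, wpow e (2 * l + 2) ⌢ x ≤ per O d := by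
      have h1 : Periodic Γ (wpow e (2 * l + 2) ++ c) :=
        (hext.wpow (by omega)).periodic.append hc.ext.periodic
      have h2 : (wpow e (2 * l + 2) ++ c).length = d.length := by
        rw [h.length_eq, hsplit, List.length_append, List.length_append, hc.length_eq]
      rcases h.trichotomy h1 h2 with h3 | h3 | h3 | h3
      · refine ⟨c ⌢ per O d, ?_⟩
        rw [← append_app, h3, h.app_per_lower]
      · rw [hsplit, List.append_cancel_left_eq] at h3
        have := hc.sgn_lower
        rw [h3, hen] at this
        norm_num at this
      · refine ⟨c ⌢ per O d, ?_⟩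
        have := h3 (per O d) (per O d)
        rw [h.app_per_lower, append_app] at this
        exact this.le
      · have := h3 (per O d) (per O d)
        rw [hsplit, append_app, append_app, app_lt_app_pos hpe] at this
        exact absurd this (not_lt.2 (hc.app_lt _ _).le)
    obtain ⟨x, hx⟩ := hlow
    have hup : per O d < wpow e (2 * l + 2) ⌢ per O e := by
      rwa [wpow_app_of_app (app_per he)]
    obtain ⟨Z, hZ⟩ := exists_app_of_between hx hup.le
    have hZe : Z < per O e := by
      rwa [hZ, app_lt_app_pos hpe] at hup
    have h1 : dr (wpow e (2 * l + 1)).length (per O d) = e ⌢ Z := by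
      rw [hZ, show 2 * l + 2 = 2 * l + 1 + 1 from rfl, wpow_succ' e (2 * l + 1), append_app, dr_app]
    have h2 := h.ext.dr_le (wpow e (2 * l + 1)).length
    rw [h1] at h2
    have h3 : per O e < e ⌢ Z := by
      conv_lhs => rw [← app_per he]
      rwa [app_lt_app_neg hen]
    exact absurd (hlt.trans h3) (not_lt.2 h2)
  · have := hc.sgn_lower
    rw [hen] at this
    norm_num at this

lemma eq_one_of_irreducible_wpow {u : Word N} {k : ℕ} (hne : wpow u k ≠ [])
    (h : IrreducibleWord (wpow u k)) : k = 1 := by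
  have h1 : k ≠ 0 := by
    rintro rfl
    exact hne (wpow_zero u)
  have h2 : ¬ 2 ≤ k := fun hk => h ⟨u, k, hk, rfl⟩
  omega

lemma IsMinWord.irreducible_ne_wpow {m e : Word N} (hm : IsMinWord Γ O m) (he : e ≠ [])
    (hirr : IrreducibleWord e) (hs : sgn O e = 1) (k : ℕ) : e ≠ wpow m k := by
  rintro rfl
  have := eq_one_of_irreducible_wpow he hirr
  subst this
  rw [wpow_one, hm.2.2.1] at hs
  norm_num at hs

/-- The lower word of a tuning pair is approximable if it is not renormalizable: its root is either
a shorter word to which the induction hypothesis applies, or `m`. -/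
lemma TuningPair.approximable {m d d' : Word N} (htun : TunableWith Γ O m)
    (h : TuningPair Γ O d d') (hren : ¬ Renormalizable Γ O d)
    (IH : ∀ e, PrimeWord Γ O m e → e.length ≤ d.length → Approximable Γ O m e) :
    Approximable Γ O m d := by
  obtain ⟨e, k, he, hirr, hk, rfl⟩ := exists_root h.ne_nil
  have hext : Extremal Γ O e := h.ext.of_wpow
  have hper : per O (wpow e k) = per O e := per_wpow he hk.ne'
  rcases sgn_eq_one_or (O := O) e with hp | hn
  · have hgood : PrimeWord Γ O m e := by
      refine ⟨⟨hext, hp⟩, hirr, ?_, htun.1.irreducible_ne_wpow he hirr hp⟩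
      rintro ⟨c, c', v, hc, hv, rfl⟩
      refine hren ⟨c, c', wpow v k, hc, ⟨hv.1.wpow hk, ?_⟩, (tuning_wpow _ _ _ _).symm⟩
      rw [sgn_wpow, hv.2, one_pow]
    intro n
    obtain ⟨z, hz⟩ := IH e hgood (by rw [length_wpow]; exact Nat.le_mul_of_pos_left _ hk) (k * n)
    refine ⟨z, ?_⟩
    rwa [wpow_mul, hper]
  · rcases htun.2 e hext hirr hn with ⟨j, hj, rfl⟩ | ⟨c, hc | hc⟩
    · have hj0 : j ≠ 0 := by rintro rfl; simp at hj
      intro n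
      refine ⟨per O m, ?_⟩
      rw [hper, per_wpow htun.1.1.ne_nil hj0, wpow_mul, wpow_mul,
        wpow_app_of_app (app_per htun.1.1.ne_nil)]
      have h2 := hext.dr_le
      rw [per_wpow htun.1.1.ne_nil hj0] at h2
      exact ⟨htun.1.1.isPath, ⟨[], rfl⟩, h2⟩
    · exfalso
      have h1 : wpow e k = tuning c e (wpow [1] k) := by
        rw [tuning_wpow, tuning_cons, if_neg (by decide)]
        simp
      refine hren ?_
      have h3 : per O c < per O (wpow e k) := by rw [hper]; exact hc.per_lt_per
      have h4 := h.1
      rw [h1] at h3 h4 ⊢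
      exact hc.renormalizable_of_tuning h4 h3
    · have := hc.sgn_lower
      rw [hn] at this
      norm_num at this

/-- Every negative extremal irreducible word that is not a power of `m` is tuned from a pair whose
lower word is not renormalizable. The pair with the shortest words does it, by
`TuningPair.upper_eq_tuning`. -/
lemma exists_outer_pair {m f : Word N} (htun : TunableWith Γ O m) (hf : Extremal Γ O f)
    (hirr : IrreducibleWord f) (hs : sgn O f = -1) (hfm : ∀ k, f ≠ wpow m k)
    (IH : ∀ e, PrimeWord Γ O m e → e.length ≤ f.length → Approximable Γ O m e) :
    ∃ d d' : Word N, ∃ v : Word 1, PrimePair Γ O d d' ∧ f = tuning d d' (1 :: v) ∧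
      ¬ Renormalizable Γ O d ∧ Approximable Γ O m d := by
  classical
  have hex : ∃ n, ∃ d d' : Word N, ∃ v : Word 1, TuningPair Γ O d d' ∧
      f = tuning d d' (1 :: v) ∧ d.length = n := by
    rcases htun.2 f hf hirr hs with ⟨k, -, hk⟩ | ⟨c, hc | hc⟩
    · exact absurd hk (hfm k)
    · exact ⟨_, c, f, [], hc, by rw [tuning_cons, if_neg (by decide)]; simp, rfl⟩
    · have := hc.sgn_lower
      rw [hs] at this
      norm_num at this
  obtain ⟨d, d', v, hd, hfd, hdn⟩ := Nat.find_spec hex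
  have hren : ¬ Renormalizable Γ O d := by
    rintro ⟨c, c', u, hc, hu, rfl⟩
    obtain ⟨u', hu', hh⟩ := hc.upper_eq_tuning hu hd
    obtain ⟨u'', rfl⟩ : ∃ u'', u' = 1 :: u'' := by
      cases u' with
      | nil => simp at hh
      | cons a u' => simp at hh; exact ⟨u', by rw [hh]⟩
    refine Nat.find_min hex (m := c.length) ?_ ⟨c, c', u'' ++ tuning u (1 :: u'') v, hc, ?_, rfl⟩
    · rw [← hdn, length_tuning hc.length_eq]
      have h1 := two_le_length_of_admissible hu
      have h2 := List.length_pos_iff.2 hc.ne_nil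
      nlinarith
    · rw [hfd, hu', tuning_flatMap, tuning_cons, if_neg (by decide)]
      rfl
  refine ⟨d, d', v, hd.primePair htun, hfd, hren, hd.approximable htun hren fun e he hl => ?_⟩
  refine IH e he (hl.trans ?_)
  rw [hfd, length_tuning hd.length_eq]
  exact Nat.le_mul_of_pos_left _ (by simp)

/-! ### Positions inside a tuned word -/

/-- A cut of a tuned word falls into one of its blocks; `g = []` means that it is aligned. -/
lemma tuning_eq_append {d d' : Word N} {v : Word 1} {q s : Word N} (h : tuning d d' v = q ++ s)
    (hs : s ≠ []) : ∃ v₁ c v₂ g t, v = v₁ ++ c :: v₂ ∧ (if c = 0 then d else d') = g ++ t ∧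
      t ≠ [] ∧ q = tuning d d' v₁ ++ g ∧ s = t ++ tuning d d' v₂ := by
  induction v generalizing q with
  | nil =>
    have := congrArg List.length h
    rw [tuning_nil, List.length_append] at this
    exact absurd (List.length_eq_zero_iff.1 (by simp at this; omega)) hs
  | cons a v ih =>
    rw [tuning_cons] at h
    by_cases hl : (if a = 0 then d else d').length ≤ q.length
    · obtain ⟨q', rfl, h2⟩ : ∃ q', q = (if a = 0 then d else d') ++ q' ∧
          tuning d d' v = q' ++ s := by
        rcases List.append_eq_append_iff.1 h with ⟨q', h1, h2⟩ | ⟨q', h1, h2⟩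
        · exact ⟨q', h1, h2⟩
        · have : q' = [] := by
            have := congrArg List.length h1
            rw [List.length_append] at this
            exact List.length_eq_zero_iff.1 (by omega)
          subst this
          exact ⟨[], by simpa using h1.symm, by simpa using h2.symm⟩
      obtain ⟨v₁, c, v₂, g, t, rfl, h4, h5, rfl, h7⟩ := ih h2
      exact ⟨a :: v₁, c, v₂, g, t, rfl, h4, h5, by rw [tuning_cons, List.append_assoc], h7⟩
    · rcases List.append_eq_append_iff.1 h with ⟨q', h1, h2⟩ | ⟨q', h1, h2⟩
      · rw [h1] at hl
        simp at hl
      · refine ⟨[], a, v, q, q', rfl, h1, ?_, by simp, h2⟩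
        rintro rfl
        rw [h1] at hl
        simp at hl

lemma wpow_append_eq_append {e G q s : Word N} {j : ℕ} (h : wpow e j ++ G = q ++ s) :
    (∃ q', G = q' ++ s ∧ q = wpow e j ++ q') ∨
      ∃ g t i, e = g ++ t ∧ t ≠ [] ∧ s = t ++ (wpow e i ++ G) := by
  induction j generalizing q with
  | zero => exact Or.inl ⟨q, by simpa using h, by simp⟩
  | succ j ih =>
    rw [wpow_succ, List.append_assoc] at h
    rcases List.append_eq_append_iff.1 h with ⟨q', rfl, h2⟩ | ⟨q', h1, h2⟩
    · rcases ih h2 with ⟨q'', h3, rfl⟩ | h3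
      · exact Or.inl ⟨q'', h3, by rw [wpow_succ, List.append_assoc]⟩
      · exact Or.inr h3
    · by_cases hq : q' = []
      · subst hq
        rw [List.nil_append] at h2
        rw [List.append_nil] at h1
        rcases ih (q := []) (by simpa using h2.symm) with ⟨q'', h3, h4⟩ | h3
        · exact Or.inl ⟨q'', h3, by rw [wpow_succ, List.append_assoc, ← h4, h1]; simp⟩
        · exact Or.inr h3
      · exact Or.inr ⟨q, q', j, h1, hq, h2⟩

/-- A proper suffix of a block, followed by a sequence above `d ^ ∞`, leads to something strictly
below `d'`. -/
lemma PrimePair.below_of_token {d d' g t : Word N} (h : PrimePair Γ O d d') {c : Fin (1 + 1)}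
    (hc : (if c = 0 then d else d') = g ++ t) (hg : g ≠ []) (ht : t ≠ []) {y : Sq O}
    (hy : per O d ≤ y) : t ⌢ y ≪ d' := by
  split_ifs at hc with h0
  · subst hc; exact h.below_of_suffix_lower ht hy
  · subst hc; exact h.below_of_suffix_upper ht hg hy

lemma PrimePair.below_of_lower_eq {d d' g t : Word N} (h : PrimePair Γ O d d')
    (hc : d = g ++ t) (ht : t ≠ []) {y : Sq O} (hy : per O d ≤ y) : t ⌢ y ≪ d' := by
  subst hc; exact h.below_of_suffix_lower ht hy

lemma TuningPair.le_app {d d' : Word N} (h : TuningPair Γ O d d') {y : Sq O}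
    (hy : per O d ≤ y) : per O d ≤ d ⌢ y := by
  conv_lhs => rw [← h.app_per_lower]
  exact (app_le_app_pos h.sgn_lower).2 hy

lemma TuningPair.le_tuning_app {d d' : Word N} (h : TuningPair Γ O d d') (v : Word 1) {y : Sq O}
    (hy : per O d ≤ y) : per O d ≤ tuning d d' v ⌢ y := by
  induction v with
  | nil => simpa using hy
  | cons c v ih =>
    rw [tuning_cons, append_app]
    split_ifs
    · exact h.le_app ih
    · exact (h.per_lt_app _).le

/-- Let `κ = B x` dominate its shifts, where `B` is a tuned word that starts with `d'` and
`x` lies strictly between `d` and `d'`. If `Q Y` also lies strictly between `d` and `d'`, then the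
proper suffixes of `B Q`, followed by `Y`, are smaller than `B Q`. -/
lemma PrimePair.suffix_below {d d' : Word N} (h : PrimePair Γ O d d') {v : Word 1} {Q : Word N}
    {x Y : Sq O} (hmax : ∀ n, dr n (tuning d d' (1 :: v) ⌢ x) ≤ tuning d d' (1 :: v) ⌢ x)
    (hx : d ⋘ x) (hx' : x ≪ d') (hY : d ⋘ Q ⌢ Y) (hY' : Q ⌢ Y ≪ d')
    (hQ : ∀ q s, Q = q ++ s → q ≠ [] → s ≠ [] → s ⌢ Y ≪ tuning d d' (1 :: v) ++ Q)
    {q s : Word N} (hqs : tuning d d' (1 :: v) ++ Q = q ++ s) (hq : q ≠ []) (hs : s ≠ []) :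
    s ⌢ Y ≪ tuning d d' (1 :: v) ++ Q := by
  have hlow : ∀ y : Sq O, d ⋘ y → per O d ≤ y := fun y hy => by
    have := (hy (per O d)).le
    rwa [h.pair.app_per_lower] at this
  have hstart : ∀ y : Sq O, y ≪ d' → y ≪ tuning d d' (1 :: v) ++ Q := fun y hy => by
    rw [tuning_cons, if_neg (by decide), List.append_assoc]
    exact hy.append _
  rcases List.append_eq_append_iff.1 hqs with ⟨q', rfl, h2⟩ | ⟨s', h1, rfl⟩
  · by_cases hq' : q' = []
    · subst hq'
      rw [List.nil_append] at h2
      rw [← h2]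
      exact hstart _ hY'
    · exact hQ q' s h2 hq' hs
  · by_cases hs' : s' = []
    · subst hs'
      exact hstart _ (by simpa using hY')
    obtain ⟨v₁, c, v₂, g, t, hv, hc, ht, hq1, rfl⟩ := tuning_eq_append h1 hs'
    by_cases hg : g = []
    · subst hg
      -- an aligned position: compare with the prefix of the same length
      rw [List.append_nil] at hq1
      rw [List.nil_append] at hc
      have hB2 : t ++ tuning d d' v₂ = tuning d d' (c :: v₂) := by rw [tuning_cons, hc]
      rw [hB2] at h1 ⊢
      rw [append_app]
      have hv₁ : v₁ ≠ [] := by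
        rintro rfl
        exact hq hq1
      obtain ⟨u, a, u', hu, hul⟩ : ∃ u a u', (1 :: v : Word 1) = u ++ a :: u' ∧
          u.length = (c :: v₂).length := by
        have hlt : (c :: v₂).length < (1 :: v : Word 1).length := by
          rw [hv, List.length_append]
          have := List.length_pos_iff.2 hv₁
          omega
        obtain ⟨a, u', hau⟩ := List.exists_cons_of_ne_nil
          (l := (1 :: v : Word 1).drop (c :: v₂).length) (by
            rw [Ne, List.drop_eq_nil_iff]; omega)
        exact ⟨_, a, u', by rw [← hau, List.take_append_drop], by
          rw [List.length_take]; omega⟩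
      have hle := hmax q.length
      conv_lhs at hle => rw [h1, append_app, dr_app]
      have hbody : ∀ y : Sq O, tuning d d' (1 :: v) ⌢ y =
          tuning d d' u ⌢ (if a = 0 then d else d') ⌢ tuning d d' u' ⌢ y := fun y => by
        rw [hu, tuning_append, tuning_cons, append_app, append_app]
      have hlen : (tuning d d' (c :: v₂)).length = (tuning d d' u).length := by
        rw [length_tuning h.pair.length_eq, length_tuning h.pair.length_eq, hul]
      rw [hbody] at hle
      by_cases he : tuning d d' (c :: v₂) = tuning d d' u
      · rw [he] at hle ⊢
        intro z
        rw [append_app, hbody]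
        rcases sgn_eq_one_or (O := O) (tuning d d' u) with hp | hn
        · rw [app_le_app_pos hp] at hle
          rw [app_lt_app_pos hp]
          split_ifs at hle ⊢ with ha
          · exact absurd hle (not_le.2 (hx _))
          · exact hY' _
        · rw [app_le_app_neg hn] at hle
          rw [app_lt_app_neg hn]
          split_ifs at hle ⊢ with ha
          · exact hY _
          · exact absurd hle (not_le.2 (hx' _))
      · intro z
        rw [append_app, hbody]
        by_contra hc2
        exact he (eq_of_interleave hlen hle (not_lt.1 hc2))
    · rw [append_app, append_app]
      exact hstart _ (h.below_of_token hc hg ht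
        (h.pair.le_tuning_app _ (hlow _ hY)))

/-! ### The positive root of the lower word -/

/-- `e` is the shortest positive word such that `d ^ ∞` consists of copies of `e`. -/
structure IsPosRoot (O : Fin (N + 1) → ℤˣ) (d e : Word N) : Prop where
  ne_nil : e ≠ []
  sgn_eq : sgn O e = 1
  app_per : e ⌢ per O d = per O d
  length_le : ∀ z, z ≠ [] → sgn O z = 1 → z ⌢ per O d = per O d → e.length ≤ z.length

lemma exists_posRoot {d : Word N} (hd : d ≠ []) (hs : sgn O d = 1) :
    ∃ e K, IsPosRoot O d e ∧ d = wpow e K := by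
  classical
  have hex : ∃ n, ∃ z : Word N, z ≠ [] ∧ sgn O z = 1 ∧ z ⌢ per O d = per O d ∧ z.length = n :=
    ⟨_, d, hd, hs, app_per hd, rfl⟩
  obtain ⟨e, h1, h2, h3, h4⟩ := Nat.find_spec hex
  have hmin : ∀ z, z ≠ [] → sgn O z = 1 → z ⌢ per O d = per O d → e.length ≤ z.length := by
    intro z hz hz1 hz2
    rw [h4]
    exact Nat.find_min' hex ⟨z, hz, hz1, hz2, rfl⟩
  refine ⟨e, d.length / e.length, ⟨h1, h2, h3, hmin⟩, ?_⟩
  have hle := Nat.div_mul_le_self d.length e.length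
  obtain ⟨t, ht, ht2⟩ := exists_append_of_app_eq
    ((wpow_app_of_app h3 (d.length / e.length)).trans (app_per hd).symm) (by
      rwa [length_wpow])
  by_cases htn : t = []
  · rw [htn, List.append_nil] at ht
    exact ht
  exfalso
  have h5 : sgn O t = 1 := by
    have := hs
    rw [ht, sgn_append, sgn_wpow, h2, one_pow, one_mul] at this
    exact this
  have h6 := hmin t htn h5 ht2.symm
  have h7 := congrArg List.length ht
  rw [List.length_append, length_wpow] at h7
  have h8 := Nat.mod_add_div' d.length e.length
  have h9 := Nat.mod_lt d.length (List.length_pos_iff.2 h1)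
  omega

lemma IsPosRoot.le_app {d e : Word N} (he : IsPosRoot O d e) {y : Sq O} (hy : per O d ≤ y) (i : ℕ) :
    per O d ≤ wpow e i ⌢ y := by
  conv_lhs => rw [← wpow_app_of_app he.app_per i]
  refine (app_le_app_pos ?_).2 hy
  rw [sgn_wpow, he.sgn_eq, one_pow]

/-- The position of `G x` above `e` does not depend on the tail `x`, as long as it is at
least `d ^ ∞`. -/
lemma IsPosRoot.above_exchange {d e G : Word N} (he : IsPosRoot O d e)
    (hmax : ∀ n, dr n (per O d) ≤ per O d) (hG : G ≠ []) {x y : Sq O} (hx : per O d ≤ x)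
    (hy : per O d ≤ y) (h : e ⋘ G ⌢ x) : e ⋘ G ⌢ y := by
  by_contra hc
  obtain ⟨z, hz⟩ := not_above hc
  obtain ⟨z', hz'⟩ := exists_app_of_between hz (h z).le
  by_cases hl : e.length ≤ G.length
  · obtain ⟨t, rfl, -⟩ := exists_append_of_app_eq hz' hl
    exact h.not_app (t ⌢ x) (append_app _ _ _)
  obtain ⟨t, ht, -⟩ := exists_append_of_app_eq hz'.symm (by omega)
  have htne : t ≠ [] := by
    rintro rfl
    rw [List.append_nil] at ht
    rw [ht] at hl
    exact hl le_rfl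
  have hdr : dr G.length (per O d) = t ⌢ per O d := by
    conv_lhs => rw [← he.app_per, ht, append_app, dr_app]
  have h1 : t ⌢ per O d ≤ per O d := hdr ▸ hmax G.length
  rcases sgn_eq_one_or (O := O) G with hp | hn
  · rw [ht, append_app, app_le_app_pos hp] at hz
    have hts : sgn O t = 1 := by
      have := he.sgn_eq
      rwa [ht, sgn_append, hp, one_mul] at this
    obtain ⟨ζ, hζ⟩ := exists_app_of_between h1 (hy.trans hz)
    have h2 : ζ ≤ per O d := by
      have := hmax t.length
      rwa [hζ, dr_app, ← hζ] at this
    have h3 : per O d ≤ ζ := by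
      conv_rhs at h1 => rw [hζ]
      exact (app_le_app_pos hts).1 h1
    have h4 := he.length_le t htne hts (by
      conv_rhs => rw [hζ, le_antisymm h2 h3])
    have := congrArg List.length ht
    rw [List.length_append] at this
    have := List.length_pos_iff.2 hG
    omega
  · have := h (per O d)
    rw [ht, append_app, app_lt_app_neg hn] at this
    exact absurd (hx.trans_lt this) (not_lt.2 h1)

lemma IsPosRoot.above_upper {d d' e : Word N} (he : IsPosRoot O d e) (h : TuningPair Γ O d d')
    (z : Sq O) : e ⋘ d' ⌢ z := by
  have hl := he.length_le d h.ne_nil h.sgn_lower h.app_per_lower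
  refine above_of_le (z := per O d) ?_ fun y hy => ?_
  · rw [he.app_per]; exact (h.per_lt_app z).le
  · obtain ⟨t, ht, -⟩ := exists_append_of_app_eq hy.symm (hl.trans_eq h.length_eq)
    refine not_app_of_lt he.ne_nil he.sgn_eq he.app_per h.per_lt_per h.ext'.dr_le
      (t ⌢ per O d') ?_
    rw [← append_app, ← ht, KneadingWords.app_per h.ne_nil']

/-! ### Prolonging a tuned prefix over a gap -/

lemma extremal_of_below {F : Word N} (hF : Periodic Γ F)
    (h : ∀ q s, F = q ++ s → q ≠ [] → s ≠ [] → s ⌢ per O F ≪ F) :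
    Extremal Γ O F ∧ IrreducibleWord F := by
  have key : ∀ i, 0 < i → i < F.length → dr i (per O F) < per O F := by
    intro i hi hi'
    have h1 : F = F.take i ++ F.drop i := (List.take_append_drop i F).symm
    have hq : F.take i ≠ [] := by
      intro e
      have := congrArg List.length e
      rw [List.length_take, List.length_nil] at this
      omega
    have hs : F.drop i ≠ [] := by
      rw [Ne, List.drop_eq_nil_iff]
      omega
    have h2 := h _ _ h1 hq hs (per O F)
    have h3 := dr_per_append (O := O) (q := F.take i) (s := F.drop i)
      (by rw [List.take_append_drop]; exact hF.ne_nil)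
    rw [List.take_append_drop, List.length_take, min_eq_left hi'.le] at h3
    rwa [KneadingWords.app_per hF.ne_nil, ← h3] at h2
  exact ⟨extremal_of_dr_le hF (dr_le_of_lt_length hF.ne_nil fun i hi hi' => (key i hi hi').le),
    irreducible_of_dr_ne hF.ne_nil fun i hi hi' => (key i hi hi').ne⟩

/-- Data of a first gap: `κ = B x` where `B` is a tuned word starting with `d'` and `x` is
strictly between `d` and `d'`. -/
structure Gap (Γ : Digraph (Fin (N + 1))) (O : Fin (N + 1) → ℤˣ) (d d' : Word N) (v : Word 1)
    (x : Sq O) : Prop where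
  prime : PrimePair Γ O d d'
  max : ∀ n, dr n (tuning d d' (1 :: v) ⌢ x) ≤ tuning d d' (1 :: v) ⌢ x
  above : d ⋘ x
  below : x ≪ d'

lemma tuning_one_cons (d d' : Word N) (v : Word 1) :
    tuning d d' (1 :: v) = d' ++ tuning d d' v := by
  rw [tuning_cons, if_neg (by decide)]

lemma Below.append_tuning {d d' : Word N} {v : Word 1} {y : Sq O} (hy : y ≪ d') (Q : Word N) :
    y ≪ tuning d d' (1 :: v) ++ Q := by
  rw [tuning_one_cons, List.append_assoc]
  exact hy.append _

lemma wpow_root_split {d e : Word N} {K j : ℕ} (hd : d = wpow e K) (hj : j < K) :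
    d = wpow e j ++ (e ++ wpow e (K - j - 1)) := by
  rw [← wpow_succ, ← wpow_add, hd]
  congr 1
  omega

lemma IsPosRoot.lower_above {d e : Word N} (he : IsPosRoot O d e) {K j : ℕ} (hd : d = wpow e K)
    (hj : j < K) {y : Sq O} (hy : e ⋘ y) : d ⋘ wpow e j ⌢ y := by
  intro z
  rw [wpow_root_split hd hj, append_app]
  refine (app_lt_app_pos ?_).2 (hy.append _ z)
  rw [sgn_wpow, he.sgn_eq, one_pow]

lemma IsPosRoot.pow_below {d d' e : Word N} (he : IsPosRoot O d e) (h : TuningPair Γ O d d')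
    {j : ℕ} (hj : j ≠ 0) (y : Sq O) : wpow e j ⌢ y ≪ d' := by
  obtain ⟨i, rfl⟩ := Nat.exists_eq_succ_of_ne_zero hj
  intro z
  rw [wpow_succ, append_app]
  exact he.above_upper h z _

lemma PrimePair.below_of_root_suffix {d d' e g t : Word N} {K : ℕ} (h : PrimePair Γ O d d')
    (hd : d = wpow e K) (he : e = g ++ t) (ht : t ≠ []) {y : Sq O} (hy : per O d ≤ y) :
    t ⌢ y ≪ d' := by
  have hK : K ≠ 0 := by
    rintro rfl
    exact h.pair.ne_nil hd
  obtain ⟨k, rfl⟩ := Nat.exists_eq_succ_of_ne_zero hK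
  refine h.below_of_lower_eq (g := wpow e k ++ g) ?_ ht hy
  rw [hd, wpow_succ', List.append_assoc, ← he]

/-- Suffixes of `B e ^ j G` followed by `Y` are smaller than `B e ^ j G`, if this holds for the
suffixes of `G`. -/
lemma Gap.suffix_below {d d' e G : Word N} {v : Word 1} {x Y : Sq O} {K j : ℕ}
    (hg : Gap Γ O d d' v x) (he : IsPosRoot O d e) (hd : d = wpow e K) (hj : j < K)
    (hY : e ⋘ G ⌢ Y) (hY' : j = 0 → G ⌢ Y ≪ d')
    (hG : ∀ q s, wpow e j ++ G = q ++ s → q ≠ [] → s ≠ [] → (∃ q', G = q' ++ s) →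
      s ⌢ Y ≪ tuning d d' (1 :: v) ++ (wpow e j ++ G))
    {q s : Word N} (hqs : tuning d d' (1 :: v) ++ (wpow e j ++ G) = q ++ s) (hq : q ≠ [])
    (hs : s ≠ []) : s ⌢ Y ≪ tuning d d' (1 :: v) ++ (wpow e j ++ G) := by
  have hGY : per O d ≤ G ⌢ Y := by
    have := (hY (per O d)).le
    rwa [he.app_per] at this
  refine hg.prime.suffix_below hg.max hg.above hg.below ?_ ?_ ?_ hqs hq hs
  · rw [append_app]; exact he.lower_above hd hj hY
  · rw [append_app]
    by_cases hj0 : j = 0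
    · subst hj0
      simpa using hY' rfl
    · exact he.pow_below hg.prime.pair hj0 _
  · intro q' s' hqs' hq' hs'
    rcases wpow_append_eq_append hqs' with ⟨q'', h1, -⟩ | ⟨g, t, i, h1, h2, rfl⟩
    · exact hG q' s' hqs' hq' hs' ⟨q'', h1⟩
    · rw [append_app, append_app]
      exact Below.append_tuning (hg.prime.below_of_root_suffix hd h1 h2 (he.le_app hGY i)) _

/-- The sequence in the gap is a power of the root of `d`, shorter than `d`, followed by something
strictly above the root. -/
lemma Gap.exists_root_decomposition {d d' e : Word N} {v : Word 1} {x : Sq O} {K : ℕ}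
    (hg : Gap Γ O d d' v x) (he : IsPosRoot O d e) (hd : d = wpow e K) :
    ∃ j x₁, j < K ∧ x = wpow e j ⌢ x₁ ∧ e ⋘ x₁ := by
  classical
  have hpos : ∀ i, sgn O (wpow e i) = 1 := fun i => by rw [sgn_wpow, he.sgn_eq, one_pow]
  have hno : ∀ y : Sq O, x ≠ wpow e K ⌢ y := fun y => hd ▸ hg.above.not_app y
  have hex : ∃ j, ¬ ∃ x₁, x = wpow e (j + 1) ⌢ x₁ := by
    have hK : K ≠ 0 := by
      rintro rfl
      exact hg.prime.pair.ne_nil hd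
    obtain ⟨k, rfl⟩ := Nat.exists_eq_succ_of_ne_zero hK
    exact ⟨k, fun ⟨x₁, h⟩ => hno x₁ h⟩
  obtain ⟨j, hj, hmin⟩ : ∃ j, (¬ ∃ x₁, x = wpow e (j + 1) ⌢ x₁) ∧ ∃ x₁, x = wpow e j ⌢ x₁ := by
    refine ⟨Nat.find hex, Nat.find_spec hex, ?_⟩
    rcases h : Nat.find hex with _ | i
    · exact ⟨x, by simp⟩
    · have := Nat.find_min hex (m := i) (by omega)
      exact not_not.1 this
  obtain ⟨x₁, rfl⟩ := hmin
  have hjK : j < K := by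
    by_contra hc
    obtain ⟨l, rfl⟩ := Nat.exists_eq_add_of_le (not_lt.1 hc)
    exact hno (wpow e l ⌢ x₁) (by rw [wpow_add, append_app])
  refine ⟨j, x₁, hjK, rfl, above_of_le (z := wpow e (K - j - 1) ⌢ per O d) ?_ fun y hy => ?_⟩
  · have := hg.above (per O d)
    rw [wpow_root_split hd hjK, append_app, append_app, app_lt_app_pos (hpos j)] at this
    rw [← wpow_root_split hd hjK] at this
    exact this.le
  · refine hj ⟨y, ?_⟩
    rw [wpow_succ', append_app, ← hy]

/-- The sequence after the first `d'` is strictly below `d'`. Otherwise every tail after a block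
would start with `d'`, and there would be no gap. -/
lemma Gap.rest_below {d d' : Word N} {v : Word 1} {x : Sq O} (hg : Gap Γ O d d' v x) :
    tuning d d' v ⌢ x ≪ d' := by
  have hp := hg.prime.pair
  set B := tuning d d' (1 :: v) with hB
  have hκ : B ⌢ x = d' ⌢ tuning d d' v ⌢ x := by rw [hB, tuning_one_cons, append_app]
  by_contra hc
  obtain ⟨z, hz⟩ := not_below hc
  have hle : tuning d d' v ⌢ x ≤ B ⌢ x := by
    have := hg.max d'.length
    conv_lhs at this => rw [hκ, dr_app]
    exact this
  have key : ∀ n, tuning d d' v ⌢ x ≤ dr (n * d'.length) (B ⌢ x) := by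
    intro n
    induction n with
    | zero => simpa using hle
    | succ n ih =>
      have h1 := hg.max (n * d'.length)
      obtain ⟨y, hy⟩ := exists_app_of_between (hz.trans ih) (h1.trans hκ.le)
      rw [Nat.succ_mul, Nat.add_comm (n * d'.length), ← dr_dr, hy, dr_app]
      rw [hy, hκ] at h1
      exact (app_le_app_neg hp.sgn_upper).1 h1
  have h2 := key (v.length + 1)
  rw [show (v.length + 1) * d'.length = B.length by
    rw [hB, length_tuning hp.length_eq, hp.length_eq, List.length_cons], dr_app] at h2
  exact absurd (hz.trans h2) (not_le.2 (hg.below z))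

lemma Gap.suffix_below_root {d d' e : Word N} {v : Word 1} {x : Sq O} {K j : ℕ}
    (hg : Gap Γ O d d' v x) (he : IsPosRoot O d e) (hd : d = wpow e K) (hj : j < K) (hj0 : j ≠ 0)
    (Y : Sq O) {q s : Word N} (hqs : tuning d d' (1 :: v) ++ (wpow e j ++ []) = q ++ s)
    (hq : q ≠ []) (hs : s ≠ []) :
    s ⌢ d' ⌢ Y ≪ tuning d d' (1 :: v) ++ (wpow e j ++ []) := by
  refine hg.suffix_below he hd hj ?_ (fun h => absurd h hj0) ?_ hqs hq hs
  · exact he.above_upper hg.prime.pair Y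
  · rintro q s - - hs ⟨q', h⟩
    exact absurd (List.append_eq_nil_iff.1 h.symm).2 hs

lemma Gap.suffix_below_upper {d d' e : Word N} {v : Word 1} {x x' : Sq O} {K j : ℕ}
    (hg : Gap Γ O d d' v x) (he : IsPosRoot O d e) (hd : d = wpow e K) (hj : j < K) (hj0 : j ≠ 0)
    (hx : x = wpow e j ⌢ d' ⌢ x')
    (Y : Sq O) {q s : Word N} (hqs : tuning d d' (1 :: v) ++ (wpow e j ++ d') = q ++ s)
    (hq : q ≠ []) (hs : s ≠ []) :
    s ⌢ d' ⌢ Y ≪ tuning d d' (1 :: v) ++ (wpow e j ++ d') := by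
  have hp := hg.prime.pair
  refine hg.suffix_below he hd hj ?_ (fun h => absurd h hj0) ?_ hqs hq hs
  · exact he.above_upper hp _
  · rintro q s - - hs ⟨q', h⟩
    by_cases hq' : q' = []
    · subst hq'
      rw [List.nil_append] at h
      subst h
      rw [tuning_one_cons, List.append_assoc]
      intro z
      rw [append_app, app_lt_app_neg hp.sgn_upper]
      have h1 := hg.rest_below
      rw [hx, ← append_app, ← append_app] at h1
      have h2 : (tuning d d' v ++ (wpow e j ++ d')) ⌢ z ≪ d' := by
        refine h1.congr le_rfl ?_
        rw [← List.append_assoc]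
        refine tk_mono (n := ((tuning d d' v ++ wpow e j) ++ d').length)
          (by rw [List.length_append]; omega) ?_
        rw [tk_app, tk_app]
      exact h2 Y
    · have h1 := hg.prime
      rw [h] at h1
      have := h1.below_of_suffix_upper hs hq' (y := d' ⌢ Y) (hp.per_lt_app _).le
      rw [← h] at this
      exact Below.append_tuning this _

/-- The case of `Gap.suffix_below` where `G` is the way to the first return above `d ^ ∞`. -/
lemma Gap.suffix_below_return {d d' e G : Word N} {v : Word 1} {x x' Y : Sq O} {K j : ℕ}
    (hg : Gap Γ O d d' v x) (he : IsPosRoot O d e) (hd : d = wpow e K) (hj : j < K)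
    (hG0 : G ≠ []) (hGa : e ⋘ G ⌢ x') (hGb : G ⌢ x' ≪ d') (hx' : per O d ≤ x')
    (hmin : ∀ q s, G = q ++ s → q ≠ [] → s ≠ [] → s ⌢ x' < per O d) (hY : per O d ≤ Y)
    {q s : Word N} (hqs : tuning d d' (1 :: v) ++ (wpow e j ++ G) = q ++ s)
    (hq : q ≠ []) (hs : s ≠ []) :
    s ⌢ Y ≪ tuning d d' (1 :: v) ++ (wpow e j ++ G) := by
  have hGY := hg.prime.below_exchange hG0 hx' hY hGb
  refine hg.suffix_below he hd hj ?_ (fun _ => hGY) ?_ hqs hq hs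
  · exact he.above_exchange hg.prime.pair.ext.dr_le hG0 hx' hY hGa
  · rintro q s - - hs ⟨q', h⟩
    by_cases hq' : q' = []
    · subst hq'
      rw [List.nil_append] at h
      subst h
      exact Below.append_tuning hGY _
    · exact Below.append_tuning (hg.prime.below_of_app_lt hx' hY (hmin q' s h hq' hs)) _

/-- The prefix `B Q` of `κ = B Q x'` is extremal and irreducible if its proper suffixes stay below
it. Its periodic sequence starts with `d'`, so only tails of the form `d' Y` have to be
considered. -/
lemma Gap.extremal {d d' Q : Word N} {v : Word 1} {x x' : Sq O} (hg : Gap Γ O d d' v x)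
    (hpath : IsPath Γ (tuning d d' (1 :: v) ⌢ x))
    (hF : x = Q ⌢ x') (hx' : per O d ≤ x')
    (h : ∀ Y : Sq O, ∀ q s, tuning d d' (1 :: v) ++ Q = q ++ s → q ≠ [] → s ≠ [] →
      s ⌢ d' ⌢ Y ≪ tuning d d' (1 :: v) ++ Q) :
    Extremal Γ O (tuning d d' (1 :: v) ++ Q) ∧ IrreducibleWord (tuning d d' (1 :: v) ++ Q) := by
  have hp := hg.prime.pair
  have e : ∀ y : Sq O, (tuning d d' (1 :: v) ++ Q) ⌢ y = d' ⌢ (tuning d d' v ++ Q) ⌢ y := by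
    intro y
    rw [tuning_one_cons, List.append_assoc, append_app]
  have hne : tuning d d' (1 :: v) ++ Q ≠ [] :=
    ne_nil_of_append (by rw [tuning_one_cons]; exact ne_nil_of_append hp.ne_nil')
  have hper : Periodic Γ (tuning d d' (1 :: v) ++ Q) := by
    refine periodic_of_isPath (O := O) hne (x := x') ?_ ?_
      (first_eq_last_of_le hx' hp.ext.periodic.per_first)
    · rwa [append_app, ← hF]
    · rw [e]; exact hp.ext'.periodic.app_first _
  refine extremal_of_below (O := O) hper fun q s hqs hq hs => ?_
  have := h ((tuning d d' v ++ Q) ⌢ per O (tuning d d' (1 :: v) ++ Q)) q s hqs hq hs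
  rwa [← e, app_per hne] at this

/-- A periodic sequence `κ = B x` with a gap after `B` has a prefix longer than `B` that is
negative, extremal and irreducible, or a positive prefix longer than `B` to which every
`Y ≥ d ^ ∞` may be appended, unless the period is `B e ^ j` for the root `e` of `d`.

Write `x = e ^ j x₁` with `j` maximal, so that `x₁` is strictly above `e`. The prefix is one of
`B e ^ j`, `B e ^ j d'` and `B e ^ j G`, where `G` leads from `x₁` to its first return above
`d ^ ∞`. -/
lemma Gap.prolong {d d' : Word N} {v : Word 1} {x : Sq O} {p : ℕ} (hg : Gap Γ O d d' v x)
    (hpath : IsPath Γ (tuning d d' (1 :: v) ⌢ x))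
    (hdr : dr p (tuning d d' (1 :: v) ⌢ x) = tuning d d' (1 :: v) ⌢ x)
    (hsgn : sgn O (tk p (tuning d d' (1 :: v) ⌢ x)) = 1)
    (hlt : (tuning d d' (1 :: v)).length < p) :
    (∃ F x', tuning d d' (1 :: v) ⌢ x = F ⌢ x' ∧ (tuning d d' (1 :: v)).length < F.length ∧
      F.length < p ∧ sgn O F = -1 ∧ Extremal Γ O F ∧ IrreducibleWord F) ∨
    (∃ F x', tuning d d' (1 :: v) ⌢ x = F ⌢ x' ∧ (tuning d d' (1 :: v)).length < F.length ∧
      per O d ≤ x' ∧ sgn O F = 1 ∧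
      ∀ Y, per O d ≤ Y → ∀ q s, F = q ++ s → q ≠ [] → s ≠ [] → s ⌢ Y ≪ F) ∨
    ∃ e K j, IsPosRoot O d e ∧ d = wpow e K ∧ j ≠ 0 ∧ j < K ∧
      tk p (tuning d d' (1 :: v) ⌢ x) = tuning d d' (1 :: v) ++ wpow e j := by
  have hp := hg.prime.pair
  have hκ : tuning d d' (1 :: v) ⌢ x = d' ⌢ tuning d d' v ⌢ x := by rw [tuning_one_cons, append_app]
  obtain ⟨e, K, he, hd⟩ := exists_posRoot hp.ne_nil hp.sgn_lower
  obtain ⟨j, x₁, hjK, rfl, hx₁⟩ := hg.exists_root_decomposition he hd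
  set B := tuning d d' (1 :: v) with hB
  set κ := B ⌢ wpow e j ⌢ x₁ with hκdef
  have hposj : sgn O (wpow e j) = 1 := by rw [sgn_wpow, he.sgn_eq, one_pow]
  have hx₁δ : per O d ≤ x₁ := by
    have := (hx₁ (per O d)).le
    rwa [he.app_per] at this
  have hκB : ¬ κ ≪ d' := fun h => h.not_app _ hκ
  have hdrκ : dr (B ++ wpow e j).length κ = x₁ := by
    rw [hκdef, ← append_app, dr_app]
  -- the period does not end inside `e ^ j`
  have hle : (B ++ wpow e j).length ≤ p := by
    by_contra hc
    rw [List.length_append] at hc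
    obtain ⟨a, rfl⟩ := Nat.exists_eq_add_of_le hlt.le
    have h1 : wpow e j ++ [] = (wpow e j).take a ++ (wpow e j).drop a := by simp
    have h2 : (wpow e j).drop a ≠ [] := by rw [Ne, List.drop_eq_nil_iff]; omega
    have h3 : κ = (wpow e j).drop a ⌢ x₁ := by
      rw [← hdr, hκdef, add_comm, ← dr_dr, dr_app]
      have h4 : ((wpow e j).take a).length = a := by rw [List.length_take]; omega
      conv_lhs => rw [← List.take_append_drop a (wpow e j), append_app]
      conv_lhs => arg 1; rw [← h4]
      rw [dr_app]
    rcases wpow_append_eq_append h1 with ⟨q', h4, -⟩ | ⟨g, t, i, h4, h5, h6⟩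
    · exact h2 (List.append_eq_nil_iff.1 h4.symm).2
    · refine hκB ?_
      rw [h3, h6, append_app, List.append_nil]
      exact hg.prime.below_of_root_suffix hd h4 h5 (he.le_app hx₁δ i)
  have htk : ∀ F : Word N, ∀ y, κ = F ⌢ y → F.length = p → tk p κ = F := by
    rintro F y h rfl
    rw [h, tk_app]
  have hlt_of : ∀ F : Word N, ∀ y, κ = F ⌢ y → F.length ≤ p → sgn O F = -1 → F.length < p := by
    intro F y h hl hs
    refine lt_of_le_of_ne hl fun h2 => ?_
    rw [htk F y h h2, hs] at hsgn
    norm_num at hsgn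
  by_cases hcase : j ≠ 0 ∧ sgn O B = -1
  · left
    obtain ⟨hj0, hBs⟩ := hcase
    have hF : κ = (B ++ (wpow e j ++ [])) ⌢ x₁ := by
      rw [List.append_nil, append_app]
    have hs : sgn O (B ++ (wpow e j ++ [])) = -1 := by
      rw [List.append_nil, sgn_append, hBs, hposj, mul_one]
    have hext := hg.extremal (Q := wpow e j ++ []) hpath (by rw [List.append_nil]) hx₁δ
      fun Y q s h1 h2 h3 => hg.suffix_below_root he hd hjK hj0 Y h1 h2 h3
    refine ⟨_, x₁, hF, ?_, hlt_of _ _ hF (by rwa [List.append_nil]) hs, hs, hext.1, hext.2⟩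
    rw [List.append_nil, List.length_append]
    have := List.length_pos_iff.2 (wpow_ne_nil he.ne_nil hj0)
    omega
  by_cases hb : x₁ ≪ d'
  · have hne : (B ++ wpow e j).length ≠ p := by
      intro h
      rw [h, hdr] at hdrκ
      rw [hdrκ] at hκB
      exact hκB hb
    -- the first return of `x₁` to the sequences above `d ^ ∞`
    have hret : 0 < p - (B ++ wpow e j).length ∧
        per O d ≤ dr (p - (B ++ wpow e j).length) x₁ := by
      refine ⟨by omega, ?_⟩
      rw [← hdrκ, dr_dr, Nat.sub_add_cancel hle, hdr, hκ]
      exact (hp.per_lt_app _).le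
    classical
    have hex : ∃ n, 0 < n ∧ per O d ≤ dr n x₁ := ⟨_, hret⟩
    set n := Nat.find hex with hn
    obtain ⟨hn0, hnδ⟩ := Nat.find_spec hex
    rw [← hn] at hn0 hnδ
    have hnle : n ≤ p - (B ++ wpow e j).length := Nat.find_min' hex hret
    set G := tk n x₁ with hG
    have hGx : G ⌢ dr n x₁ = x₁ := tk_app_dr n x₁
    have hG0 : G ≠ [] := by
      intro h
      have := congrArg List.length h
      rw [hG, length_tk, List.length_nil] at this
      omega
    have hmin : ∀ q s, G = q ++ s → q ≠ [] → s ≠ [] → s ⌢ dr n x₁ < per O d := by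
      intro q s h hq hs
      by_contra hc
      have h1 : dr q.length x₁ = s ⌢ dr n x₁ := by
        conv_lhs => rw [← hGx, h, append_app, dr_app]
      refine Nat.find_min hex (m := q.length) ?_ ⟨List.length_pos_iff.2 hq, ?_⟩
      · have h2 := congrArg List.length h
        rw [hG, length_tk, List.length_append] at h2
        have := List.length_pos_iff.2 hs
        rw [← hn]
        omega
      · rw [h1]; exact not_lt.1 hc
    have hF : κ = (B ++ (wpow e j ++ G)) ⌢ dr n x₁ := by
      rw [append_app, append_app, hGx]
    have hFl : (B ++ (wpow e j ++ G)).length = (B ++ wpow e j).length + n := by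
      rw [← List.append_assoc, List.length_append, hG, length_tk]
    have hBF : B.length < (B ++ (wpow e j ++ G)).length := by
      rw [hFl, List.length_append]
      omega
    have hsuf : ∀ Y, per O d ≤ Y → ∀ q s, B ++ (wpow e j ++ G) = q ++ s → q ≠ [] → s ≠ [] →
        s ⌢ Y ≪ B ++ (wpow e j ++ G) := fun Y hY q s h1 h2 h3 =>
      hg.suffix_below_return he hd hjK hG0 (by rwa [hGx]) (by rwa [hGx]) hnδ hmin hY h1 h2 h3
    rcases sgn_eq_one_or (O := O) (B ++ (wpow e j ++ G)) with hs | hs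
    · exact Or.inr (Or.inl ⟨_, _, hF, hBF, hnδ, hs, hsuf⟩)
    · have hext := hg.extremal (Q := wpow e j ++ G) hpath (by rw [append_app, hGx]) hnδ
        fun Y q s h1 h2 h3 => hsuf _ (hp.per_lt_app _).le q s h1 h2 h3
      exact Or.inl ⟨_, _, hF, hBF, hlt_of _ _ hF (by omega) hs, hs, hext.1, hext.2⟩
  · have hj0 : j ≠ 0 := by
      rintro rfl
      exact hb (by simpa using hg.below)
    have hBs : sgn O B = 1 := by
      rcases sgn_eq_one_or (O := O) B with h | h
      · exact h
      · exact absurd ⟨hj0, h⟩ hcase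
    have hx₁κ : x₁ ≤ κ := by rw [← hdrκ]; exact hg.max _
    obtain ⟨x', rfl⟩ : ∃ x', x₁ = d' ⌢ x' := by
      obtain ⟨z, hz⟩ := not_below hb
      exact exists_app_of_between hz (hx₁κ.trans hκ.le)
    have hx'δ : per O d ≤ x' := by
      rw [hκ, app_le_app_neg hp.sgn_upper] at hx₁κ
      exact (hp.le_tuning_app v (he.le_app hx₁δ j)).trans hx₁κ
    by_cases hpe : (B ++ wpow e j).length = p
    · refine Or.inr (Or.inr ⟨e, K, j, he, hd, hj0, hjK, ?_⟩)
      exact htk _ (d' ⌢ x') (by rw [append_app]) hpe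
    left
    have hF : κ = (B ++ (wpow e j ++ d')) ⌢ x' := by
      rw [append_app, append_app]
    have hs : sgn O (B ++ (wpow e j ++ d')) = -1 := by
      rw [sgn_append, sgn_append, hBs, hposj, hp.sgn_upper]; norm_num
    have hFl : (B ++ (wpow e j ++ d')).length = (B ++ wpow e j).length + d'.length := by
      rw [← List.append_assoc, List.length_append]
    -- the period does not end inside `d'`
    have hle2 : (B ++ (wpow e j ++ d')).length ≤ p := by
      by_contra hc
      obtain ⟨a, ha⟩ := Nat.exists_eq_add_of_le hle
      have h4 : (d'.take a).length = a := by rw [List.length_take]; omega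
      have h5 : κ = d'.drop a ⌢ x' := by
        rw [← hdr, ha, add_comm, ← dr_dr, hdrκ]
        conv_lhs => rw [← List.take_append_drop a d', append_app]
        conv_lhs => arg 1; rw [← h4]
        rw [dr_app]
      have h6 := hg.prime
      rw [← List.take_append_drop a d'] at h6
      refine hκB ?_
      have := h6.below_of_suffix_upper (y := x') (by rw [Ne, List.drop_eq_nil_iff]; omega) (by
        intro h
        rw [h, List.length_nil] at h4
        omega) hx'δ
      rwa [List.take_append_drop, ← h5] at this
    have hext := hg.extremal (Q := wpow e j ++ d') hpath (by rw [append_app]) hx'δ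
      fun Y q s h1 h2 h3 => hg.suffix_below_upper he hd hjK hj0 rfl Y h1 h2 h3
    refine ⟨_, x', hF, ?_, hlt_of _ _ hF hle2 hs, hs, hext.1, hext.2⟩
    rw [hFl, List.length_append]
    have := List.length_pos_iff.2 hp.ne_nil'
    omega

/-! ### Borders of irreducible extremal words -/

/-- A suffix of an extremal word that is not one of its prefixes is strictly smaller than the prefix
of the same length. -/
lemma Extremal.suffix_lt_of_ne {w q s : Word N} (hw : Extremal Γ O w) (hq : w = q ++ s)
    (hne : tk s.length (per O w) ≠ s) (x y : Sq O) : s ⌢ x < tk s.length (per O w) ⌢ y := by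
  have h1 : s ⌢ per O w ≤ per O w := by subst hq; exact hw.suffix_le
  rw [← tk_app_dr s.length (per O w)] at h1
  by_contra hc
  rw [tk_app_dr s.length (per O w)] at h1
  conv_rhs at h1 => rw [← tk_app_dr s.length (per O w)]
  exact hne (eq_of_interleave (by simp) h1 (not_lt.1 hc)).symm

lemma per_append_eq {s t : Word N} (h : s ++ t ≠ []) :
    per O (s ++ t) = s ⌢ t ⌢ per O (s ++ t) := by
  rw [← append_app, app_per h]

/-- Borders of an irreducible extremal word are negative. -/
lemma Extremal.border_sgn {w q a y : Word N} (hw : Extremal Γ O w) (hirr : IrreducibleWord w)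
    (hay : w = a ++ y) (hqa : w = q ++ a) (ha : a ≠ []) (hy : y ≠ []) : sgn O a = -1 := by
  rcases sgn_eq_one_or (O := O) a with hp | hn
  · exfalso
    have h1 : a ⌢ per O w ≤ per O w := by subst hqa; exact hw.suffix_le
    have h2 : per O w = a ⌢ y ⌢ per O w := by
      subst hay; exact per_append_eq hw.periodic.ne_nil
    have h3 : dr a.length (per O w) = y ⌢ per O w := by
      conv_lhs => rw [h2, dr_app]
    conv_rhs at h1 => rw [h2]
    rw [app_le_app_pos hp] at h1
    refine hirr.dr_ne (O := O) (List.length_pos_iff.2 ha) ?_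
      (le_antisymm (hw.dr_le a.length) (h3 ▸ h1))
    have := congrArg List.length hay
    rw [List.length_append] at this
    have := List.length_pos_iff.2 hy
    omega
  · exact hn

/-- A border after which the letter `N` follows is extremal and irreducible. -/
lemma Extremal.border_extremal {w q a y : Word N} (hw : Extremal Γ O w) (hirr : IrreducibleWord w)
    (hay : w = a ++ y) (hqa : w = q ++ a) (ha : a ≠ []) (hy : y ≠ [])
    (h0 : (y ⌢ per O w) 0 = Fin.last N) : Extremal Γ O a ∧ IrreducibleWord a := by
  have hsgn := hw.border_sgn hirr hay hqa ha hy
  have h2 : per O w = a ⌢ y ⌢ per O w := by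
    subst hay; exact per_append_eq hw.periodic.ne_nil
  have hper : Periodic Γ a := by
    refine periodic_of_isPath (O := O) ha (x := y ⌢ per O w) ?_ ?_ h0
    · rw [← h2]; exact hw.periodic.isPath
    · rw [← h2]; exact hw.periodic.per_first
  have hpre : ∀ n, n ≤ a.length → ∃ r, a = tk n (per O w) ++ r := by
    intro n hn
    refine ⟨a.drop n, ?_⟩
    have h3 : tk a.length (per O w) = a := by
      conv_lhs => arg 2; rw [h2]
      rw [tk_app]
    conv_lhs => rw [← List.take_append_drop n a]
    congr 1
    rw [← take_tk hn, h3]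
  refine extremal_of_below (O := O) hper fun g s hgs hg hs => ?_
  have hl := congrArg List.length hgs
  rw [List.length_append] at hl
  have hg' := List.length_pos_iff.2 hg
  have hs' := List.length_pos_iff.2 hs
  obtain ⟨t, ht⟩ := hpre s.length (by omega)
  have htl := congrArg List.length ht
  rw [List.length_append, length_tk] at htl
  have hws : w = (q ++ g) ++ s := by rw [hqa, hgs, List.append_assoc]
  by_cases he : tk s.length (per O w) = s
  · -- a border of a border; then the rest of the border is not a prefix
    rw [he] at ht
    have hsn : sgn O s = -1 := by
      refine hw.border_sgn hirr (a := s) (y := t ++ y) ?_ hws hs ?_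
      · rw [hay, ht, List.append_assoc]
      · intro h
        exact hy (List.append_eq_nil_iff.1 h).2
    have htn : t ≠ [] := by
      rintro rfl
      simp at htl
      omega
    have htp : sgn O t = 1 := by
      have := hsgn
      rw [ht, sgn_append, hsn] at this
      linarith
    have hwt : w = (q ++ s) ++ t := by rw [List.append_assoc, ← ht, hqa]
    have hne : tk t.length (per O w) ≠ t := by
      intro h
      obtain ⟨r, hr⟩ := hpre t.length (by omega)
      rw [h] at hr
      have := hw.border_sgn hirr (a := t) (y := r ++ y) (by rw [hay, hr]; simp) hwt htn (by
        intro h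
        exact hy (List.append_eq_nil_iff.1 h).2)
      rw [htp] at this
      norm_num at this
    intro z
    conv_rhs => arg 1; rw [ht]
    rw [append_app, app_lt_app_neg hsn]
    obtain ⟨r, hr⟩ := hpre t.length (by omega)
    have := hw.suffix_lt_of_ne hwt hne z (r ⌢ per O a)
    rwa [← append_app, ← hr, app_per ha] at this
  · intro z
    conv_rhs => arg 1; rw [ht]
    rw [append_app]
    exact hw.suffix_lt_of_ne hws he _ _

/-! ### The minimal word and prime words -/

lemma IsMinWord.dr_le {m : Word N} (hm : IsMinWord Γ O m) (n : ℕ) :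
    dr n (per O m) ≤ per O m := by
  by_cases h : dr n (per O m) 0 = Fin.last N
  · obtain ⟨k, rfl⟩ := hm.dvd_of_first (O := O) (i := n) (by simpa [dr] using h)
    rw [mul_comm, dr_mul_of_dr (dr_per hm.1.ne_nil)]
  · refine (lt_of_first_lt ?_).le
    rw [hm.1.per_first]
    exact Fin.lt_last_iff_ne_last.2 h

/-- `w ^ ∞ ≠ m ^ ∞`, because the letters `N` of `m ^ ∞` are `m.length` apart. -/
lemma PrimeWord.per_ne {m w : Word N} (hw : PrimeWord Γ O m w) (hm : IsMinWord Γ O m) :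
    per O w ≠ per O m := by
  intro h
  have hne := hw.adm.1.periodic.ne_nil
  have h1 : per O m w.length = Fin.last N := by
    have := congrFun (dr_per (O := O) hne) 0
    rw [hw.adm.1.periodic.per_first, h] at this
    simpa [dr] using this
  obtain ⟨c, hc⟩ := hm.dvd_of_first h1
  refine hw.ne_wpow c ?_
  have hc0 : c ≠ 0 := by
    rintro rfl
    exact hne (List.length_eq_zero_iff.1 (by simpa using hc))
  rw [← tk_per (O := O) hne, h, ← per_wpow hm.1.ne_nil hc0]
  conv_rhs => rw [← tk_per (O := O) (wpow_ne_nil hm.1.ne_nil hc0)]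
  rw [length_wpow, hc, mul_comm]

lemma PrimeWord.dr_ne_min {m w : Word N} (hw : PrimeWord Γ O m w) (hm : IsMinWord Γ O m) (i : ℕ) :
    dr i (per O w) ≠ per O m := by
  intro h
  have hne := hw.adm.1.periodic.ne_nil
  obtain ⟨k, hk⟩ := exists_dr_back (List.length_pos_iff.2 hne) (dr_per (O := O) hne) i
  rw [h] at hk
  have h1 : per O m k = Fin.last N := by
    have := congrFun hk 0
    rw [hw.adm.1.periodic.per_first] at this
    simpa [dr] using this
  obtain ⟨c, rfl⟩ := hm.dvd_of_first h1
  rw [mul_comm, dr_mul_of_dr (dr_per hm.1.ne_nil)] at hk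
  exact hw.per_ne hm hk.symm

/-- A shift of the periodic sequence of an irreducible word has no smaller period. -/
lemma IrreducibleWord.dr_ne_per {w d : Word N} (hirr : IrreducibleWord w) (hd : d ≠ [])
    (hl : d.length < w.length) (i : ℕ) : dr i (per O w) ≠ per O d := by
  intro h
  have hne : w ≠ [] := by
    rintro rfl
    simp at hl
  refine hirr.dr_ne (O := O) (List.length_pos_iff.2 hd) hl
    (dr_of_dr_dr (List.length_pos_iff.2 hne) (dr_per hne) (n := i) ?_)
  rw [h, dr_per hd]

/-! ### Constructing approximating sequences -/

lemma EndsBelow.mono {m : Word N} {κ κ' c : Sq O} (h : EndsBelow Γ m κ c) (hle : κ ≤ κ') :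
    EndsBelow Γ m κ' c :=
  ⟨h.isPath, h.ends, fun i => (h.dr_le i).trans hle⟩

lemma EndsBelow.app {m F : Word N} {κ c : Sq O} (h : EndsBelow Γ m κ c) (hpath : IsPath Γ (F ⌢ c))
    (hle : F ⌢ c ≤ κ) (hs : ∀ q s, F = q ++ s → q ≠ [] → s ≠ [] → s ⌢ c ≤ κ) :
    EndsBelow Γ m κ (F ⌢ c) := by
  refine ⟨hpath, ?_, fun i => ?_⟩
  · obtain ⟨u, rfl⟩ := h.ends
    exact ⟨F ++ u, (append_app _ _ _).symm⟩
  · by_cases hi : F.length ≤ i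
    · obtain ⟨k, rfl⟩ := Nat.exists_eq_add_of_le hi
      rw [dr_length_add_app]
      exact h.dr_le k
    · by_cases hi0 : i = 0
      · subst hi0
        simpa using hle
      · have h1 : (F.take i).length = i := by rw [List.length_take]; omega
        have h2 : dr i (F ⌢ c) = F.drop i ⌢ c := by
          conv_lhs => rw [← List.take_append_drop i F, append_app]
          conv_lhs => arg 1; rw [← h1]
          rw [dr_app]
        rw [h2]
        refine hs _ _ (List.take_append_drop i F).symm ?_ ?_
        · intro h
          rw [h, List.length_nil] at h1
          exact hi0 h1.symm
        · rw [Ne, List.drop_eq_nil_iff]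
          exact hi

lemma tk_wpow_app {d : Word N} (hd : d ≠ []) {n k : ℕ} (hk : k ≤ n * d.length) (z : Sq O) :
    tk k (wpow d n ⌢ z) = tk k (per O d) := by
  refine tk_mono hk ?_
  rw [← length_wpow, tk_app, ← wpow_app_of_app (app_per (O := O) hd) n, tk_app]

lemma eventually_lt_wpow {d : Word N} (hd : d ≠ []) {x : Sq O} (h : x < per O d) :
    ∃ n₀, ∀ n, n₀ ≤ n → ∀ z : Sq O, x < wpow d n ⌢ z := by
  obtain ⟨J, -, hJ⟩ := Sq.lt_local h
  refine ⟨J, fun n hn z => hJ _ _ rfl (tk_wpow_app hd ?_ z)⟩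
  exact hn.trans (Nat.le_mul_of_pos_right _ (List.length_pos_iff.2 hd))

lemma wpow_app_first {d : Word N} (hd : Periodic Γ d) {n : ℕ} (hn : n ≠ 0) (z : Sq O) :
    (wpow d n ⌢ z) 0 = Fin.last N :=
  (hd.wpow (Nat.pos_of_ne_zero hn)).app_first z

/-- Approximants of `d ^ ∞` separate `ℓ < d ^ ∞` from `κ > d ^ ∞`. -/
lemma Approximable.exists_between {m d : Word N} (h : Approximable Γ O m d) (hd : d ≠ [])
    {κ ℓ : Sq O} (hκ : per O d < κ) (hℓ : ℓ < per O d) :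
    ∃ c, EndsBelow Γ m κ c ∧ ℓ < c ∧ c < κ := by
  obtain ⟨n, hn⟩ := eventually_lt_wpow hd hℓ
  obtain ⟨z, hz⟩ := h n
  exact ⟨_, hz.mono hκ.le, hn n le_rfl z, (hz.dr_le 0).trans_lt hκ⟩

/-- A positive prefix `F` of `κ` to which sequences above `d ^ ∞` may be
appended yields an approximating sequence. -/
lemma Approximable.exists_of_pos {m d F T a : Word N} (happ : Approximable Γ O m d)
    (hd : Periodic Γ d) {κ ℓ x : Sq O} (hpath : IsPath Γ κ) (hF : κ = F ⌢ x) (hx : per O d < x)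
    (hs : sgn O F = 1) (ha : a ≠ []) (hT : T ≠ [])
    (haT : F = a ++ T) (hℓ : ℓ = T ⌢ x)
    (hsuf : ∀ Y, per O d ≤ Y → ∀ q s, F = q ++ s → q ≠ [] → s ≠ [] → s ⌢ Y ≪ F)
    (hκ : per O d < κ) : ∃ c, EndsBelow Γ m κ c ∧ ℓ < c ∧ c < κ := by
  obtain ⟨z, hz⟩ := happ (F.length + 1)
  set y := wpow d (F.length + 1) ⌢ z with hy
  have hyδ : y ≤ per O d := hz.dr_le 0
  have hy0 : y 0 = Fin.last N := wpow_app_first hd (by omega) z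
  have hlt : F ⌢ y < κ := by
    rw [hF, app_lt_app_pos hs]
    exact hyδ.trans_lt hx
  have hshift : ∀ q s, F = q ++ s → q ≠ [] → s ≠ [] → s ⌢ y ≪ F := by
    intro q s h1 h2 h3
    refine (hsuf _ le_rfl q s h1 h2 h3).congr (n := s.length + F.length) (by omega) ?_
    refine app_tk_congr s (tk_wpow_app hd.ne_nil ?_ z).symm
    exact (Nat.le_succ _).trans (Nat.le_mul_of_pos_right _ (List.length_pos_iff.2 hd.ne_nil))
  refine ⟨F ⌢ y, (hz.mono hκ.le).app ?_ hlt.le ?_, ?_, hlt⟩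
  · refine IsPath.exchange (x := x) (hF ▸ hpath) hz.isPath ?_
    rw [first_eq_last_of_le hx.le hd.per_first]
    exact hy0
  · intro q s h1 h2 h3
    have := hshift q s h1 h2 h3 x
    rw [← hF] at this
    exact this.le
  · rw [hℓ]
    exact hsuf x hx.le a T haT ha hT y

/-- A negative extremal prefix `d' d ^ i` of `κ` that is followed by something below `d ^ ∞`
yields an approximating sequence. -/
lemma Approximable.exists_of_neg {m d d' a y : Word N} {i : ℕ} (happ : Approximable Γ O m d)
    (hp : PrimePair Γ O d d') {κ ξ : Sq O} (hmax : ∀ n, dr n κ ≤ κ)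
    (hF : Extremal Γ O (d' ++ wpow d i)) (hirr : IrreducibleWord (d' ++ wpow d i))
    (hκ : κ = (d' ++ wpow d i) ⌢ ξ) (hξ : ξ < per O d) (hay : d' ++ wpow d i = a ++ y)
    (ha : a ≠ []) (hy : y ≠ []) (has : sgn O a = -1) :
    ∃ c, EndsBelow Γ m κ c ∧ y ⌢ ξ < c ∧ c < κ := by
  have hpp := hp.pair
  set F := d' ++ wpow d i with hFdef
  have hFs : sgn O F = -1 := by
    rw [hFdef, sgn_append, sgn_wpow, hpp.sgn_lower, hpp.sgn_upper]; norm_num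
  have hlen : F.length = a.length + y.length := by rw [hay, List.length_append]
  have hla := List.length_pos_iff.2 ha
  have hly := List.length_pos_iff.2 hy
  -- `y` is not a prefix of `F`
  have hbelow : y ⌢ ξ ≪ F := by
    refine below_of_le (z := ξ) ?_ fun z hz => ?_
    · rw [← hκ]
      have := hmax a.length
      conv_lhs at this => rw [hκ, hay, append_app, dr_app]
      exact this
    · obtain ⟨t, ht, -⟩ := exists_append_of_app_eq hz (by omega)
      have hys : sgn O y = 1 := by
        have := hFs
        rw [hay, sgn_append, has] at this
        linarith
      have h1 : y ⌢ per O F ≤ per O F := by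
        have := hF
        rw [hay] at this ⊢
        exact this.suffix_le
      have h2 : per O F = y ⌢ t ⌢ per O F := by
        conv_lhs => rw [← app_per (O := O) hF.periodic.ne_nil]
        conv_lhs => arg 1; rw [ht]
        rw [append_app]
      conv_rhs at h1 => rw [h2]
      rw [app_le_app_pos hys] at h1
      have h3 : dr y.length (per O F) = t ⌢ per O F := by
        conv_lhs => rw [h2, dr_app]
      exact hirr.dr_ne (O := O) hly (by omega)
        (le_antisymm (hF.dr_le _) (h1.trans_eq h3.symm))
  obtain ⟨n₀, hn₀⟩ := eventually_lt_wpow hpp.ne_nil hξ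
  obtain ⟨z, hz⟩ := happ (n₀ + 1)
  set c := wpow d (n₀ + 1) ⌢ z with hc
  have hlt : F ⌢ c < κ := by
    rw [hκ, app_lt_app_neg hFs]
    exact hn₀ _ (by omega) z
  have hstart : ∀ x : Sq O, x ≪ d' → x < κ := fun x hx => by
    rw [hκ, hFdef, append_app]
    exact hx _
  have hδκ : per O d < κ := by
    rw [hκ, hFdef, append_app]
    exact hpp.per_lt_app _
  have htk : ∀ k, tk d.length (wpow d k ⌢ c) = tk d.length (per O d) := fun k => by
    rw [hc, ← append_app, ← wpow_add]
    exact tk_wpow_app hpp.ne_nil (Nat.le_mul_of_pos_left _ (by omega)) z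
  have hsuf : ∀ t k, t ⌢ per O d ≪ d' → t ⌢ wpow d k ⌢ c < κ := fun t k h => by
    refine hstart _ (h.congr (n := t.length + d.length) ?_ (app_tk_congr t (htk k).symm))
    rw [hpp.length_eq]; omega
  refine ⟨F ⌢ c, (hz.mono hδκ.le).app ?_ hlt.le ?_, hbelow c, hlt⟩
  · refine IsPath.exchange (x := per O F) ?_ hz.isPath ?_
    · rw [app_per hF.periodic.ne_nil]; exact hF.periodic.isPath
    · rw [hF.periodic.per_first]
      exact wpow_app_first hpp.ext.periodic (by omega) z
  · intro q s h1 h2 h3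
    rcases List.append_eq_append_iff.1 h1 with ⟨q', h4, h5⟩ | ⟨s', h4, rfl⟩
    · rw [← List.append_nil (wpow d i)] at h5
      rcases wpow_append_eq_append h5 with ⟨q'', h6, -⟩ | ⟨g, t, k, h6, h7, rfl⟩
      · exact absurd (List.append_eq_nil_iff.1 h6.symm).2 h3
      · rw [List.append_nil, append_app]
        exact (hsuf t k (hp.below_of_lower_eq h6 h7 le_rfl)).le
    · rw [append_app]
      by_cases hs' : s' = []
      · subst hs'
        rw [nil_app]
        by_cases hi : i = 0
        · subst hi
          rw [wpow_zero, nil_app]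
          exact (hz.dr_le 0).trans hδκ.le
        · obtain ⟨k, rfl⟩ := Nat.exists_eq_succ_of_ne_zero hi
          rw [wpow_succ, append_app]
          exact (hsuf d k fun z => hpp.app_lt _ z).le
      · have h6 := hp
        rw [h4] at h6
        have := h6.below_of_suffix_upper hs' h2 le_rfl
        rw [← h4] at this
        exact (hsuf s' i this).le

/-! ### Periods that end in a power of the root -/

/-- The period of `κ` is not `B e ^ j`, for a tuned word `B` that starts with `d'` and a proper
power `e ^ j` of the root `e` of `d`. Here `a` is a border of the period with `κ = a ℓ` and
`d ^ ∞ < ℓ`, tuned from a pair `(h, h')` with `h ^ ∞ < ℓ`. As `a` ends with `e`, the word `e`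
would be tuned from `(h, h')`, which makes `d` renormalizable. -/
lemma PrimePair.false_of_root_power {d d' h h' e q a y : Word N} {v u : Word 1} {K j : ℕ}
    (hd : PrimePair Γ O d d') (hh : PrimePair Γ O h h') (hren : ¬ Renormalizable Γ O d)
    (he : IsPosRoot O d e) (hdK : d = wpow e K) (hj0 : j ≠ 0) (hjK : j < K)
    {κ : Sq O} (hκ : κ = tuning d d' (1 :: v) ⌢ wpow e j ⌢ κ)
    (hqa : tuning d d' (1 :: v) ++ wpow e j = q ++ a)
    (hay : tuning d d' (1 :: v) ++ wpow e j = a ++ y) (hq : q ≠ [])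
    (hau : a = tuning h h' u) (hda : d.length ≤ a.length)
    (hδ : per O d < y ⌢ κ) (hη : per O h < y ⌢ κ) : False := by
  have hp := hd.pair
  have hhp := hh.pair
  have hel := List.length_pos_iff.2 he.ne_nil
  have hjl : j * e.length < d.length := by
    rw [hdK, length_wpow]
    exact Nat.mul_lt_mul_of_pos_right hjK hel
  have hκd : κ = d' ⌢ tuning d d' v ⌢ wpow e j ⌢ κ := by
    conv_lhs => rw [hκ, tuning_one_cons, append_app]
  have hδκ : per O d ≤ κ := by rw [hκd]; exact (hp.per_lt_app _).le
  have hκa : κ = a ⌢ y ⌢ κ := by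
    conv_lhs => rw [hκ, ← append_app, hay, append_app]
  obtain ⟨s', hB, ha⟩ : ∃ s', tuning d d' (1 :: v) = q ++ s' ∧ a = s' ++ wpow e j := by
    rcases List.append_eq_append_iff.1 hqa with ⟨q', h1, h2⟩ | ⟨s', h1, h2⟩
    · have := congrArg List.length h2
      rw [List.length_append, length_wpow] at this
      omega
    · exact ⟨s', h1, h2⟩
  have hs' : s' ≠ [] := by
    rintro rfl
    rw [ha, List.nil_append, length_wpow] at hda
    omega
  obtain ⟨v₁, c, v₂, g, t, hv, hc, ht, hq1, hs1⟩ := tuning_eq_append hB hs'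
  -- the border starts at an aligned position
  have hg : g = [] := by
    by_contra hg
    have h1 := hd.below_of_token hc hg ht
      (hp.le_tuning_app v₂ (he.le_app hδκ j))
    rw [← append_app, ← append_app, ← hs1, ← ha] at h1
    obtain ⟨r, hr, -⟩ := exists_append_of_app_eq (hκd.symm.trans hκa) (hp.length_eq ▸ hda)
    exact h1.not_app (r ⌢ κ) (by rw [hr, append_app])
  subst hg
  rw [List.nil_append] at hc
  rw [List.append_nil] at hq1
  have hs2 : s' = tuning d d' (c :: v₂) := by rw [hs1, tuning_cons, hc]
  have hv₁ : v₁ ≠ [] := by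
    rintro rfl
    exact hq hq1
  -- the rest of the sequence after the border starts with the root
  obtain ⟨ℓ', hℓ'⟩ : ∃ ℓ', y ⌢ κ = e ⌢ ℓ' := by
    obtain ⟨w, b, w', hw, hwl⟩ : ∃ w b w', (1 :: v : Word 1) = w ++ b :: w' ∧
        w.length = (c :: v₂).length := by
      have hlt : (c :: v₂).length < (1 :: v : Word 1).length := by
        rw [hv, List.length_append]
        have := List.length_pos_iff.2 hv₁
        omega
      obtain ⟨b, w', hbw⟩ := List.exists_cons_of_ne_nil
        (l := (1 :: v : Word 1).drop (c :: v₂).length) (by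
          rw [Ne, List.drop_eq_nil_iff]; omega)
      exact ⟨_, b, w', by rw [← hbw, List.take_append_drop], by
        rw [List.length_take]; omega⟩
    have h1 : tuning d d' w ⌢ ((if b = 0 then d else d') ⌢ tuning d d' w' ⌢ wpow e j ⌢ κ) =
        s' ⌢ wpow e j ⌢ y ⌢ κ := by
      rw [← append_app s', ← ha, ← hκa]
      conv_rhs => rw [hκ, hw, tuning_append, tuning_cons, append_app, append_app]
    have h2 := (app_eq_app (by
      rw [hs2, length_tuning hp.length_eq, length_tuning hp.length_eq, hwl]) h1).2
    by_cases hb : b = 0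
    · rw [if_pos hb, wpow_root_split hdK hjK, append_app, app_inj, append_app] at h2
      exact ⟨_, h2.symm⟩
    · rw [if_neg hb] at h2
      obtain ⟨i, rfl⟩ := Nat.exists_eq_succ_of_ne_zero hj0
      exact absurd (h2.trans (by rw [wpow_succ, append_app])) ((he.above_upper hp _).not_app _)
  have heℓ : per O d < e ⌢ y ⌢ κ := by
    conv_lhs => rw [← he.app_per]
    exact (app_lt_app_pos he.sgn_eq).2 hδ
  have hηδ : per O h ≤ per O d := by
    by_contra hc
    rw [not_le] at hc
    obtain ⟨z, hz⟩ := exists_app_of_between (u := e) (x := per O d) (y := ℓ') (z := per O h)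
      (by rw [he.app_per]; exact hc.le) (hℓ' ▸ hη.le)
    exact not_app_of_lt he.ne_nil he.sgn_eq he.app_per hc hhp.ext.dr_le z hz
  rcases hηδ.eq_or_lt with heq | hlt
  · -- equal lower words: the lengths do not match
    have h1 : h.length = d.length :=
      le_antisymm (hp.length_le_of_per_eq hhp heq.symm) (hhp.length_le_of_per_eq hp heq)
    have h2 := congrArg List.length ha
    rw [hau, hs2, List.length_append, length_tuning hhp.length_eq, length_tuning hp.length_eq, h1,
      length_wpow] at h2
    have h3 : d.length ∣ j * e.length :=
      (Nat.dvd_add_right (Dvd.intro_left _ rfl)).1 (h2 ▸ Dvd.intro_left _ rfl)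
    have h4 := Nat.le_of_dvd (Nat.mul_pos (Nat.pos_of_ne_zero hj0) hel) h3
    omega
  · -- the last root of the border is tuned
    obtain ⟨i, rfl⟩ := Nat.exists_eq_succ_of_ne_zero hj0
    have h1 : tuning h h' u = (s' ++ wpow e i) ++ e := by
      rw [← hau, ha, wpow_succ', List.append_assoc]
    obtain ⟨u₁, b, u₂, g, t, hu, hb, ht', -, het⟩ := tuning_eq_append h1 he.ne_nil
    have hg : g = [] := by
      by_contra hg
      have hle : per O h ≤ tuning h h' u₂ ⌢ y ⌢ κ := hhp.le_tuning_app u₂ hη.le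
      have hgt : per O h < t ⌢ tuning h h' u₂ ⌢ y ⌢ κ := by
        rw [← append_app t, ← het]
        exact hlt.trans heℓ
      by_cases hb0 : b = 0
      · rw [if_pos hb0] at hb
        subst hb
        rcases hh.app_le_of_suffix_lower hle with h3 | ⟨h3, h4⟩
        · exact absurd hgt (not_lt.2 h3)
        · refine not_app_of_lt ht' h3 h4 hlt hp.ext.dr_le (tuning (g ++ t) h' u₂ ⌢ per O d) ?_
          rw [← append_app, ← het, he.app_per]
      · rw [if_neg hb0] at hb
        subst hb
        exact absurd hgt (not_lt.2 (hh.app_le_of_suffix_upper ht' hg hle))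
    subst hg
    rw [List.nil_append] at hb
    have h2 : e = tuning h h' (b :: u₂) := by rw [het, tuning_cons, hb]
    have h3 : d = tuning h h' (wpow (b :: u₂) K) := by rw [tuning_wpow, ← h2, hdK]
    refine hren ?_
    have h4 := hp.1
    rw [h3] at h4 hlt ⊢
    exact hhp.renormalizable_of_tuning h4 hlt

/-! ### Separating the periodic sequence from its border tails -/

/-- A tuned word is a power of `d` or contains `d'`; in the latter case it lies above `d ^ ∞`,
whatever follows. -/
lemma TuningPair.le_tuning_or {d d' : Word N} (h : TuningPair Γ O d d') (v : Word 1) :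
    (∀ ξ : Sq O, per O d ≤ tuning d d' v ⌢ ξ) ∨ ∃ i, tuning d d' v = wpow d i := by
  induction v with
  | nil => exact Or.inr ⟨0, rfl⟩
  | cons c v ih =>
    by_cases hc : c = 0
    · rcases ih with h1 | ⟨i, hi⟩
      · left
        intro ξ
        rw [tuning_cons, if_pos hc, append_app]
        exact h.le_app (h1 ξ)
      · right
        exact ⟨i + 1, by rw [tuning_cons, if_pos hc, hi, wpow_succ]⟩
    · left
      intro ξ
      rw [tuning_cons, if_neg hc, append_app]
      exact (h.per_lt_app _).le

lemma tuning_block {d d' : Word N} (h : d.length = d'.length) {u : Word 1} {t : ℕ}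
    (ht : t < u.length) (ξ : Sq O) :
    ∃ (c : Fin (1 + 1)) (z : Sq O), dr (t * d.length) (tuning d d' u ⌢ ξ) =
      (if c = 0 then d else d') ⌢ z := by
  obtain ⟨c, u', hcu⟩ := List.exists_cons_of_ne_nil (l := u.drop t) (by
    rw [Ne, List.drop_eq_nil_iff]; omega)
  refine ⟨c, tuning d d' u' ⌢ ξ, ?_⟩
  have h1 : (tuning d d' (u.take t)).length = t * d.length := by
    rw [length_tuning h, List.length_take, min_eq_left ht.le]
  conv_lhs => rw [← List.take_append_drop t u, hcu, tuning_append, append_app, ← h1, dr_app,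
    tuning_cons, append_app]

/-- Let `κ = d' λ` dominate its shifts, with `λ` above `d ^ ∞`. As long as the blocks of
`κ` are copies of `d` and `d'`, the tails after these blocks stay above `d ^ ∞`. -/
lemma TuningPair.exists_tuning_prefix {d d' : Word N} (h : TuningPair Γ O d d') {κ l : Sq O}
    (hmax : ∀ n, dr n κ ≤ κ) (hκ : κ = d' ⌢ l) (hl : per O d ≤ l) {n : ℕ}
    (hblk : ∀ t < n, ∃ (c : Fin (1 + 1)) (z : Sq O), dr (t * d.length) κ =
      (if c = 0 then d else d') ⌢ z) :
    per O d ≤ dr (n * d.length) κ ∧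
      ∃ v : Word 1, v.length = n ∧ κ = tuning d d' v ⌢ dr (n * d.length) κ := by
  induction n with
  | zero =>
    rw [Nat.zero_mul, dr_zero]
    refine ⟨?_, [], rfl, by simp⟩
    rw [hκ]; exact (h.per_lt_app _).le
  | succ n ih =>
    obtain ⟨h1, v, hv, hκv⟩ := ih fun t ht => hblk t (by omega)
    obtain ⟨c, z, hz⟩ := hblk n (by omega)
    have h2 : (if c = 0 then d else d').length = d.length := by
      split_ifs
      exacts [rfl, h.length_eq.symm]
    have h3 : dr ((n + 1) * d.length) κ = z := by
      rw [Nat.succ_mul, Nat.add_comm (n * d.length), ← dr_dr, hz, ← h2, dr_app]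
    rw [h3]
    refine ⟨?_, v ++ [c], by simp [hv], ?_⟩
    · by_cases hc : c = 0
      · rw [hz, if_pos hc, ← h.app_per_lower, app_le_app_pos h.sgn_lower] at h1
        exact h1
      · have h4 := hmax (n * d.length)
        rw [hz, if_neg hc, hκ, app_le_app_neg h.sgn_upper] at h4
        exact hl.trans h4
    · rw [tuning_append, tuning_cons, tuning_nil, List.append_nil, append_app, ← hz]
      exact hκv

/-- An irreducible prefix of `w ^ ∞` is not a power of `m`, if a letter `N` follows within or just
after it. -/
lemma IsMinWord.ne_wpow_of_prefix {m w f : Word N} {ξ : Sq O} {k i : ℕ} (hm : IsMinWord Γ O m)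
    (hw : PrimeWord Γ O m w) (hf : f ≠ []) (hirr : IrreducibleWord f) (hκ : per O w = f ⌢ ξ)
    (hi : 0 < i) (hif : i ≤ f.length) (hN : per O w i = Fin.last N) : f ≠ wpow m k := by
  rintro rfl
  have hk := eq_one_of_irreducible_wpow hf hirr
  subst hk
  rw [wpow_one] at hκ hif
  rcases hif.lt_or_eq with hlt | rfl
  · have h1 : per O m i = Fin.last N := by
      rw [← hN, hκ]
      conv_lhs => rw [← app_per hm.1.ne_nil]
      rw [app_lt hlt, app_lt hlt]
    have := Nat.le_of_dvd hi (hm.dvd_of_first h1)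
    omega
  · have hξ : ξ 0 = Fin.last N := by
      rw [← hN, hκ]
      have := app_add m ξ 0
      rw [zero_add] at this
      exact this.symm
    rcases hm.above_or_eq hw.adm.1.periodic.isPath hw.adm.1.periodic.per_first hw.adm.1.dr_le with
      h1 | h1
    · refine h1.not_app (dr 1 ξ) ?_
      rw [hκ, append_app]
      congr 1
      conv_lhs => rw [← tk_app_dr 1 ξ]
      congr 1
      simp [tk, hξ]
    · exact hw.per_ne hm h1

/-- The inductive step: if `a` is a border of `w` and the border tail `ℓ` in `w ^ ∞ = a ℓ` is at
least `m ^ ∞`, then some sequence ending in `m ^ ∞` separates `ℓ` from `w ^ ∞`.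

Let `(d, d')` be the pair from which the longest negative extremal irreducible prefix `f` of `w` is
tuned. If `ℓ < d ^ ∞` then approximants of `d ^ ∞` do. Otherwise let `w ^ ∞ = d' l`. If
`l < d ^ ∞` then `f = d' d ^ i`, and `f` followed by approximants of `d ^ ∞` does. If `l ≥ d ^ ∞`,
then `w ^ ∞` is followed through its blocks `d` and `d'`. The blocks cannot fill a period, as `w` is
not renormalizable; and at the first gap `Gap.prolong` applies, where a negative extremal prefix
would contradict the choice of `f`. -/
lemma PrimeWord.exists_between {m w q a y : Word N} (htun : TunableWith Γ O m)
    (hw : PrimeWord Γ O m w)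
    (IH : ∀ e, PrimeWord Γ O m e → e.length < w.length → Approximable Γ O m e)
    (hay : w = a ++ y) (hqa : w = q ++ a) (ha : a ≠ []) (hy : y ≠ [])
    (hμ : per O m ≤ y ⌢ per O w) :
    ∃ c, EndsBelow Γ m (per O w) c ∧ y ⌢ per O w < c ∧ c < per O w := by
  classical
  have hm := htun.1
  have hwx := hw.adm.1
  have hwne := hwx.periodic.ne_nil
  have hmax := hwx.dr_le
  have hirr := hw.irr
  set κ := per O w with hκdef
  have hκa : κ = a ⌢ y ⌢ κ := by
    conv_lhs => rw [hκdef, ← app_per hwne]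
    conv_lhs => arg 1; rw [hay]
    rw [append_app]
  set ℓ := y ⌢ κ with hℓ
  have hdra : dr a.length κ = ℓ := by conv_lhs => rw [hκa, dr_app]
  have hla := List.length_pos_iff.2 ha
  have hly := List.length_pos_iff.2 hy
  have hlw : w.length = a.length + y.length := by rw [hay, List.length_append]
  have hlq : q.length = y.length := by
    have := congrArg List.length hqa
    rw [List.length_append] at this
    omega
  have hq : q ≠ [] := List.length_pos_iff.1 (by omega)
  have hℓ0 : ℓ 0 = Fin.last N := first_eq_last_of_le hμ hm.1.per_first
  have hκN : κ a.length = Fin.last N := by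
    have := congrFun hdra 0
    rw [hℓ0] at this
    simpa [dr] using this
  have has := hwx.border_sgn hirr hay hqa ha hy
  obtain ⟨hax, hairr⟩ := hwx.border_extremal hirr hay hqa ha hy hℓ0
  have htka : tk a.length κ = a := by conv_lhs => rw [hκa, tk_app]
  have htkw : tk w.length κ = w := tk_per hwne
  -- the longest negative extremal irreducible prefix
  let P : ℕ → Prop := fun n => n < w.length ∧ Extremal Γ O (tk n κ) ∧ IrreducibleWord (tk n κ) ∧
    sgn O (tk n κ) = -1
  have hPa : P a.length := ⟨by omega, by rwa [htka], by rwa [htka], by rwa [htka]⟩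
  set f := Nat.findGreatest P w.length with hf
  have hPf : P f := Nat.findGreatest_spec (P := P) (by omega : a.length ≤ w.length) hPa
  have hfmax : ∀ n, P n → n ≤ f := fun n hn => Nat.le_findGreatest hn.1.le hn
  have haf : a.length ≤ f := hfmax _ hPa
  obtain ⟨hfw, hfx, hfirr, hfs⟩ := hPf
  have hκf : κ = tk f κ ⌢ dr f κ := (tk_app_dr f κ).symm
  have hfm : ∀ k, tk f κ ≠ wpow m k := fun k =>
    hm.ne_wpow_of_prefix hw hfx.periodic.ne_nil hfirr hκf hla (by rwa [length_tk]) hκN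
  have ham : ∀ k, a ≠ wpow m k := fun k =>
    hm.ne_wpow_of_prefix hw ha hairr hκa hla le_rfl hκN
  obtain ⟨d, d', v₀, hd, hfd, hren, happ⟩ := exists_outer_pair htun hfx hfirr hfs hfm
    fun e he hl => IH e he (hl.trans_lt (by rwa [length_tk]))
  obtain ⟨h, h', u, hh, hau, -, happ'⟩ := exists_outer_pair htun hax hairr has ham
    fun e he hl => IH e he (by omega)
  have hp := hd.pair
  have hdl := List.length_pos_iff.2 hp.ne_nil
  -- a pair whose lower word gives a sequence above `ℓ` suffices
  have settle : ∀ c c' : Word N, ∀ z : Sq O, TuningPair Γ O c c' → Approximable Γ O m c →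
      c.length < w.length → κ = c' ⌢ z → per O c < ℓ ∨
      ∃ c, EndsBelow Γ m κ c ∧ ℓ < c ∧ c < κ := by
    intro c c' z hc hca hcl hcz
    rcases lt_trichotomy (per O c) ℓ with h1 | h1 | h1
    · exact Or.inl h1
    · exact absurd (hdra.trans h1.symm) (hirr.dr_ne_per hc.ne_nil hcl _)
    · exact Or.inr (hca.exists_between hc.ne_nil (hcz ▸ hc.per_lt_app z) h1)
  have hfd' : tk f κ = d' ++ tuning d d' v₀ := by rw [hfd, tuning_one_cons]
  have hfl : f = d.length + v₀.length * d.length := by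
    have := congrArg List.length hfd'
    rwa [length_tk, List.length_append, length_tuning hp.length_eq, ← hp.length_eq] at this
  set ξ := dr f κ with hξ
  set l := tuning d d' v₀ ⌢ ξ with hl
  have hκl : κ = d' ⌢ l := by
    conv_lhs => rw [hκf, hfd', append_app]
  have hdw : d.length < w.length := by omega
  rcases settle d d' l hp happ hdw hκl with hδℓ | hdone
  swap
  · exact hdone
  have hal : a.length = (u.length + 1) * h.length := by
    rw [hau, length_tuning hh.pair.length_eq, List.length_cons]
  have hhw : h.length < w.length := by
    have : h.length ≤ (u.length + 1) * h.length := Nat.le_mul_of_pos_left _ (by omega)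
    omega
  rcases settle h h' (tuning h h' u ⌢ ℓ) hh.pair happ' hhw (by
    rw [← append_app, ← tuning_one_cons, ← hau]; exact hκa) with hηℓ | hdone
  swap
  · exact hdone
  -- the border is at least as long as the pair
  have hda : d.length ≤ a.length := by
    by_contra hc
    obtain ⟨t, ht, hℓt⟩ := exists_append_of_app_eq (hκa.symm.trans hκl) (by
      rw [← hp.length_eq]; omega)
    have htne : t ≠ [] := by
      rintro rfl
      rw [List.append_nil] at ht
      rw [← ht, ← hp.length_eq] at hc
      exact hc le_rfl
    have h1 := hd
    rw [ht] at h1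
    have h2 := h1.suffix_app_lt has htne l
    rw [← hℓt] at h2
    exact lt_asymm h2 hδℓ
  by_cases hlδ : per O d ≤ l
  swap
  · -- `κ = d' d ^ i ξ` with `ξ < d ^ ∞`
    have hξδ : ξ < per O d := by
      by_contra hc
      exact hlδ (hp.le_tuning_app v₀ (not_lt.1 hc))
    obtain ⟨i, hi⟩ : ∃ i, tuning d d' v₀ = wpow d i := by
      rcases hp.le_tuning_or v₀ with h1 | h1
      · exact absurd (h1 ξ) hlδ
      · exact h1
    rw [hi] at hfd'
    obtain ⟨t, ht, hℓt⟩ := exists_append_of_app_eq (hκa.symm.trans hκf) (by rwa [length_tk])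
    have htne : t ≠ [] := by
      rintro rfl
      rw [nil_app] at hℓt
      rw [hℓt] at hδℓ
      exact lt_asymm hδℓ hξδ
    rw [hfd'] at hκf hfx hfirr ht
    rw [hℓt]
    exact happ.exists_of_neg hd hmax hfx hfirr hκf hξδ ht ha htne has
  -- the first block that is not a copy of `d` or `d'`
  let Q : ℕ → Prop := fun t => ∃ (c : Fin (1 + 1)) (z : Sq O), dr (t * d.length) κ =
      (if c = 0 then d else d') ⌢ z
  have hprefix : ∀ n, (∀ t < n, Q t) → per O d ≤ dr (n * d.length) κ ∧
      ∃ v : Word 1, v.length = n ∧ κ = tuning d d' v ⌢ dr (n * d.length) κ := fun n hn =>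
    hp.exists_tuning_prefix hmax hκl hlδ hn
  have hκnb : ¬ κ ≪ d' := fun h1 => h1.not_app _ hκl
  have hdrw : dr w.length κ = κ := dr_per hwne
  have hδκ : per O d < κ := hκl ▸ hp.per_lt_app l
  have hex : ∃ t, t * d.length < w.length ∧ ¬ Q t := by
    by_contra hc
    push Not at hc
    set k := w.length / d.length with hk
    have hkl : k * d.length ≤ w.length := Nat.div_mul_le_self _ _
    have hlt' : w.length < (k + 1) * d.length := by
      have h1 := Nat.mod_add_div' w.length d.length
      have h2 := Nat.mod_lt w.length hdl
      rw [← hk] at h1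
      rw [Nat.succ_mul]
      omega
    rcases hkl.eq_or_lt with heq | hlt
    · -- the period is a multiple of the block length: `w` is tuned
      obtain ⟨-, v, hv, hκv⟩ := hprefix k fun t ht => hc t (by
        rw [← heq]; exact Nat.mul_lt_mul_of_pos_right ht hdl)
      have hwv : w = tuning d d' v := by
        rw [← htkw, hκv, ← heq, ← hv, ← length_tuning hp.length_eq, tk_app]
      refine hw.not_ren ?_
      have h1 := hw.adm
      rw [hκdef] at hδκ
      rw [hwv] at h1 hδκ ⊢
      exact hp.renormalizable_of_tuning h1 hδκ
    · -- the period ends inside a block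
      obtain ⟨b, hb⟩ := Nat.exists_eq_add_of_le hlt.le
      obtain ⟨h1, -⟩ := hprefix (k + 1) fun t ht => hc t (by
        refine lt_of_le_of_lt (Nat.mul_le_mul_right _ (by omega : t ≤ k)) hlt)
      obtain ⟨c, z, hz⟩ := hc k hlt
      set B := if c = 0 then d else d' with hB
      have hBl : B.length = d.length := by
        rw [hB]
        split_ifs
        exacts [rfl, hp.length_eq.symm]
      have h2 : dr ((k + 1) * d.length) κ = z := by
        rw [Nat.succ_mul, Nat.add_comm (k * d.length), ← dr_dr, hz, ← hBl, dr_app]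
      rw [h2] at h1
      have hbl : b < B.length := by
        rw [hBl]
        rw [Nat.succ_mul] at hlt'
        omega
      have h4 : (B.take b).length = b := by rw [List.length_take]; omega
      have h5 : κ = B.drop b ⌢ z := by
        conv_lhs => rw [← hdrw, hb, add_comm, ← dr_dr, hz, ← List.take_append_drop b B, append_app]
        conv_lhs => arg 1; rw [← h4]
        rw [dr_app]
      have h6 := hd.below_of_token (c := c) (g := B.take b) (t := B.drop b)
        (List.take_append_drop b B).symm (by
          intro h
          rw [h, List.length_nil] at h4
          omega) (by rw [Ne, List.drop_eq_nil_iff]; omega) h1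
      rw [← h5] at h6
      exact hκnb h6
  obtain ⟨n, ⟨hnw, hnQ⟩, hnmin⟩ : ∃ n, (n * d.length < w.length ∧ ¬ Q n) ∧ ∀ t < n, Q t := by
    refine ⟨Nat.find hex, Nat.find_spec hex, fun t ht => ?_⟩
    by_contra hc
    refine Nat.find_min hex ht ⟨lt_trans ?_ (Nat.find_spec hex).1, hc⟩
    exact Nat.mul_lt_mul_of_pos_right ht hdl
  obtain ⟨hxδ, v, hv, hκv⟩ := hprefix n hnmin
  have hv₀n : v₀.length + 1 ≤ n := by
    by_contra hc
    refine hnQ ?_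
    have := tuning_block hp.length_eq (u := 1 :: v₀) (t := n)
      (by rw [List.length_cons]; omega) ξ
    rwa [← hfd, ← hκf] at this
  obtain ⟨v, rfl⟩ : ∃ v', v = 1 :: v' := by
    cases v with
    | nil => simp at hv; omega
    | cons c v =>
      refine ⟨v, ?_⟩
      congr 1
      by_contra hc
      have hc0 : c = 0 := by
        have h1 := c.isLt
        have h2 : (c : ℕ) ≠ 1 := fun e => hc (Fin.ext e)
        ext
        simp
        omega
      rw [tuning_cons, if_pos hc0, append_app] at hκv
      exact absurd (hκv.symm.trans hκl) (hp.app_lt _ _).ne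
  set x := dr (n * d.length) κ with hx
  have hgap : Gap Γ O d d' v x := by
    refine ⟨hd, by rw [← hκv]; exact hmax, ?_, ?_⟩
    · refine above_of_le (z := per O d) (by rwa [hp.app_per_lower]) fun z hz => hnQ ⟨0, z, ?_⟩
      rw [if_pos rfl]; exact hz
    · refine below_of_le (z := l) (by rw [← hκl]; exact hmax _) fun z hz => hnQ ⟨1, z, ?_⟩
      rw [if_neg (by decide)]; exact hz
  have hBl : (tuning d d' (1 :: v)).length = n * d.length := by
    rw [length_tuning hp.length_eq, hv]
  have hfB : f ≤ n * d.length := by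
    have := Nat.mul_le_mul_right d.length hv₀n
    rw [Nat.succ_mul] at this
    omega
  have hprol := hgap.prolong (p := w.length) (by rw [← hκv]; exact hwx.periodic.isPath)
    (by rw [← hκv]; exact hdrw) (by rw [← hκv, htkw]; exact hw.adm.2) (by rwa [hBl])
  rw [← hκv, hBl, htkw] at hprol
  rcases hprol with ⟨F, x', hF, hBF, hFw, hFs, hFx, hFirr⟩ | ⟨F, x', hF, hBF, hx', hFs, hsuf⟩ |
    ⟨e, K, j, he, hdK, hj0, hjK, hwB⟩
  · have h1 : tk F.length κ = F := by rw [hF, tk_app]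
    have h2 := hfmax F.length ⟨hFw, by rwa [h1], by rwa [h1], by rwa [h1]⟩
    omega
  · obtain ⟨T, hT, hℓT⟩ := exists_append_of_app_eq (hκa.symm.trans hF) (by omega)
    have hTne : T ≠ [] := by
      rintro rfl
      rw [List.append_nil] at hT
      rw [hT] at hBF
      omega
    refine happ.exists_of_pos hp.ext.periodic hwx.periodic.isPath hF
      (lt_of_le_of_ne hx' fun h1 => ?_) hFs ha hTne hT hℓT hsuf hδκ
    refine hirr.dr_ne_per (O := O) hp.ne_nil hdw F.length ?_
    rw [h1, ← hκdef]
    conv_lhs => rw [hF, dr_app]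
  · exfalso
    refine hd.false_of_root_power hh hren he hdK hj0 hjK (κ := κ) (v := v) (q := q) (a := a)
      (y := y) (u := 1 :: u) ?_ (hwB ▸ hqa) (hwB ▸ hay) hq hau hda hδℓ hηℓ
    rw [← append_app, ← hwB, hκdef, app_per hwne]

/-- There is a sequence below `w ^ ∞` that lies above all border tails. -/
lemma PrimeWord.exists_separating {m w : Word N} (htun : TunableWith Γ O m)
    (hw : PrimeWord Γ O m w)
    (IH : ∀ e, PrimeWord Γ O m e → e.length < w.length → Approximable Γ O m e) :
    ∃ c, EndsBelow Γ m (per O w) c ∧ c 0 = Fin.last N ∧ c < per O w ∧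
      ∀ s t q, w = s ++ t → w = q ++ s → s ≠ [] → t ≠ [] → t ⌢ per O w < c := by
  classical
  have hm := htun.1
  have hwx := hw.adm.1
  have hμκ : per O m < per O w :=
    lt_of_le_of_ne (hm.per_le hwx.periodic.isPath hwx.periodic.per_first hwx.dr_le)
      (hw.per_ne hm).symm
  let S : Finset ℕ := (Finset.range w.length).filter fun i => 0 < i ∧ ∃ q, w = q ++ w.take i
  have hS : ∀ s t q, w = s ++ t → w = q ++ s → s ≠ [] → t ≠ [] →
      ∃ i ∈ S, w.drop i = t := by
    intro s t q h1 h2 h3 h4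
    have hs := List.length_pos_iff.2 h3
    have ht := List.length_pos_iff.2 h4
    have hl : w.length = s.length + t.length := by rw [h1, List.length_append]
    have hst : w.take s.length = s ∧ w.drop s.length = t := by
      constructor
      · conv_lhs => rw [h1]
        exact List.take_left
      · conv_lhs => rw [h1]
        exact List.drop_left
    exact ⟨s.length, Finset.mem_filter.2 ⟨Finset.mem_range.2 (by omega), hs, q, by
      rw [hst.1]; exact h2⟩, hst.2⟩
  by_cases hall : ∀ i ∈ S, w.drop i ⌢ per O w < per O m
  · refine ⟨per O m, ⟨hm.1.isPath, ⟨[], rfl⟩, fun i => (hm.dr_le i).trans hμκ.le⟩,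
      hm.1.per_first, hμκ, fun s t q h1 h2 h3 h4 => ?_⟩
    obtain ⟨i, hi, rfl⟩ := hS s t q h1 h2 h3 h4
    exact hall i hi
  · push Not at hall
    obtain ⟨i₀, hi₀, hle₀⟩ := hall
    obtain ⟨i, hi, hmax⟩ := Finset.exists_max_image S (fun i => w.drop i ⌢ per O w) ⟨i₀, hi₀⟩
    have hμ := hle₀.trans (hmax i₀ hi₀)
    obtain ⟨hiw, hi0, q, hq⟩ := Finset.mem_filter.1 hi
    rw [Finset.mem_range] at hiw
    obtain ⟨c, hc, hlt, hcκ⟩ := hw.exists_between htun IH (List.take_append_drop i w).symm hq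
      (by
        intro h
        have := congrArg List.length h
        rw [List.length_take, List.length_nil] at this
        omega)
      (by rw [Ne, List.drop_eq_nil_iff]; omega) hμ
    refine ⟨c, hc, first_eq_last_of_le (hμ.trans hlt.le) hm.1.per_first, hcκ,
      fun s t q h1 h2 h3 h4 => ?_⟩
    obtain ⟨j, hj, rfl⟩ := hS s t q h1 h2 h3 h4
    exact (hmax j hj).trans_lt hlt

open Filter in
/-- Sequences `w ^ n u m ^ ∞` that strictly dominate all their shifts. The tail `c = u m ^ ∞` is the
separating sequence: a shift that starts with a border `s` of `w = s t` is compared with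
`w ^ n c` through `t w ^ (n - 1) c < c`, as `s` is negative. -/
lemma PrimeWord.exists_dominating {m w : Word N} (htun : TunableWith Γ O m)
    (hw : PrimeWord Γ O m w)
    (IH : ∀ e, PrimeWord Γ O m e → e.length < w.length → Approximable Γ O m e) :
    ∃ (u : Word N) (n₀ : ℕ), ∀ n, n₀ ≤ n →
      IsPath Γ (wpow w n ⌢ u ⌢ per O m) ∧ (wpow w n ⌢ u ⌢ per O m) 0 = Fin.last N ∧
      wpow w n ⌢ u ⌢ per O m < per O w ∧
      ∀ i, 0 < i → dr i (wpow w n ⌢ u ⌢ per O m) < wpow w n ⌢ u ⌢ per O m := by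
  have hm := htun.1
  have hwx := hw.adm.1
  have hwne := hwx.periodic.ne_nil
  have hwl := List.length_pos_iff.2 hwne
  have hpos : ∀ n, sgn O (wpow w n) = 1 := fun n => by rw [sgn_wpow, hw.adm.2, one_pow]
  have hfix : ∀ n, wpow w n ⌢ per O w = per O w := wpow_app_of_app (app_per hwne)
  obtain ⟨c, ⟨hcpath, ⟨u, hu⟩, hcle⟩, hc0, hcκ, hcb⟩ := hw.exists_separating htun IH
  have hμκ : per O m < per O w :=
    lt_of_le_of_ne (hm.per_le hwx.periodic.isPath hwx.periodic.per_first hwx.dr_le)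
      (hw.per_ne hm).symm
  have hgrow : ∀ n, n ≠ 0 → c < wpow w n ⌢ c := fun n hn =>
    self_lt_app_of_lt (wpow_ne_nil hwne hn) (hpos n) (hfix n) hcκ
  have hdru : ∀ k, dr (u.length + k) c = dr k (per O m) := fun k => by
    rw [hu, dr_length_add_app]
  -- the shifts of `c` fall below `w ^ n c`
  have hE1 : ∀ᶠ n in atTop, ∀ i, ∀ z : Sq O, dr i c < wpow w n ⌢ z := by
    have h1 : ∀ i, dr i c < per O w := by
      intro i
      refine lt_of_le_of_ne (hcle i) fun h => ?_
      have hml := List.length_pos_iff.2 hm.1.ne_nil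
      have h2 : u.length + i * (m.length - 1) + i = u.length + i * m.length := by
        obtain ⟨k, hk⟩ := Nat.exists_eq_succ_of_ne_zero hml.ne'
        rw [hk, Nat.succ_sub_one, Nat.mul_succ, add_assoc]
      refine hw.dr_ne_min hm (u.length + i * (m.length - 1)) ?_
      rw [← h, dr_dr, h2, hdru, dr_mul_of_dr (dr_per hm.1.ne_nil)]
    have h2 : ∀ᶠ n in atTop, ∀ i ∈ {i | i < u.length}, ∀ z : Sq O, dr i c < wpow w n ⌢ z := by
      rw [eventually_all_finite (Set.finite_lt_nat _)]
      exact fun i _ => eventually_atTop.2 (eventually_lt_wpow hwne (h1 i))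
    filter_upwards [h2, eventually_atTop.2 (eventually_lt_wpow hwne hμκ)] with n h3 h4 i z
    by_cases hi : i < u.length
    · exact h3 i hi z
    · obtain ⟨k, rfl⟩ := Nat.exists_eq_add_of_le (not_lt.1 hi)
      rw [hdru]
      exact (hm.dr_le k).trans_lt (h4 z)
  -- the border tails stay below `c` when `w ^ ∞` is replaced by `w ^ n c`
  have hE2 : ∀ᶠ n in atTop, ∀ s t q, w = s ++ t → w = q ++ s → s ≠ [] → t ≠ [] →
      ∀ z : Sq O, t ⌢ wpow w n ⌢ z < c := by
    have h2 : ∀ᶠ n in atTop, ∀ i ∈ {i | i < w.length}, w.drop i ⌢ per O w < c →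
        ∀ z : Sq O, w.drop i ⌢ wpow w n ⌢ z < c := by
      rw [eventually_all_finite (Set.finite_lt_nat _)]
      intro i _
      by_cases hi : w.drop i ⌢ per O w < c
      · obtain ⟨J, -, hJ⟩ := Sq.lt_local hi
        filter_upwards [eventually_ge_atTop J] with n hn _ z
        refine hJ _ _ (tk_mono (n := (w.drop i).length + J) (by omega) ?_) rfl
        exact app_tk_congr _ (tk_wpow_app hwne (hn.trans (Nat.le_mul_of_pos_right _ hwl)) z)
      · exact Eventually.of_forall fun n h => absurd h hi
    filter_upwards [h2] with n h3 s t q h4 h5 h6 h7 z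
    have h8 : w.drop s.length = t := by
      conv_lhs => rw [h4]
      exact List.drop_left
    have h9 : s.length < w.length := by
      have := congrArg List.length h4
      rw [List.length_append] at this
      have := List.length_pos_iff.2 h7
      omega
    rw [← h8]
    exact h3 s.length h9 (h8 ▸ hcb s t q h4 h5 h6 h7) z
  obtain ⟨n₀, hn₀⟩ := eventually_atTop.1 (hE1.and hE2)
  refine ⟨u, n₀ + 1, fun n hn => ?_⟩
  obtain ⟨n, rfl⟩ : ∃ n', n = n' + 1 := ⟨n - 1, by omega⟩
  obtain ⟨-, h2⟩ := hn₀ n (by omega)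
  obtain ⟨h1, -⟩ := hn₀ (n + 1) (by omega)
  rw [← hu]
  set x := wpow w (n + 1) ⌢ c with hx
  have hxw : x = w ⌢ wpow w n ⌢ c := by rw [hx, wpow_succ, append_app]
  have hxκ : x < per O w := by
    rw [← hfix (n + 1), hx]
    exact (app_lt_app_pos (hpos _)).2 hcκ
  refine ⟨?_, ?_, hxκ, fun i hi => ?_⟩
  · refine IsPath.exchange (x := per O w) ?_ hcpath ?_
    · rw [hfix]; exact hwx.periodic.isPath
    · rw [hc0, hwx.periodic.per_first]
  · rw [hxw]; exact hwx.periodic.app_first _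
  · by_cases hil : (wpow w (n + 1)).length ≤ i
    · obtain ⟨k, rfl⟩ := Nat.exists_eq_add_of_le hil
      rw [hx, dr_length_add_app]
      exact h1 k c
    · have hsplit : wpow w (n + 1) ++ [] =
          (wpow w (n + 1)).take i ++ (wpow w (n + 1)).drop i := by simp
      have hdne : (wpow w (n + 1)).drop i ≠ [] := by rw [Ne, List.drop_eq_nil_iff]; omega
      have hdr : dr i x = (wpow w (n + 1)).drop i ⌢ c := by
        have h3 : ((wpow w (n + 1)).take i).length = i := by rw [List.length_take]; omega
        conv_lhs => rw [hx, ← List.take_append_drop i (wpow w (n + 1)), append_app]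
        conv_lhs => arg 1; rw [← h3]
        rw [dr_app]
      have hdl : ((wpow w (n + 1)).drop i).length < (n + 1) * w.length := by
        rw [List.length_drop, length_wpow]
        rw [length_wpow] at hil
        omega
      rw [hdr]
      rcases wpow_append_eq_append hsplit with ⟨q', h3, -⟩ | ⟨g, t, j, h3, h4, h5⟩
      · exact absurd (List.append_eq_nil_iff.1 h3.symm).2 hdne
      rw [List.append_nil] at h5
      rw [h5] at hdl ⊢
      rw [append_app]
      rw [List.length_append, length_wpow] at hdl
      by_cases hg : g = []
      · subst hg
        rw [List.nil_append] at h3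
        subst h3
        have hjn : j < n := by
          by_contra hc
          have := Nat.mul_le_mul_right w.length (not_lt.1 hc)
          rw [Nat.succ_mul] at hdl
          omega
        obtain ⟨l, rfl⟩ := Nat.exists_eq_add_of_lt hjn
        rw [hxw, app_lt_app_pos hw.adm.2, add_assoc, wpow_add, append_app, app_lt_app_pos (hpos j)]
        exact hgrow _ (by omega)
      · have hgl := List.length_pos_iff.2 hg
        have htl : t.length ≤ w.length := by
          have := congrArg List.length h3
          rw [List.length_append] at this
          omega
        by_cases ht : tk t.length (per O w) = t
        · -- a border, which is negative
          obtain ⟨r, hr⟩ : ∃ r, w = t ++ r := by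
            refine ⟨w.drop t.length, ?_⟩
            conv_lhs => rw [← List.take_append_drop t.length w]
            congr 1
            rw [← ht, length_tk, ← take_tk htl, tk_per hwne]
          have hrne : r ≠ [] := by
            rintro rfl
            have := congrArg List.length hr
            have := congrArg List.length h3
            rw [List.length_append] at *
            simp at *
            omega
          have hts := hwx.border_sgn hw.irr hr h3 h4 hrne
          have h6 := h2 t r g hr h3 h4 hrne c
          rw [hxw]
          conv_rhs => arg 1; rw [hr]
          rw [append_app, app_lt_app_neg hts]
          by_cases hj : j = 0
          · subst hj
            simpa using h6
          · exact h6.trans (hgrow j hj)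
        · have h6 := hwx.suffix_lt_of_ne h3 ht (wpow w j ⌢ c) (dr t.length x)
          have h7 : tk t.length x = tk t.length (per O w) :=
            tk_wpow_app hwne (htl.trans (Nat.le_mul_of_pos_left _ (by omega))) c
          rwa [← h7, tk_app_dr] at h6

/-- Every prime word is approximable, by induction on its length. -/
lemma PrimeWord.approximable {m w : Word N} (htun : TunableWith Γ O m)
    (hw : PrimeWord Γ O m w) : Approximable Γ O m w := by
  obtain ⟨u, n₀, h⟩ := hw.exists_dominating htun fun e he hl => PrimeWord.approximable htun he
  intro n
  obtain ⟨h1, h2, h3, h4⟩ := h (n + n₀) (by omega)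
  refine ⟨wpow w n₀ ⌢ u ⌢ per O m, ?_⟩
  rw [← append_app, ← wpow_add]
  refine ⟨h1, ⟨wpow w (n + n₀) ++ u, by rw [append_app]⟩, fun i => ?_⟩
  rcases Nat.eq_zero_or_pos i with rfl | hi
  · rw [dr_zero]; exact h3.le
  · exact ((h4 i hi).trans h3).le
termination_by w.length

/-! ### Dominant words -/

lemma drop_tk (i j : ℕ) (x : Sq O) : (tk (i + j) x).drop i = tk j (dr i x) := by
  rw [tk_add]
  conv_lhs => arg 1; rw [← length_tk i x]
  exact List.drop_left

open Filter in
/-- If `u m ^ ∞` strictly dominates its shifts, then `u m ^ M` is dominant for large `M`: a suffix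
that starts in the last copies of `m` starts with `m N`, which is the least word of its length. -/
lemma IsMinWord.exists_dominant {m u : Word N} (hm : IsMinWord Γ O m)
    (hpath : IsPath Γ (u ⌢ per O m)) (h0 : (u ⌢ per O m) 0 = Fin.last N)
    (hlt : ∀ i, 0 < i → dr i (u ⌢ per O m) < u ⌢ per O m) :
    ∃ M, Dominant Γ O (u ++ wpow m M) := by
  set x := u ⌢ per O m with hx
  have hmne := hm.1.ne_nil
  have hml := List.length_pos_iff.2 hmne
  have hle : ∀ n, dr n x ≤ x := fun n => by
    rcases Nat.eq_zero_or_pos n with rfl | hn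
    · rw [dr_zero]
    · exact (hlt n hn).le
  obtain ⟨J, hJ⟩ : ∃ J, ∀ i ∈ {i | i < u.length}, 0 < i → tk J (dr i x) ≠ tk J x := by
    have : ∀ᶠ J in atTop, ∀ i ∈ {i | i < u.length}, 0 < i → tk J (dr i x) ≠ tk J x := by
      rw [eventually_all_finite (Set.finite_lt_nat _)]
      intro i _
      by_cases hi : 0 < i
      · obtain ⟨J, hJ, -⟩ := Sq.lt_local (hlt i hi)
        filter_upwards [eventually_ge_atTop J] with n hn _ h
        exact hJ (tk_mono hn h)
      · exact Eventually.of_forall fun n h => absurd h hi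
    exact this.exists
  obtain ⟨W, hW⟩ : ∃ W, W = u ++ wpow m (J + 1) := ⟨_, rfl⟩
  have hWx : x = W ⌢ per O m := by
    rw [hx, hW, append_app, wpow_app_of_app (app_per hmne)]
  have hWl : W.length = u.length + (J + 1) * m.length := by
    rw [hW, List.length_append, length_wpow]
  have hWne : W ≠ [] := by
    intro h
    have h1 := congrArg List.length h
    rw [hWl, List.length_nil] at h1
    have := Nat.mul_pos (by omega : 0 < J + 1) hml
    omega
  have hJm : J + 1 ≤ (J + 1) * m.length := Nat.le_mul_of_pos_right _ hml
  refine ⟨J + 1, ?_⟩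
  rw [← hW]
  refine ⟨periodic_of_isPath (O := O) hWne (hWx ▸ hpath) (hWx ▸ h0) hm.1.per_first,
    fun k hk hkW => ?_⟩
  obtain ⟨i, hi⟩ : ∃ i, W.length + 1 = i + k := ⟨W.length + 1 - k, by omega⟩
  have hWN : W ++ [Fin.last N] = tk (W.length + 1) x := by
    rw [hWx, tk_length_add_app]
    congr 1
    simp [tk, hm.1.per_first (O := O)]
  have hr : (W ++ [Fin.last N]).rtake k = tk k (dr i x) := by
    rw [List.rtake, hWN, length_tk, hi, Nat.add_sub_cancel, drop_tk]
  have ht : W.take k = tk k x := by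
    rw [← take_tk hkW, hWx, tk_app]
  rw [hr, ht, wordLT_tk_iff]
  refine ⟨hlt i (by omega), fun heq => ?_⟩
  by_cases hiu : i < u.length
  · exact hJ i hiu (by omega) (tk_mono (by omega) heq)
  · obtain ⟨i', rfl⟩ := Nat.exists_eq_add_of_le (not_lt.1 hiu)
    rw [hx, dr_length_add_app, ← hx] at heq
    have h1 : dr i' (per O m) 0 = Fin.last N := by
      rw [tk_eq_iff.1 heq 0 (by omega)]
      exact h0
    obtain ⟨c, rfl⟩ := hm.dvd_of_first (O := O) (i := i') (by simpa [dr] using h1)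
    rw [mul_comm, dr_mul_of_dr (dr_per hmne)] at heq
    have hcJ : c < J + 1 := by
      by_contra hc
      have := Nat.mul_le_mul_right m.length (not_lt.1 hc)
      rw [mul_comm c] at this
      omega
    have hkm : m.length + 1 ≤ k := by
      have := Nat.mul_le_mul_right m.length (Nat.succ_le_of_lt hcJ)
      rw [Nat.succ_mul, mul_comm c] at this
      omega
    have h2 := tk_mono hkm heq
    have h3 : tk (m.length + 1) (per O m) = m ++ [Fin.last N] := by
      conv_lhs => rw [← app_per hmne, tk_length_add_app]
      congr 1
      simp [tk, hm.1.per_first (O := O)]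
    rcases hm.above_or_eq hpath h0 hle with h4 | h4
    · have h5 := exists_app_of_tk (u := m ++ [Fin.last N]) (x := x) (by
        rw [List.length_append, List.length_singleton, ← h2, h3])
      exact h4.not_app _ h5
    · have h5 := hlt m.length hml
      rw [h4, dr_per hmne] at h5
      exact lt_irrefl _ h5

end KneadingWords

theorem mainTheorem2 {N : ℕ} (Γ : Digraph (Fin (N + 1))) (O : Fin (N + 1) → ℤˣ)
    (hconn : KneadingWords.StronglyConnected Γ) (haper : KneadingWords.Aperiodic Γ)
    (wmin : KneadingWords.Word N) (htun : KneadingWords.TunableWith Γ O wmin)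
    (w : KneadingWords.Word N) (hadm : KneadingWords.Admissible Γ O w)
    (hirr : KneadingWords.IrreducibleWord w)
    (hren : ¬ KneadingWords.Renormalizable Γ O w)
    (hmin : ¬ ∃ k : ℕ, w = KneadingWords.wpow wmin k)
    (n : ℕ) (hn : 0 < n) :
    ∃ b : KneadingWords.Word N, KneadingWords.Dominant Γ O (KneadingWords.wpow w n ++ b) := by
  open KneadingWords in
  have hw : PrimeWord Γ O wmin w := ⟨hadm, hirr, hren, fun k hk => hmin ⟨k, hk⟩⟩
  obtain ⟨u, n₀, h⟩ := hw.exists_dominating htun fun e he _ => he.approximable htun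
  obtain ⟨h1, h2, -, h4⟩ := h (n + n₀) (by omega)
  rw [← append_app] at h1 h2 h4
  obtain ⟨M, hM⟩ := htun.1.exists_dominant h1 h2 h4
  refine ⟨wpow w n₀ ++ (u ++ wpow wmin M), ?_⟩
  rwa [wpow_add, List.append_assoc, List.append_assoc] at hM
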